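/- Let $a,b\in\mathbb R\setminus\{0\}$, let $x,y,z$ be the coordinates of $\mathbb R^3$, $\partial_1=\partial_x$, $\partial_2=\partial_y$, $\partial_3=\partial_z$, $\partial_{ij}=\partial_i\wedge\partial_j$, $\partial_{123}=\partial_1\wedge\partial_2\wedge\partial_3$, $Y_1=x\partial_1$, $Y_2=y\partial_2$, $Y_3=z\partial_3$, $Y_{ij}=Y_i\wedge Y_j$, $Y_{123}=Y_1\wedge Y_2\wedge Y_3$, $D=xyz$, $D'=xy$. **The spectral sequence.** Let $\mathcal P$ be the space of polyvector fields on $\mathbb R^3$ with coefficients in $\mathbb R[[x,y,z]]$ and $$\Lambda_4=\Lambda_{4,I}+\Lambda_{4,II},\qquad \Lambda_{4,I}=aY_{23}+aY_{31}+bY_{12},\qquad \Lambda_{4,II}=z^2\partial_{12}.$$ With the Schouten bracket put $d=[\Lambda_4,\cdot]=d'+d''$, $d'=[\Lambda_{4,I},\cdot]$, $d''=[\Lambda_{4,II},\cdot]$. A term $\frac{x^{j_1}y^{j_2}z^{j_3}}{D}\mathbf Y$, where $\mathbf Y$ is a wedge product of $c$ of the fields $Y_i$, has bidegree $(r,s)=(j_1+j_2+c,\,j_3)$.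 Let $\mathcal P^{rs}\subset\mathcal P$ be the space of polyvector fields of bidegree $(r,s)$, $\mathcal P^n$ the space of those of diagonal degree $r+s=n$, and $\mathcal P_p$ the space of those all of whose terms have $s\ge p$. Let $E_r^{pq}=Z_r^{pq}/(Z_{r-1}^{p+1,q-1}+B_{r-1}^{pq})$, with $Z_r^{pq}=\mathcal P_p\cap d^{-1}\mathcal P_{p+r}\cap\mathcal P^{p+q}$ and $B_r^{pq}=\mathcal P_p\cap d\mathcal P_{p-r}\cap\mathcal P^{p+q}$, and $d_r:E_r^{pq}\to E_r^{p+r,q+1-r}$, $[\mathfrak z]\mapsto[d\mathfrak z]$, be the spectral sequence of this filtered graded differential space. **Exponents.** If $b/a$ is a positive rational number, write $b/a=\beta/\alpha$ in lowest terms with $\alpha,\beta>0$; every $i\in\mathbb N=\{0,1,2,\dots\}$ is admissible. If $b/a=-1/\alpha$ with a positive integer $\alpha$, put $\beta=-1$; only $i=0$ and $i=1$ are admissible. In all other cases put $\alpha=1$; only $i=0$ is admissible (and $\beta$, which occurs only in the product $\beta i$, plays no role). The *Casimir indices* are all $i\in\mathbb N$ if $b/a$ is a positive rational, and only $i=0$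 otherwise. **Representatives of type 2** (of $E_2$): $D'^{\alpha i}z^{\beta i}Y_{12}$ for Casimir indices $i$; $D'^{\alpha i}z^{\beta i}Y_{123}$ for admissible $i$; $z^k\partial_{12}$ and $z^k\partial_{123}$ for $k\in\mathbb N$; and, if $b=a$, also $x^k\partial_{23}$, $y^k\partial_{31}$, $x^k\partial_{123}$, $y^k\partial_{123}$ for $k\in\mathbb N$; together with their linear combinations. **Representatives of type 1** (of $E_2$): for admissible $i$, $c\in\{0,1,2\}$ and $k=0$, the cochains $$Z^{q_{ic}-2k,p_i+2k}=\frac{\binom{\alpha i}{k}}{(2a+b)^k}D'^{\alpha i-k}z^{\beta i+2k}\begin{cases}A_{ik}&(c=0)\\ B_{ik}Y_1+C_{ik}Y_2+D_{ik}Y_3&(c=1)\\ E_{ik}Y_{23}+F_{ik}Y_{31}&(c=2)\end{cases},\qquad (q_{ic},p_i)=(2\alpha i+2+c,\ \beta i+1),$$ with arbitrary real coefficients $A_{i0},\dots,F_{i0}$, except that $A_{10}=B_{10}=C_{10}=0$ if $b/a=-1/\alpha$. (The double superscript is the bidegree.) **Theorem.** Let $n\in\mathbb N$ and consider the package of even terms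 $E_{2(n-1)\alpha+4},E_{2(n-1)\alpha+6},\dots,E_{2n\alpha+2}$ (for $n=0$, the package consists of $E_2$ only). (a) The terms of the package are canonically isomorphic: $d_r=0$ for every even $r$ with $2(n-1)\alpha+4\le r\le 2n\alpha$ (for $n\geq 1$), and for all $r\le r'$ in the package and all $p,q$ there is an isomorphism $E_{r'}^{pq}\to E_r^{pq}$ that maps the class of $\mathfrak z\in Z_{r'}^{pq}\subset Z_r^{pq}$ to the class of $\mathfrak z$. (b) Every term of the package admits the following system of representatives (one that, in each bidegree $p,q$, is contained in $Z_r^{pq}$ and in one-to-one correspondence with the classes of $E_r^{pq}$): the sums of 1. the representatives of type 2 of bidegree $(q,p)$, with $\mathbb R z^{i(2\alpha+\beta)+2}\partial_{12}$ and $\mathbb R z^{i(2\alpha+\beta)+3}\partial_{123}$ left out for all admissible $i\in\{0,\dots,n-1\}$, and 2. the representatives $Z^{q_{ic},p_i}$ of type 1 of bidegree $(q_{ic},p_i)=(q,p)$, altered as follows. * For admissible $i\ge n$, $Z^{q_{ic},p_i}$ is replaced by $\sum_{k=0}^{\alpha n}Z^{q_{ic}-2k,p_i+2k}$, where for each choice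 of the initial coefficients the coefficients with $k\ge1$ are any fixed real numbers such that for $0\le k\le\alpha n-1$ $$A_{i,k+1}=A_{ik};\qquad B_{i,k+1}+C_{i,k+1}=\frac{(\alpha i-k+1)(B_{ik}+C_{ik})-2D_{ik}}{\alpha i-k},\quad D_{i,k+1}=D_{ik};\qquad E_{i,k+1}-F_{i,k+1}=\frac{\alpha i-k+1}{\alpha i-k}(E_{ik}-F_{ik}).$$ * For admissible $i\in\{0,\dots,n-1\}$, $Z^{q_{ic},p_i}$ is replaced by $$\begin{cases}\left(D'+\frac{z^2}{2a+b}\right)^{\alpha i}z^{\beta i}A_{i0}&(c=0)\\ \left(D'+\frac{z^2}{2a+b}\right)^{\alpha i}z^{\beta i}\left(B_{i0}(Y_1+\tfrac12Y_3)+C_{i0}(Y_2+\tfrac12Y_3)\right)&(c=1)\\ D'^{\alpha i}z^{\beta i}E_{i0}(Y_{23}+Y_{31})&(c=2).\end{cases}$$ (If $2a+b=0$, only $i=0$ is admissible, and all powers of $\frac{1}{2a+b}$ that occur have exponent $0$.) -/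

import Mathlib

noncomputable section

/-! ### Filtered graded differential spaces and their spectral sequence -/

/-- A real differential space `(K, d)` with a decreasing filtration `K_p` that is compatible with
`d`, and with subspaces `K^n` (the homogeneous elements of degree `n`) on which `d` has
weight `1`. -/
structure FilteredComplex (K : Type*) [AddCommGroup K] [Module ℝ K] where
  d : K →ₗ[ℝ] K
  d_d : ∀ x, d (d x) = 0
  fil : ℤ → Submodule ℝ K
  fil_anti : Antitone fil
  d_fil : ∀ p x, x ∈ fil p → d x ∈ fil p
  deg : ℤ → Submodule ℝ K
  d_deg : ∀ n x, x ∈ deg n → d x ∈ deg (n + 1)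

namespace FilteredComplex

variable {K : Type*} [AddCommGroup K] [Module ℝ K] (C : FilteredComplex K)

/-- `Z_r^{pq} = K_p ∩ d⁻¹ K_{p+r} ∩ K^{p+q}`. -/
def Z (r p q : ℤ) : Submodule ℝ K :=
  C.fil p ⊓ (C.fil (p + r)).comap C.d ⊓ C.deg (p + q)

/-- `B_r^{pq} = K_p ∩ d K_{p-r} ∩ K^{p+q}`. -/
def B (r p q : ℤ) : Submodule ℝ K :=
  C.fil p ⊓ (C.fil (p - r)).map C.d ⊓ C.deg (p + q)

/-- The subspace `Z_{r-1}^{p+1,q-1} + B_{r-1}^{pq}`, viewed inside `Z_r^{pq}`. -/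
def bound (r p q : ℤ) : Submodule ℝ (C.Z r p q) :=
  (C.Z (r - 1) (p + 1) (q - 1) ⊔ C.B (r - 1) p q).comap (C.Z r p q).subtype

/-- `E_r^{pq} = Z_r^{pq} / (Z_{r-1}^{p+1,q-1} + B_{r-1}^{pq})`. -/
abbrev E (r p q : ℤ) : Type _ := C.Z r p q ⧸ C.bound r p q

/-- The class in `E_r^{pq}` of an element of `Z_r^{pq}`. -/
def cls (r p q : ℤ) : C.Z r p q →ₗ[ℝ] C.E r p q := (C.bound r p q).mkQ

theorem Z_le {r r' : ℤ} (h : r ≤ r') (p q : ℤ) : C.Z r' p q ≤ C.Z r p q := by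
  rintro x ⟨⟨h1, h2⟩, h3⟩
  exact ⟨⟨h1, C.fil_anti (by lia) h2⟩, h3⟩

theorem d_mem_Z (r p q : ℤ) (x : K) (hx : x ∈ C.Z r p q) :
    C.d x ∈ C.Z r (p + r) (q + 1 - r) := by
  obtain ⟨⟨_, h2⟩, h3⟩ := hx
  refine ⟨⟨h2, ?_⟩, ?_⟩
  · change C.d (C.d x) ∈ C.fil (p + r + r)
    rw [C.d_d]
    exact Submodule.zero_mem _
  · have := C.d_deg _ _ h3
    rwa [show p + r + (q + 1 - r) = p + q + 1 by ring]

/-- The map `Z_r^{pq} → Z_r^{p+r,q+1-r}` induced by `d`. -/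
def dZ (r p q : ℤ) : C.Z r p q →ₗ[ℝ] C.Z r (p + r) (q + 1 - r) :=
  C.d.restrict (C.d_mem_Z r p q)

theorem bound_le (r p q : ℤ) :
    C.bound r p q ≤ (C.bound r (p + r) (q + 1 - r)).comap (C.dZ r p q) := by
  rintro ⟨x, hx⟩ h
  obtain ⟨z, hz, y, hy, hzy⟩ := Submodule.mem_sup.mp (show x ∈ _ from h)
  change C.d x ∈ C.Z (r - 1) (p + r + 1) (q + 1 - r - 1) ⊔ C.B (r - 1) (p + r) (q + 1 - r)
  refine Submodule.mem_sup_right ?_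
  have hx2 := C.d_mem_Z r p q x hx
  obtain ⟨⟨_, w, _, hw⟩, _⟩ := hy
  refine ⟨⟨hx2.1.1, z, C.fil_anti (by lia) hz.1.1, ?_⟩, hx2.2⟩
  rw [← hzy, map_add, ← hw, C.d_d, add_zero]

/-- The differential `d_r : E_r^{pq} → E_r^{p+r,q+1-r}`, `[z] ↦ [d z]`. -/
def dE (r p q : ℤ) : C.E r p q →ₗ[ℝ] C.E r (p + r) (q + 1 - r) :=
  Submodule.mapQ _ _ (C.dZ r p q) (C.bound_le r p q)

/-- `S` is a system of representatives of `E_r^{pq}`: it consists of elements of `Z_r^{pq}`,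
and these are in one-to-one correspondence with the classes. -/
def IsRepSystem (r p q : ℤ) (S : Set K) : Prop :=
  ∃ h : S ⊆ C.Z r p q, Function.Bijective fun u : S => C.cls r p q ⟨u.1, h u.2⟩

end FilteredComplex

/-! ### Formal polyvector fields on `ℝ³` -/

/-- Formal power series in `x, y, z` (the variables with index `0, 1, 2`). -/
abbrev Coef : Type := MvPowerSeries (Fin 3) ℝ

/-- Formal polyvector fields `∑_S f_S ∂_S`, where `∂_S` is the wedge product, in increasing
order, of the `∂_i`, `i ∈ S`. -/
abbrev Polyvec : Type := Finset (Fin 3) → Coef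

namespace Polyvec

/-- The sign of the shuffle that sorts the concatenation of `T` and `U`. -/
def shuffleSign (T U : Finset (Fin 3)) : ℤ :=
  (-1) ^ ((T ×ˢ U).filter fun t => t.2 < t.1).card

/-- The wedge product. -/
def wedge (P Q : Polyvec) : Polyvec := fun S =>
  ∑ T ∈ S.powerset, shuffleSign T (S \ T) • (P T * Q (S \ T))

/-- Derivative of the coefficients with respect to the `i`-th variable. -/
def coefDer (i : Fin 3) (P : Polyvec) : Polyvec := fun S => MvPowerSeries.pderiv ℝ i (P S)

/-- Derivative from the left with respect to the odd variable `∂_i`. -/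
def leftDer (i : Fin 3) (P : Polyvec) : Polyvec := fun S =>
  if i ∈ S then 0 else (-1 : ℤ) ^ (S.filter fun j => j < i).card • P (insert i S)

/-- Derivative from the right with respect to the odd variable `∂_i`. -/
def rightDer (i : Fin 3) (P : Polyvec) : Polyvec := fun S =>
  if i ∈ S then 0 else (-1 : ℤ) ^ (S.filter fun j => i < j).card • P (insert i S)

/-- The Schouten bracket, which extends the Lie bracket of vector fields and `[V, f] = V(f)`. -/
def schouten (P Q : Polyvec) : Polyvec :=
  ∑ i, (wedge (rightDer i P) (coefDer i Q) - wedge (coefDer i P) (leftDer i Q))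

theorem wedge_add (P Q R : Polyvec) : wedge P (Q + R) = wedge P Q + wedge P R := by
  ext1 S; simp [wedge, mul_add, Finset.sum_add_distrib]

theorem wedge_smul (P Q : Polyvec) (c : ℝ) : wedge P (c • Q) = c • wedge P Q := by
  ext1 S; simp [wedge, Finset.smul_sum]

theorem add_wedge (P Q R : Polyvec) : wedge (P + Q) R = wedge P R + wedge Q R := by
  ext1 S; simp [wedge, add_mul, Finset.sum_add_distrib]

theorem coefDer_add (i : Fin 3) (P Q : Polyvec) :
    coefDer i (P + Q) = coefDer i P + coefDer i Q := by
  ext1 S; simp [coefDer]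

theorem coefDer_smul (i : Fin 3) (c : ℝ) (P : Polyvec) :
    coefDer i (c • P) = c • coefDer i P := by
  ext1 S; simp [coefDer]

theorem leftDer_add (i : Fin 3) (P Q : Polyvec) :
    leftDer i (P + Q) = leftDer i P + leftDer i Q := by
  ext1 S; by_cases h : i ∈ S <;> simp [leftDer, h]

theorem leftDer_smul (i : Fin 3) (c : ℝ) (P : Polyvec) :
    leftDer i (c • P) = c • leftDer i P := by
  ext1 S; by_cases h : i ∈ S <;> simp [leftDer, h]

theorem rightDer_add (i : Fin 3) (P Q : Polyvec) :
    rightDer i (P + Q) = rightDer i P + rightDer i Q := by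
  ext1 S; by_cases h : i ∈ S <;> simp [rightDer, h]

/-- The Lichnerowicz-Poisson coboundary operator `∂_Λ = [Λ, ·]`. -/
def coboundary (L : Polyvec) : Polyvec →ₗ[ℝ] Polyvec where
  toFun := schouten L
  map_add' P Q := by
    simp only [schouten, coefDer_add, leftDer_add, wedge_add, ← Finset.sum_add_distrib]
    exact Finset.sum_congr rfl fun i _ => by abel
  map_smul' c P := by
    simp only [schouten, coefDer_smul, leftDer_smul, wedge_smul, Finset.smul_sum, smul_sub,
      RingHom.id_apply]

theorem coboundary_add (L M : Polyvec) : coboundary (L + M) = coboundary L + coboundary M := by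
  refine LinearMap.ext fun P => ?_
  change schouten (L + M) P = schouten L P + schouten M P
  simp only [schouten, coefDer_add, rightDer_add, add_wedge, ← Finset.sum_add_distrib]
  exact Finset.sum_congr rfl fun i _ => by abel

/-- The function `1`, as a polyvector field. -/
def one : Polyvec := Pi.single ∅ 1

/-- The coordinate vector field `∂_i` (indices `0, 1, 2` stand for `x, y, z`). -/
def partialField (i : Fin 3) : Polyvec := Pi.single {i} 1

/-- The vector field `Y_i = x_i ∂_i`. -/
def Y (i : Fin 3) : Polyvec := (MvPowerSeries.X i : Coef) • partialField i

def Y23 : Polyvec := wedge (Y 1) (Y 2)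
def Y31 : Polyvec := wedge (Y 2) (Y 0)
def Y12 : Polyvec := wedge (Y 0) (Y 1)
def Y123 : Polyvec := wedge (Y 0) (wedge (Y 1) (Y 2))
def d23 : Polyvec := wedge (partialField 1) (partialField 2)
def d31 : Polyvec := wedge (partialField 2) (partialField 0)
def d12 : Polyvec := wedge (partialField 0) (partialField 1)
def d123 : Polyvec := wedge (partialField 0) (wedge (partialField 1) (partialField 2))

/-! ### The bigrading

With `D = xyz`, the term `x^J ∂_S` equals `(σ / D) Y_S`, where the numerator `σ` is the monomial
whose exponents are `numExp S J`. -/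

/-- The exponents of the numerator. -/
def numExp (S : Finset (Fin 3)) (J : Fin 3 →₀ ℕ) (i : Fin 3) : ℕ :=
  if i ∈ S then J i else J i + 1

/-- The horizontal degree `r = j₁ + j₂ + c`, where `c` is the cochain degree. -/
def rdeg (S : Finset (Fin 3)) (J : Fin 3 →₀ ℕ) : ℤ := numExp S J 0 + numExp S J 1 + S.card

/-- The vertical degree `s = j₃`. -/
def sdeg (S : Finset (Fin 3)) (J : Fin 3 →₀ ℕ) : ℤ := numExp S J 2

/-- The polyvector fields all of whose terms `x^J ∂_S` satisfy `T S J`. -/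
def supported (T : Finset (Fin 3) → (Fin 3 →₀ ℕ) → Prop) : Submodule ℝ Polyvec where
  carrier := {P | ∀ S J, MvPowerSeries.coeff J (P S) ≠ 0 → T S J}
  zero_mem' S J h := absurd (by simp) h
  add_mem' {P Q} hP hQ S J h := by
    by_cases h1 : MvPowerSeries.coeff J (P S) = 0
    · refine hQ S J fun h2 => h ?_
      simp [h1, h2]
    · exact hP S J h1
  smul_mem' c P hP S J h := by
    refine hP S J fun h1 => h ?_
    simp [h1]

/-- The space `P^{rs}` of polyvector fields of bidegree `(r, s)`. -/
def bideg (r s : ℤ) : Submodule ℝ Polyvec := supported fun S J => rdeg S J = r ∧ sdeg S J = s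

/-- The space `P^n` of polyvector fields of diagonal degree `n = r + s`. -/
def diag (n : ℤ) : Submodule ℝ Polyvec := supported fun S J => rdeg S J + sdeg S J = n

/-- The horizontal filtration: the terms have vertical degree `s ≥ p`. -/
def hfil (p : ℤ) : Submodule ℝ Polyvec := supported fun S J => p ≤ sdeg S J

/-! ### The Poisson tensor and its bigraded complex -/

/-- `Λ_{4,I} = a Y₂₃ + a Y₃₁ + b Y₁₂ = a yz ∂₂₃ + a xz ∂₃₁ + b xy ∂₁₂`. -/
def lambdaI (a b : ℝ) : Polyvec := a • Y23 + a • Y31 + b • Y12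

/-- `Λ_{4,II} = z² ∂₁₂`. -/
def lambdaII : Polyvec := (MvPowerSeries.X 2 ^ 2 : Coef) • d12

/-- `Λ₄ = Λ_{4,I} + Λ_{4,II}`. -/
def lambda4 (a b : ℝ) : Polyvec := lambdaI a b + lambdaII

/-- `∂_{Λ₄} = d' + d''` with `d' = ∂_{Λ_{4,I}}` and `d'' = ∂_{Λ_{4,II}}`. -/
theorem coboundary_lambda4 (a b : ℝ) :
    coboundary (lambda4 a b) = coboundary (lambdaI a b) + coboundary lambdaII :=
  coboundary_add _ _

/-! Helper facts: `[Λ₄, ·]` is a differential, it respects the filtration and has diagonal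
weight `1`. -/

theorem wedge_0 (P Q : Polyvec) : wedge P Q ∅ = P ∅ * Q ∅ := by
  simp [wedge, shuffleSign]

theorem wedge_single (P Q : Polyvec) (i : Fin 3) : wedge P Q {i} = P ∅ * Q {i} + P {i} * Q ∅ := by
  rw [wedge, show ({i} : Finset (Fin 3)).powerset = {∅, {i}} by revert i; decide,
    Finset.sum_insert (by simp), Finset.sum_singleton]
  simp [shuffleSign]

theorem wedge_pair (P Q : Polyvec) (i j : Fin 3) (h : i < j) :
    wedge P Q {i, j} = P ∅ * Q {i, j} + P {i} * Q {j} - P {j} * Q {i} + P {i, j} * Q ∅ := by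
  rw [wedge,
    show ({i, j} : Finset (Fin 3)).powerset = {∅, {i}, {j}, {i, j}} by revert i j; decide]
  iterate 3 rw [Finset.sum_insert (by revert i j; decide)]
  rw [Finset.sum_singleton, show ({i, j} : Finset (Fin 3)) \ ∅ = {i, j} by simp,
    show ({i, j} : Finset (Fin 3)) \ {i} = {j} by revert i j; decide,
    show ({i, j} : Finset (Fin 3)) \ {j} = {i} by revert i j; decide,
    show ({i, j} : Finset (Fin 3)) \ {i,j} = ∅ by simp,
    show shuffleSign {i} {j} = 1 by revert i j; decide,
    show shuffleSign {j} {i} = -1 by revert i j; decide,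
    show shuffleSign ∅ {i,j} = 1 by simp [shuffleSign],
    show shuffleSign {i,j} ∅ = 1 by simp [shuffleSign]]
  simp only [one_smul, neg_smul]
  ring

theorem wedge_univ (P Q : Polyvec) :
    wedge P Q {0,1,2} = P ∅ * Q {0,1,2} + P {0} * Q {1,2} - P {1} * Q {0,2} + P {2} * Q {0,1}
      + P {0,1} * Q {2} - P {0,2} * Q {1} + P {1,2} * Q {0} + P {0,1,2} * Q ∅ := by
  have h : ({0,1,2} : Finset (Fin 3)).powerset =
      {∅, {0}, {1}, {2}, {0,1}, {0,2}, {1,2}, {0,1,2}} := by decide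
  simp only [wedge, h]
  iterate 7 rw [Finset.sum_insert (by decide)]
  rw [Finset.sum_singleton]
  simp only [show ({0,1,2} : Finset (Fin 3)) \ ∅ = {0,1,2} by decide,
    show ({0,1,2} : Finset (Fin 3)) \ {0} = {1,2} by decide,
    show ({0,1,2} : Finset (Fin 3)) \ {1} = {0,2} by decide,
    show ({0,1,2} : Finset (Fin 3)) \ {2} = {0,1} by decide,
    show ({0,1,2} : Finset (Fin 3)) \ {0,1} = {2} by decide,
    show ({0,1,2} : Finset (Fin 3)) \ {0,2} = {1} by decide,
    show ({0,1,2} : Finset (Fin 3)) \ {1,2} = {0} by decide,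
    show ({0,1,2} : Finset (Fin 3)) \ {0,1,2} = ∅ by decide,
    show shuffleSign ∅ {0,1,2} = 1 by decide, show shuffleSign {0} {1,2} = 1 by decide,
    show shuffleSign {1} {0,2} = -1 by decide, show shuffleSign {2} {0,1} = 1 by decide,
    show shuffleSign {0,1} {2} = 1 by decide, show shuffleSign {0,2} {1} = -1 by decide,
    show shuffleSign {1,2} {0} = 1 by decide, show shuffleSign {0,1,2} ∅ = 1 by decide,
    one_smul, neg_smul]
  ring

theorem forall_fin3 {p : Finset (Fin 3) → Prop} (h0 : p ∅) (h1 : p {0}) (h2 : p {1})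
    (h3 : p {2}) (h4 : p {0,1}) (h5 : p {0,2}) (h6 : p {1,2}) (h7 : p {0,1,2}) (S) : p S := by
  have : S = ∅ ∨ S = {0} ∨ S = {1} ∨ S = {2} ∨ S = {0,1} ∨ S = {0,2} ∨ S = {1,2} ∨
      S = {0,1,2} := by
    revert S; decide
  rcases this with h|h|h|h|h|h|h|h <;> subst h <;> assumption

/-- The bivector field with the given components. -/
def bivec (f g h : Coef) : Polyvec := fun S =>
  if S = {1, 2} then f else if S = {0, 2} then -g else if S = {0, 1} then h else 0

theorem lambda4_eq (a b : ℝ) : lambda4 a b =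
    bivec (MvPowerSeries.C a * MvPowerSeries.X 1 * MvPowerSeries.X 2)
      (MvPowerSeries.C a * MvPowerSeries.X 0 * MvPowerSeries.X 2)
      (MvPowerSeries.C b * MvPowerSeries.X 0 * MvPowerSeries.X 1 + MvPowerSeries.X 2 ^ 2) := by
  refine funext (forall_fin3 ?_ ?_ ?_ ?_ ?_ ?_ ?_ ?_) <;>
  simp +decide [lambda4, lambdaI, lambdaII, Y23, Y31, Y12, Y, d12, partialField, wedge_0,
    wedge_single, wedge_pair, wedge_univ, MvPowerSeries.smul_eq_C_mul, bivec] <;> ring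

open MvPowerSeries in
theorem schouten_bivec (f g h : Coef) (P : Polyvec) :
    schouten (bivec f g h) P ∅ = 0 ∧
    schouten (bivec f g h) P {0} = h * pderiv ℝ 1 (P ∅) - g * pderiv ℝ 2 (P ∅) ∧
    schouten (bivec f g h) P {1} = f * pderiv ℝ 2 (P ∅) - h * pderiv ℝ 0 (P ∅) ∧
    schouten (bivec f g h) P {2} = g * pderiv ℝ 0 (P ∅) - f * pderiv ℝ 1 (P ∅) ∧
    schouten (bivec f g h) P {0, 1} =
      h * pderiv ℝ 0 (P {0}) + h * pderiv ℝ 1 (P {1})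
      - g * pderiv ℝ 2 (P {1}) - f * pderiv ℝ 2 (P {0})
      - pderiv ℝ 0 h * P {0} - pderiv ℝ 1 h * P {1} - pderiv ℝ 2 h * P {2} ∧
    schouten (bivec f g h) P {0, 2} =
      - g * pderiv ℝ 0 (P {0}) - g * pderiv ℝ 2 (P {2})
      + h * pderiv ℝ 1 (P {2}) + f * pderiv ℝ 1 (P {0})
      + pderiv ℝ 0 g * P {0} + pderiv ℝ 1 g * P {1} + pderiv ℝ 2 g * P {2} ∧
    schouten (bivec f g h) P {1, 2} =
      f * pderiv ℝ 1 (P {1}) + f * pderiv ℝ 2 (P {2})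
      - h * pderiv ℝ 0 (P {2}) - g * pderiv ℝ 0 (P {1})
      - pderiv ℝ 0 f * P {0} - pderiv ℝ 1 f * P {1} - pderiv ℝ 2 f * P {2} ∧
    schouten (bivec f g h) P {0, 1, 2} =
      h * pderiv ℝ 0 (P {0, 2}) + g * pderiv ℝ 0 (P {0, 1}) + h * pderiv ℝ 1 (P {1, 2})
      - f * pderiv ℝ 1 (P {0, 1}) - g * pderiv ℝ 2 (P {1, 2}) - f * pderiv ℝ 2 (P {0, 2})
      - (pderiv ℝ 0 h * P {0, 2} + pderiv ℝ 0 g * P {0, 1} + pderiv ℝ 1 h * P {1, 2}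
        - pderiv ℝ 1 f * P {0, 1} - pderiv ℝ 2 g * P {1, 2} - pderiv ℝ 2 f * P {0, 2}) := by
  refine ⟨?_, ?_, ?_, ?_, ?_, ?_, ?_, ?_⟩ <;>
  simp +decide [schouten, Fin.sum_univ_three, wedge_0, wedge_single, wedge_pair, wedge_univ,
    rightDer, leftDer, coefDer, bivec, Finset.filter_insert, Finset.filter_singleton,
    Finset.pair_comm (1 : Fin 3) 0, Finset.pair_comm (2 : Fin 3) 0,
    Finset.pair_comm (2 : Fin 3) 1] <;> ring

theorem pderiv_comm (i j : Fin 3) (f : Coef) :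
    MvPowerSeries.pderiv ℝ i (MvPowerSeries.pderiv ℝ j f) =
      MvPowerSeries.pderiv ℝ j (MvPowerSeries.pderiv ℝ i f) := by
  by_cases hij : i = j
  · rw [hij]
  ext n
  simp only [MvPowerSeries.coeff_pderiv, Finsupp.add_apply, Finsupp.single_apply, if_neg hij,
    if_neg (Ne.symm hij), add_right_comm n]
  push_cast
  ring

open MvPowerSeries in
theorem coboundary_lambda4_sq (a b : ℝ) (P : Polyvec) :
    coboundary (lambda4 a b) (coboundary (lambda4 a b) P) = 0 := by
  change schouten _ (schouten _ P) = 0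
  rw [lambda4_eq]
  obtain ⟨e0, e1, e2, e3, e12, e13, e23, -⟩ := schouten_bivec
    (C a * X 1 * X 2) (C a * X 0 * X 2) (C b * X 0 * X 1 + X 2 ^ 2) P
  have h2 (i : Fin 3) : pderiv ℝ i (2 : Coef) = 0 := (pderiv ℝ i).map_natCast 2
  generalize schouten _ P = Q at *
  obtain ⟨g0, g1, g2, g3, g12, g13, g23, g123⟩ := schouten_bivec
    (C a * X 1 * X 2) (C a * X 0 * X 2) (C b * X 0 * X 1 + X 2 ^ 2) Q
  refine funext (forall_fin3 ?_ ?_ ?_ ?_ ?_ ?_ ?_ ?_)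
  · exact g0
  · simp [g1, e0]
  · simp [g2, e0]
  · simp [g3, e0]
  · rw [g12, e1, e2, e3]
    simp [Derivation.leibniz, Derivation.leibniz_pow, pderiv_X_of_ne, pderiv_comm 1 0,
      pderiv_comm 2 0, pderiv_comm 2 1]
    ring
  · rw [g13, e1, e2, e3]
    simp [Derivation.leibniz, Derivation.leibniz_pow, pderiv_X_of_ne, pderiv_comm 1 0,
      pderiv_comm 2 0, pderiv_comm 2 1]
    ring
  · rw [g23, e1, e2, e3]
    simp [Derivation.leibniz, Derivation.leibniz_pow, pderiv_X_of_ne, pderiv_comm 1 0,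
      pderiv_comm 2 0, pderiv_comm 2 1]
    ring
  · rw [g123, e12, e13, e23]
    simp [h2, Derivation.leibniz, Derivation.leibniz_pow, pderiv_X_of_ne, pderiv_comm 1 0,
      pderiv_comm 2 0, pderiv_comm 2 1]
    ring

theorem coeff_wedge_ne {P Q : Polyvec} {S : Finset (Fin 3)} {J : Fin 3 →₀ ℕ}
    (h : MvPowerSeries.coeff J (wedge P Q S) ≠ 0) :
    ∃ T U J₁ J₂, Disjoint T U ∧ T ∪ U = S ∧ J₁ + J₂ = J ∧
      MvPowerSeries.coeff J₁ (P T) ≠ 0 ∧ MvPowerSeries.coeff J₂ (Q U) ≠ 0 := by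
  rw [wedge, map_sum] at h
  obtain ⟨T, hT, h⟩ := Finset.exists_ne_zero_of_sum_ne_zero h
  rw [map_zsmul, MvPowerSeries.coeff_mul] at h
  obtain ⟨x, hx, h⟩ := Finset.exists_ne_zero_of_sum_ne_zero (right_ne_zero_of_smul h)
  exact ⟨T, S \ T, x.1, x.2, Finset.disjoint_sdiff,
    Finset.union_sdiff_of_subset (Finset.mem_powerset.mp hT),
    Finset.HasAntidiagonal.mem_antidiagonal.mp hx,
    left_ne_zero_of_mul h, right_ne_zero_of_mul h⟩

theorem coeff_der_ne {P : Polyvec} {S : Finset (Fin 3)} {J : Fin 3 →₀ ℕ} {i : Fin 3}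
    (h : MvPowerSeries.coeff J (leftDer i P S) ≠ 0 ∨ MvPowerSeries.coeff J (rightDer i P S) ≠ 0) :
    i ∉ S ∧ MvPowerSeries.coeff J (P (insert i S)) ≠ 0 := by
  unfold leftDer rightDer at h
  split_ifs at h with hi
  · simp at h
  · simp only [map_zsmul] at h
    exact ⟨hi, h.elim right_ne_zero_of_smul right_ne_zero_of_smul⟩

theorem coeff_coefDer_ne {P : Polyvec} {S : Finset (Fin 3)} {J : Fin 3 →₀ ℕ} {i : Fin 3}
    (h : MvPowerSeries.coeff J (coefDer i P S) ≠ 0) :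
    MvPowerSeries.coeff (J + Finsupp.single i 1) (P S) ≠ 0 := by
  rw [coefDer, MvPowerSeries.coeff_pderiv] at h
  exact left_ne_zero_of_mul h

/-- The exponents of the numerators, shifted by one, are additive for the bracket. -/
theorem coeff_schouten_ne {P Q : Polyvec} {S : Finset (Fin 3)} {J : Fin 3 →₀ ℕ}
    (h : MvPowerSeries.coeff J (schouten P Q S) ≠ 0) :
    ∃ T U J₁ J₂, MvPowerSeries.coeff J₁ (P T) ≠ 0 ∧ MvPowerSeries.coeff J₂ (Q U) ≠ 0 ∧
      S.card + 1 = T.card + U.card ∧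
      ∀ i, numExp S J i + 1 = numExp T J₁ i + numExp U J₂ i := by
  rw [schouten, Finset.sum_apply, map_sum] at h
  obtain ⟨i, -, h⟩ := Finset.exists_ne_zero_of_sum_ne_zero h
  have h' : MvPowerSeries.coeff J (wedge (rightDer i P) (coefDer i Q) S) ≠ 0 ∨
      MvPowerSeries.coeff J (wedge (coefDer i P) (leftDer i Q) S) ≠ 0 := by
    by_contra! hc
    exact h (by simp [hc.1, hc.2])
  rcases h' with h | h <;> obtain ⟨T, U, J₁, J₂, hd, rfl, rfl, h1, h2⟩ := coeff_wedge_ne h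
  · obtain ⟨hi, h1⟩ := coeff_der_ne (Or.inr h1)
    refine ⟨insert i T, U, J₁, _, h1, coeff_coefDer_ne h2, ?_, fun j => ?_⟩
    · rw [Finset.card_union_of_disjoint hd, Finset.card_insert_of_notMem hi]; ring
    · have hT : j ∈ T → j ∉ U := fun a b => Finset.disjoint_left.mp hd a b
      by_cases hj : j = i
      · subst hj
        by_cases hU : j ∈ U <;> simp [numExp, hi, hU] <;> ring
      · by_cases hT' : j ∈ T <;> by_cases hU : j ∈ U <;>
          simp_all [numExp] <;> ring
  · obtain ⟨hi, h2⟩ := coeff_der_ne (Or.inl h2)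
    refine ⟨T, insert i U, _, J₂, coeff_coefDer_ne h1, h2, ?_, fun j => ?_⟩
    · rw [Finset.card_union_of_disjoint hd, Finset.card_insert_of_notMem hi]; ring
    · have hT : j ∈ T → j ∉ U := fun a b => Finset.disjoint_left.mp hd a b
      by_cases hj : j = i
      · subst hj
        by_cases hU : j ∈ T <;> simp [numExp, hi, hU] <;> ring
      · by_cases hT' : j ∈ T <;> by_cases hU : j ∈ U <;>
          simp_all [numExp] <;> ring

theorem coeff_quadratic {c : ℝ} {i j : Fin 3} {J : Fin 3 →₀ ℕ}
    (h : MvPowerSeries.coeff J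
      (MvPowerSeries.C c * MvPowerSeries.X i * MvPowerSeries.X j : Coef) ≠ 0) :
    J = Finsupp.single i 1 + Finsupp.single j 1 := by
  rw [MvPowerSeries.X, MvPowerSeries.X, ← MvPowerSeries.monomial_zero_eq_C_apply,
    MvPowerSeries.monomial_mul_monomial, MvPowerSeries.monomial_mul_monomial, zero_add] at h
  exact MvPowerSeries.eq_of_coeff_monomial_ne_zero h

theorem lambda4_support {a b : ℝ} {S : Finset (Fin 3)} {J : Fin 3 →₀ ℕ}
    (h : MvPowerSeries.coeff J (lambda4 a b S) ≠ 0) :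
    S.card = 2 ∧ ((∀ i, numExp S J i = 1) ∨
      (numExp S J 0 = 0 ∧ numExp S J 1 = 0 ∧ numExp S J 2 = 3)) := by
  rw [lambda4_eq, bivec] at h
  split_ifs at h with h1 h2 h3
  · subst h1
    rw [coeff_quadratic h]
    exact ⟨rfl, Or.inl fun i => by fin_cases i <;> simp [numExp]⟩
  · subst h2
    rw [map_neg, neg_ne_zero] at h
    rw [coeff_quadratic h]
    exact ⟨rfl, Or.inl fun i => by fin_cases i <;> simp [numExp]⟩
  · subst h3
    by_cases hb : MvPowerSeries.coeff J
        (MvPowerSeries.C b * MvPowerSeries.X 0 * MvPowerSeries.X 1 : Coef) = 0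
    · rw [map_add, hb, zero_add, MvPowerSeries.X_pow_eq] at h
      rw [MvPowerSeries.eq_of_coeff_monomial_ne_zero h]
      exact ⟨rfl, Or.inr (by simp [numExp])⟩
    · rw [coeff_quadratic hb]
      exact ⟨rfl, Or.inl fun i => by fin_cases i <;> simp [numExp]⟩
  · simp at h

theorem lambda4_support' {a b : ℝ} {S : Finset (Fin 3)} {J : Fin 3 →₀ ℕ}
    (h : MvPowerSeries.coeff J (lambda4 a b S) ≠ 0) :
    1 ≤ sdeg S J ∧ rdeg S J + sdeg S J = 5 := by
  obtain ⟨h1, h | ⟨h2, h3, h4⟩⟩ := lambda4_support h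
  · simp [rdeg, sdeg, h, h1]
  · simp [rdeg, sdeg, h2, h3, h4, h1]

theorem coboundary_hfil (a b : ℝ) (p : ℤ) (P : Polyvec) (hP : P ∈ hfil p) :
    coboundary (lambda4 a b) P ∈ hfil p := by
  intro S J h
  obtain ⟨T, U, J₁, J₂, h1, h2, -, h3⟩ := coeff_schouten_ne h
  have h4 := (lambda4_support' h1).1
  have h5 := hP _ _ h2
  have h6 := h3 2
  simp only [sdeg] at *
  lia

theorem coboundary_diag (a b : ℝ) (n : ℤ) (P : Polyvec) (hP : P ∈ diag n) :
    coboundary (lambda4 a b) P ∈ diag (n + 1) := by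
  intro S J h
  obtain ⟨T, U, J₁, J₂, h1, h2, h7, h3⟩ := coeff_schouten_ne h
  have h4 := (lambda4_support' h1).2
  have h5 := hP _ _ h2
  have h6 := h3 0
  have h8 := h3 1
  have h9 := h3 2
  simp only [rdeg, sdeg] at *
  lia

/-- The formal polyvector fields with the differential `[Λ₄, ·] = d' + d''`, the horizontal filtration and the
diagonal grading. -/
def complex4 (a b : ℝ) : FilteredComplex Polyvec where
  d := coboundary (lambda4 a b)
  d_d := coboundary_lambda4_sq a b
  fil := hfil
  fil_anti _ _ h _ hP S J hJ := h.trans (hP S J hJ)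
  d_fil := coboundary_hfil a b
  deg := diag
  d_deg := coboundary_diag a b

/-! ### Exponents and admissible indices -/

/-- `b / a` is a positive rational number. -/
def PosRatio (a b : ℝ) : Prop := ∃ t : ℚ, 0 < t ∧ (t : ℝ) = b / a

/-- `b / a = -1 / m` for some positive integer `m`. -/
def Accidental (a b : ℝ) : Prop := ∃ m : ℕ, 0 < m ∧ b / a = -1 / m

/-- The exponents `α`, `β`: `β / α` is the irreducible representative of `b / a`, with `α > 0`,
if `b / a` is positive rational or of the form `-1 / α`; otherwise `α = 1`, and `β` (which will
only occur multiplied by `0`) is arbitrary. -/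
structure IsExponents (a b : ℝ) (al : ℕ) (be : ℤ) : Prop where
  pos : PosRatio a b → 0 < al ∧ 0 < be ∧ IsCoprime (al : ℤ) be ∧ b / a = be / al
  acc : Accidental a b → 0 < al ∧ be = -1 ∧ b / a = be / al
  other : ¬ PosRatio a b → ¬ Accidental a b → al = 1

/-- The exponents `i` of the powers `(D'^α z^β)^i` that are Casimirs of `Λ_{4,I}`. -/
def CasIndex (a b : ℝ) (i : ℕ) : Prop := PosRatio a b ∨ i = 0

/-- The index of the accidental Casimir-like function `D'^α z⁻¹`. -/
def AccIndex (a b : ℝ) (i : ℕ) : Prop := Accidental a b ∧ i = 1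

/-- The admissible indices. -/
def Admissible (a b : ℝ) (i : ℕ) : Prop := CasIndex a b i ∨ AccIndex a b i

/-! ### Representatives -/

/-- Multiplication by the Laurent monomial `x^{e₀} y^{e₁} z^{e₂}`; terms whose exponents would
become negative are dropped. -/
def laurent (e : Fin 3 → ℤ) (P : Polyvec) : Polyvec := fun S J =>
  if ∀ i, e i ≤ J i then
    MvPowerSeries.coeff (Finsupp.equivFunOnFinite.symm fun i => ((J i : ℤ) - e i).toNat) (P S)
  else 0

/-- The representatives of type 2 of `E₂`, up to scalar factors, except the critical ones with
`i < n`. -/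
inductive IsType2 (a b : ℝ) (al : ℕ) (be : ℤ) (n : ℕ) : Polyvec → Prop
  | cas12 (i : ℕ) (hi : CasIndex a b i) :
      IsType2 a b al be n (laurent ![al * i, al * i, be * i] Y12)
  | cas123 (i : ℕ) (hi : Admissible a b i) :
      IsType2 a b al be n (laurent ![al * i, al * i, be * i] Y123)
  | z12 (k : ℕ) (hk : ∀ i < n, Admissible a b i → (k : ℤ) ≠ i * (2 * al + be) + 2) :
      IsType2 a b al be n ((MvPowerSeries.X 2 ^ k : Coef) • d12)
  | z123 (k : ℕ) (hk : ∀ i < n, Admissible a b i → (k : ℤ) ≠ i * (2 * al + be) + 3) :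
      IsType2 a b al be n ((MvPowerSeries.X 2 ^ k : Coef) • d123)
  | x23 (k : ℕ) (hab : b = a) : IsType2 a b al be n ((MvPowerSeries.X 0 ^ k : Coef) • d23)
  | y31 (k : ℕ) (hab : b = a) : IsType2 a b al be n ((MvPowerSeries.X 1 ^ k : Coef) • d31)
  | x123 (k : ℕ) (hab : b = a) : IsType2 a b al be n ((MvPowerSeries.X 0 ^ k : Coef) • d123)
  | y123 (k : ℕ) (hab : b = a) : IsType2 a b al be n ((MvPowerSeries.X 1 ^ k : Coef) • d123)

/-- `binom(αi, k) (2a+b)^{-k} D'^{αi-k} z^{βi+2k} W`, for `W` with constant coefficients in the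
`Y`-basis; this is `Z^{q_{ic}-2k, p_i+2k}`, with the coefficients collected in `W`. -/
def zTerm (a b : ℝ) (al : ℕ) (be : ℤ) (i k : ℕ) (W : Polyvec) : Polyvec :=
  (((al * i).choose k : ℝ) / (2 * a + b) ^ k) •
    laurent ![al * i - k, al * i - k, be * i + 2 * k] W

/-- `(D' + z² / (2a+b))^{αi} z^{βi} W`. -/
def fullTerm (a b : ℝ) (al : ℕ) (be : ℤ) (i : ℕ) (W : Polyvec) : Polyvec :=
  ((MvPowerSeries.X 0 * MvPowerSeries.X 1 +
      MvPowerSeries.C (1 / (2 * a + b)) * MvPowerSeries.X 2 ^ 2 : Coef) ^ (al * i)) •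
    laurent ![0, 0, be * i] W

/-- A choice of the sequences of coefficients, as functions of their initial terms:
`A i A₀ k` is `A_{ik}`, `BCD i (B₀, C₀, D₀) k` is `(B_{ik}, C_{ik}, D_{ik})` and
`EF i (E₀, F₀) k` is `(E_{ik}, F_{ik})`. -/
structure CoefChoice where
  A : ℕ → ℝ → ℕ → ℝ
  BCD : ℕ → ℝ × ℝ × ℝ → ℕ → ℝ × ℝ × ℝ
  EF : ℕ → ℝ × ℝ → ℕ → ℝ × ℝ

/-- The coefficients start with the prescribed initial terms and verify the recursions, for all
admissible `i ≥ n` and all `k < α n`. -/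
structure CoefChoice.Valid (a b : ℝ) (al n : ℕ) (σ : CoefChoice) : Prop where
  A_zero : ∀ i, n ≤ i → Admissible a b i → ∀ v, σ.A i v 0 = v
  BCD_zero : ∀ i, n ≤ i → Admissible a b i → ∀ v, σ.BCD i v 0 = v
  EF_zero : ∀ i, n ≤ i → Admissible a b i → ∀ v, σ.EF i v 0 = v
  cond₀ : ∀ i, n ≤ i → Admissible a b i → ∀ v, ∀ k < al * n, σ.A i v (k + 1) = σ.A i v k
  cond₁ : ∀ i, n ≤ i → Admissible a b i → ∀ v, ∀ k < al * n,
    (σ.BCD i v (k + 1)).1 + (σ.BCD i v (k + 1)).2.1 =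
      ((al * i - k + 1) * ((σ.BCD i v k).1 + (σ.BCD i v k).2.1) - 2 * (σ.BCD i v k).2.2) /
        (al * i - k) ∧
    (σ.BCD i v (k + 1)).2.2 = (σ.BCD i v k).2.2
  cond₂ : ∀ i, n ≤ i → Admissible a b i → ∀ v, ∀ k < al * n,
    (σ.EF i v (k + 1)).1 - (σ.EF i v (k + 1)).2 =
      (al * i - k + 1) / (al * i - k) * ((σ.EF i v k).1 - (σ.EF i v k).2)

/-- The altered representatives of type 1 with index `i` and cochain degree `c`. For the
accidental index, the initial coefficients `A_{10}, B_{10}, C_{10}` are required to vanish. -/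
def type1 (a b : ℝ) (al : ℕ) (be : ℤ) (n : ℕ) (σ : CoefChoice) (i : ℕ) : Fin 3 → Set Polyvec
  | 0 => {u | ∃ A₀ : ℝ, (AccIndex a b i → A₀ = 0) ∧
      u = if n ≤ i then
          ∑ k ∈ Finset.range (al * n + 1), zTerm a b al be i k (σ.A i A₀ k • one)
        else fullTerm a b al be i (A₀ • one)}
  | 1 => {u | ∃ B₀ C₀ D₀ : ℝ, (AccIndex a b i → B₀ = 0 ∧ C₀ = 0) ∧
      u = if n ≤ i then
          ∑ k ∈ Finset.range (al * n + 1), zTerm a b al be i k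
            ((σ.BCD i (B₀, C₀, D₀) k).1 • Y 0 + (σ.BCD i (B₀, C₀, D₀) k).2.1 • Y 1 +
              (σ.BCD i (B₀, C₀, D₀) k).2.2 • Y 2)
        else fullTerm a b al be i
          (B₀ • (Y 0 + (1 / 2 : ℝ) • Y 2) + C₀ • (Y 1 + (1 / 2 : ℝ) • Y 2))}
  | 2 => {u | ∃ E₀ F₀ : ℝ,
      u = if n ≤ i then
          ∑ k ∈ Finset.range (al * n + 1), zTerm a b al be i k
            ((σ.EF i (E₀, F₀) k).1 • Y23 + (σ.EF i (E₀, F₀) k).2 • Y31)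
        else laurent ![al * i, al * i, be * i] (E₀ • (Y23 + Y31))}

/-- `(q, p)` is the bidegree `(q_{ic}, p_i) = (2αi + 2 + c, βi + 1)` of the representatives of
type 1 with index `i` and cochain degree `c`. -/
def HasType1Bideg (al : ℕ) (be : ℤ) (p q : ℤ) (i : ℕ) (c : Fin 3) : Prop :=
  q = 2 * al * i + 2 + (c : ℕ) ∧ p = be * i + 1

/-- The altered representatives of type 1 in `E_r^{pq}` (only `0` if there are none). -/
def type1Part (a b : ℝ) (al : ℕ) (be : ℤ) (n : ℕ) (σ : CoefChoice) (p q : ℤ) : Set Polyvec :=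
  {u | (∃ i c, Admissible a b i ∧ HasType1Bideg al be p q i c ∧ u ∈ type1 a b al be n σ i c) ∨
    ((¬ ∃ i c, Admissible a b i ∧ HasType1Bideg al be p q i c) ∧ u = 0)}

/-- The remaining representatives of type 2 in `E_r^{pq}`. -/
def type2Part (a b : ℝ) (al : ℕ) (be : ℤ) (n : ℕ) (p q : ℤ) : Submodule ℝ Polyvec :=
  Submodule.span ℝ {t | IsType2 a b al be n t ∧ t ∈ bideg q p}

/-- The whole system: the sums of a representative of type 1 and one of type 2. -/
def repSystem (a b : ℝ) (al : ℕ) (be : ℤ) (n : ℕ) (σ : CoefChoice) (p q : ℤ) : Set Polyvec :=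
  {w | ∃ u ∈ type1Part a b al be n σ p q, ∃ t ∈ type2Part a b al be n p q, w = u + t}

/-- The orders `r` of the `n`-th package `E_{2(n-1)α+4}, E_{2(n-1)α+6}, …, E_{2nα+2}` of even
terms; it consists of `E₂` only if `n = 0`. -/
def InPackage (al n : ℕ) (r : ℤ) : Prop :=
  if n = 0 then r = 2
  else Even r ∧ 2 * ((n : ℤ) - 1) * al + 4 ≤ r ∧ r ≤ 2 * n * al + 2

end Polyvec

end

/-!
In the logarithmic frame `Y_S`, the operator `[Λ₄, ·]` acts on monomials: `d'` multiplies the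
coefficient of `x^u y^v z^w` by the Koszul vector `(b v - a w, a w - b u, a (u - v))` and keeps the
level `w`, while `d''` maps the exponents `(u + 1, v + 1, w - 2)` to `(u, v, w)`
(`ycoef_coboundary`). An exponent may be `-1` if the corresponding `Y_i` occurs, and this is the
source of the critical classes.

Where a component of the Koszul vector in a direction with exponent `≠ -1` does not vanish, `d'` is
acyclic (`exists_homotopy`). What remains are the resonant points `(u, u, w)`, `b u = a w`, which
are the exponents of the admissible powers of `D'^α z^β` (`resonant_iff`), the line `u = v = -1`,
and, for `b = a`, the lines `v = w = -1` and `u = w = -1`. The only interaction takes place along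
the diagonal line `(u - k, u - k, w + 2 k)` that starts at a resonant point and ends at
`u - k = -1`. There, closedness of a cochain amounts to four independent two-term recursions, for
the coefficients `A` and `D` of `1` and `Y₃`, for `B + C - 2 D` (`qcoef`) and for `E - F`
(`mcoef`). The first two have the factor `u' + 1`, which vanishes at the end of the line, so that
their solutions, with binomial coefficients, are cocycles. The factor of the other two is `u' + 2`,
so that their solutions end with a multiple of `∂₁₂` or `∂₁₂₃`: a resonant point with `u = α i`
transgresses to the end of its line, `2 (α i + 1)` levels higher. Hence the differentials of even
order `r` vanish unless `r = 2 α i + 2`, with `i` admissible, and this is the last term of the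
`i`-th package.

The conditions on a leading part that result from this, for the package with `N = α n`, define
`leadSpace`. Every element of `Z_r` is, modulo `B_{r-1}`, a cochain with leading part in this space
(`exists_reduction`), and a nonzero leading part of this kind is never hit by `d`
(`leadSpace_not_hit`). Both statements hold uniformly for all orders of the package, so a set of
elements of `Z_{2N+2}` that corresponds bijectively to the admissible leading parts
(`IsLeadSystem`) represents all terms of the package, and the canonical isomorphisms and the
vanishing of the differentials follow. Finally `isLeadSystem_repSystem` identifies the sums of
representatives of type 1 and type 2 as such a set: type 2 accounts for the monomials that are
cocycles by themselves, type 1 for the other components at the resonant points, continued along the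
diagonal line.
-/

noncomputable section

namespace Polyvec

/-! ### Coefficients in the logarithmic frame -/

/-- The exponent vector with components `i, j, k`, truncated below at `0`. -/
def exps (i j k : ℤ) : Fin 3 →₀ ℕ :=
  Finsupp.equivFunOnFinite.symm ![i.toNat, j.toNat, k.toNat]

/-- The coefficient of `x^i y^j z^k` in a power series, for integers `i, j, k`; it is `0` if one
of them is negative. -/
def coef (f : Coef) (i j k : ℤ) : ℝ :=
  if 0 ≤ i ∧ 0 ≤ j ∧ 0 ≤ k then MvPowerSeries.coeff (exps i j k) f else 0

@[simp] theorem exps_apply_zero (i j k : ℤ) : exps i j k 0 = i.toNat := rfl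

@[simp] theorem exps_apply_one (i j k : ℤ) : exps i j k 1 = j.toNat := rfl

@[simp] theorem exps_apply_two (i j k : ℤ) : exps i j k 2 = k.toNat := rfl

theorem exps_ext {J K : Fin 3 →₀ ℕ} (h0 : J 0 = K 0) (h1 : J 1 = K 1) (h2 : J 2 = K 2) :
    J = K := by
  ext i; fin_cases i <;> assumption

theorem exps_le {J K : Fin 3 →₀ ℕ} : J ≤ K ↔ J 0 ≤ K 0 ∧ J 1 ≤ K 1 ∧ J 2 ≤ K 2 := by
  rw [Finsupp.le_def, Fin.forall_fin_succ, Fin.forall_fin_succ, Fin.forall_fin_one]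
  rfl

theorem coef_of_neg {f : Coef} {i j k : ℤ} (h : ¬ (0 ≤ i ∧ 0 ≤ j ∧ 0 ≤ k)) :
    coef f i j k = 0 := if_neg h

@[simp] theorem coef_zero (i j k : ℤ) : coef 0 i j k = 0 := by simp [coef]

@[simp] theorem coef_add (f g : Coef) (i j k : ℤ) :
    coef (f + g) i j k = coef f i j k + coef g i j k := by
  unfold coef; split_ifs <;> simp

@[simp] theorem coef_sub (f g : Coef) (i j k : ℤ) :
    coef (f - g) i j k = coef f i j k - coef g i j k := by
  unfold coef; split_ifs <;> simp

@[simp] theorem coef_neg (f : Coef) (i j k : ℤ) : coef (-f) i j k = -coef f i j k := by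
  unfold coef; split_ifs <;> simp

@[simp] theorem coef_smul (c : ℝ) (f : Coef) (i j k : ℤ) :
    coef (c • f) i j k = c * coef f i j k := by
  unfold coef; split_ifs <;> simp

@[simp] theorem coef_C_mul (c : ℝ) (f : Coef) (i j k : ℤ) :
    coef (MvPowerSeries.C c * f) i j k = c * coef f i j k := by
  unfold coef; split_ifs <;> simp

theorem coef_monomial_mul (l m n : ℕ) (c : ℝ) (f : Coef) (i j k : ℤ) :
    coef (MvPowerSeries.monomial (exps l m n) c * f) i j k =
      c * coef f (i - l) (j - m) (k - n) := by
  by_cases h : 0 ≤ i - l ∧ 0 ≤ j - m ∧ 0 ≤ k - n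
  · obtain ⟨h0, h1, h2⟩ := h
    rw [coef, if_pos ⟨by lia, by lia, by lia⟩, MvPowerSeries.coeff_monomial_mul,
      if_pos (exps_le.2 ⟨by simp; lia, by simp; lia, by simp; lia⟩), coef,
      if_pos ⟨h0, h1, h2⟩]
    rw [show exps i j k - exps l m n = exps (i - l) (j - m) (k - n) from
      exps_ext (by simp) (by simp) (by simp)]
  · rw [coef_of_neg h, coef]
    split_ifs with h'
    · rw [MvPowerSeries.coeff_monomial_mul, if_neg, mul_zero]
      rw [exps_le]
      simp only [exps_apply_zero, exps_apply_one, exps_apply_two]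
      lia
    · simp

@[simp] theorem coef_X_zero_mul (f : Coef) (i j k : ℤ) :
    coef (MvPowerSeries.X 0 * f) i j k = coef f (i - 1) j k := by
  rw [MvPowerSeries.X, show Finsupp.single (0 : Fin 3) 1 = exps (1 : ℕ) (0 : ℕ) (0 : ℕ) from
    exps_ext (by simp) (by simp) (by simp), coef_monomial_mul]
  simp

@[simp] theorem coef_X_one_mul (f : Coef) (i j k : ℤ) :
    coef (MvPowerSeries.X 1 * f) i j k = coef f i (j - 1) k := by
  rw [MvPowerSeries.X, show Finsupp.single (1 : Fin 3) 1 = exps (0 : ℕ) (1 : ℕ) (0 : ℕ) from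
    exps_ext (by simp) (by simp) (by simp), coef_monomial_mul]
  simp

@[simp] theorem coef_X_two_mul (f : Coef) (i j k : ℤ) :
    coef (MvPowerSeries.X 2 * f) i j k = coef f i j (k - 1) := by
  rw [MvPowerSeries.X, show Finsupp.single (2 : Fin 3) 1 = exps (0 : ℕ) (0 : ℕ) (1 : ℕ) from
    exps_ext (by simp) (by simp) (by simp), coef_monomial_mul]
  simp

@[simp] theorem coef_pderiv_zero (f : Coef) (i j k : ℤ) :
    coef (MvPowerSeries.pderiv ℝ 0 f) i j k = (i + 1) * coef f (i + 1) j k := by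
  by_cases h : 0 ≤ i ∧ 0 ≤ j ∧ 0 ≤ k
  · have hi : ((i.toNat : ℕ) : ℝ) = i := by exact_mod_cast Int.toNat_of_nonneg h.1
    rw [coef, if_pos h, coef, if_pos ⟨by lia, h.2.1, h.2.2⟩, MvPowerSeries.coeff_pderiv, mul_comm,
      exps_apply_zero, hi,
      show exps i j k + Finsupp.single 0 1 = exps (i + 1) j k from
        exps_ext (by simp; try lia) (by simp; try lia) (by simp; try lia)]
  · rw [coef_of_neg h]
    by_cases hi : i = -1
    · simp [hi]
    · rw [coef_of_neg (by lia), mul_zero]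

@[simp] theorem coef_pderiv_one (f : Coef) (i j k : ℤ) :
    coef (MvPowerSeries.pderiv ℝ 1 f) i j k = (j + 1) * coef f i (j + 1) k := by
  by_cases h : 0 ≤ i ∧ 0 ≤ j ∧ 0 ≤ k
  · have hi : ((j.toNat : ℕ) : ℝ) = j := by exact_mod_cast Int.toNat_of_nonneg h.2.1
    rw [coef, if_pos h, coef, if_pos ⟨h.1, by lia, h.2.2⟩, MvPowerSeries.coeff_pderiv, mul_comm,
      exps_apply_one, hi,
      show exps i j k + Finsupp.single 1 1 = exps i (j + 1) k from
        exps_ext (by simp; try lia) (by simp; try lia) (by simp; try lia)]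
  · rw [coef_of_neg h]
    by_cases hi : j = -1
    · simp [hi]
    · rw [coef_of_neg (by lia), mul_zero]

@[simp] theorem coef_pderiv_two (f : Coef) (i j k : ℤ) :
    coef (MvPowerSeries.pderiv ℝ 2 f) i j k = (k + 1) * coef f i j (k + 1) := by
  by_cases h : 0 ≤ i ∧ 0 ≤ j ∧ 0 ≤ k
  · have hi : ((k.toNat : ℕ) : ℝ) = k := by exact_mod_cast Int.toNat_of_nonneg h.2.2
    rw [coef, if_pos h, coef, if_pos ⟨h.1, h.2.1, by lia⟩, MvPowerSeries.coeff_pderiv, mul_comm,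
      exps_apply_two, hi,
      show exps i j k + Finsupp.single 2 1 = exps i j (k + 1) from
        exps_ext (by simp; try lia) (by simp; try lia) (by simp; try lia)]
  · rw [coef_of_neg h]
    by_cases hi : k = -1
    · simp [hi]
    · rw [coef_of_neg (by lia), mul_zero]

/-- `1` if `i ∈ S` and `0` otherwise. -/
def ind (i : Fin 3) (S : Finset (Fin 3)) : ℤ := if i ∈ S then 1 else 0

/-- The coefficient of `x^u y^v z^w Y_S` in a polyvector field, where `Y_S` is the wedge product,
in increasing order, of the `Y_i`, `i ∈ S`. The exponents are integers; those with index in `S`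
can be equal to `-1`, since `Y_i = x_i ∂_i`. -/
def ycoef (P : Polyvec) (S : Finset (Fin 3)) (u v w : ℤ) : ℝ :=
  coef (P S) (u + ind 0 S) (v + ind 1 S) (w + ind 2 S)

/-- The polyvector field `∑ c S u v w x^u y^v z^w Y_S`; terms with inadmissible exponents are
dropped. -/
def ofYcoef (c : Finset (Fin 3) → ℤ → ℤ → ℤ → ℝ) : Polyvec := fun S J =>
  c S (J 0 - ind 0 S) (J 1 - ind 1 S) (J 2 - ind 2 S)

/-- The exponents that occur with `Y_S`. -/
def Adm (S : Finset (Fin 3)) (u v w : ℤ) : Prop :=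
  0 ≤ u + ind 0 S ∧ 0 ≤ v + ind 1 S ∧ 0 ≤ w + ind 2 S

instance (S : Finset (Fin 3)) (u v w : ℤ) : Decidable (Adm S u v w) := by
  unfold Adm; infer_instance

theorem ycoef_of_not_adm {P : Polyvec} {S : Finset (Fin 3)} {u v w : ℤ} (h : ¬ Adm S u v w) :
    ycoef P S u v w = 0 := if_neg h

theorem ycoef_ofYcoef (c : Finset (Fin 3) → ℤ → ℤ → ℤ → ℝ) (S : Finset (Fin 3)) (u v w : ℤ) :
    ycoef (ofYcoef c) S u v w = if Adm S u v w then c S u v w else 0 := by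
  unfold ycoef coef
  refine if_ctx_congr Iff.rfl (fun h => ?_) fun _ => rfl
  change c S _ _ _ = _
  obtain ⟨h0, h1, h2⟩ := h
  congr 1 <;> simp <;> lia

@[simp] theorem ycoef_zero (S : Finset (Fin 3)) (u v w : ℤ) : ycoef 0 S u v w = 0 := by
  simp [ycoef]

@[simp] theorem ycoef_add (P Q : Polyvec) (S : Finset (Fin 3)) (u v w : ℤ) :
    ycoef (P + Q) S u v w = ycoef P S u v w + ycoef Q S u v w := by simp [ycoef]

@[simp] theorem ycoef_sub (P Q : Polyvec) (S : Finset (Fin 3)) (u v w : ℤ) :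
    ycoef (P - Q) S u v w = ycoef P S u v w - ycoef Q S u v w := by simp [ycoef]

@[simp] theorem ycoef_smul (c : ℝ) (P : Polyvec) (S : Finset (Fin 3)) (u v w : ℤ) :
    ycoef (c • P) S u v w = c * ycoef P S u v w := by simp [ycoef]

theorem ycoef_sum {ι : Type*} (s : Finset ι) (f : ι → Polyvec) (S : Finset (Fin 3)) (u v w : ℤ) :
    ycoef (∑ i ∈ s, f i) S u v w = ∑ i ∈ s, ycoef (f i) S u v w := by
  classical
  induction s using Finset.induction_on with
  | empty => simp
  | insert i s hi ih => rw [Finset.sum_insert hi, Finset.sum_insert hi, ycoef_add, ih]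

theorem coeff_eq_ycoef (P : Polyvec) (S : Finset (Fin 3)) (J : Fin 3 →₀ ℕ) :
    MvPowerSeries.coeff J (P S) = ycoef P S (J 0 - ind 0 S) (J 1 - ind 1 S) (J 2 - ind 2 S) := by
  rw [ycoef, coef, if_pos (by simp), show exps _ _ _ = J from
    exps_ext (by simp) (by simp) (by simp)]

theorem ycoef_ext {P Q : Polyvec} (h : ∀ S u v w, ycoef P S u v w = ycoef Q S u v w) : P = Q := by
  ext1 S
  ext J
  rw [coeff_eq_ycoef, coeff_eq_ycoef, h]

theorem mem_supported_iff (T : Finset (Fin 3) → (Fin 3 →₀ ℕ) → Prop)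
    (T' : Finset (Fin 3) → ℤ → ℤ → ℤ → Prop)
    (hT : ∀ S J, T S J ↔ T' S (J 0 - ind 0 S) (J 1 - ind 1 S) (J 2 - ind 2 S)) (P : Polyvec) :
    P ∈ supported T ↔ ∀ S u v w, ycoef P S u v w ≠ 0 → T' S u v w := by
  constructor
  · intro h S u v w hne
    by_cases ha : Adm S u v w
    · obtain ⟨h0, h1, h2⟩ := ha
      have := (hT S _).1 (h S (exps (u + ind 0 S) (v + ind 1 S) (w + ind 2 S)) (by
        rw [coeff_eq_ycoef]
        simpa [h0, h1, h2] using hne))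
      simpa [h0, h1, h2] using this
    · exact absurd (ycoef_of_not_adm ha) hne
  · intro h S J hne
    rw [coeff_eq_ycoef] at hne
    exact (hT S J).2 (h _ _ _ _ hne)

theorem numExp_eq (S : Finset (Fin 3)) (J : Fin 3 →₀ ℕ) (i : Fin 3) :
    (numExp S J i : ℤ) = J i - ind i S + 1 := by
  unfold numExp ind; split_ifs <;> simp

theorem mem_hfil_iff (p : ℤ) (P : Polyvec) :
    P ∈ hfil p ↔ ∀ S u v w, ycoef P S u v w ≠ 0 → p ≤ w + 1 :=
  mem_supported_iff _ (fun _ _ _ w => p ≤ w + 1) (fun S J => by simp [sdeg, numExp_eq]) P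

theorem mem_diag_iff (n : ℤ) (P : Polyvec) :
    P ∈ diag n ↔ ∀ S u v w, ycoef P S u v w ≠ 0 → u + v + w + 3 + S.card = n :=
  mem_supported_iff _ (fun S u v w => u + v + w + 3 + S.card = n)
    (fun S J => by simp only [rdeg, sdeg, numExp_eq]; constructor <;> intro h <;> linarith) P

theorem mem_bideg_iff (r s : ℤ) (P : Polyvec) :
    P ∈ bideg r s ↔ ∀ S u v w, ycoef P S u v w ≠ 0 → u + v + 2 + S.card = r ∧ w + 1 = s :=
  mem_supported_iff _ (fun S u v w => u + v + 2 + S.card = r ∧ w + 1 = s)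
    (fun S J => by
      simp only [rdeg, sdeg, numExp_eq]; constructor <;> rintro ⟨h, h'⟩ <;> constructor <;>
        linarith) P

/-! ### The differential in the logarithmic frame -/

open MvPowerSeries in
/-- The coefficients of `[Λ₄, P]`. The terms with unshifted exponents are those of the wedge
product with `(b v - a w) Y₁ + (a w - b u) Y₂ + a (u - v) Y₃` and come from `Λ_{4,I}`; the other
ones come from `Λ_{4,II}`. -/
theorem ycoef_coboundary (a b : ℝ) (P : Polyvec) (u v w : ℤ) :
    ycoef (coboundary (lambda4 a b) P) ∅ u v w = 0 ∧
    ycoef (coboundary (lambda4 a b) P) {0} u v w =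
      (b * v - a * w) * ycoef P ∅ u v w + (v + 1) * ycoef P ∅ (u + 1) (v + 1) (w - 2) ∧
    ycoef (coboundary (lambda4 a b) P) {1} u v w =
      (a * w - b * u) * ycoef P ∅ u v w - (u + 1) * ycoef P ∅ (u + 1) (v + 1) (w - 2) ∧
    ycoef (coboundary (lambda4 a b) P) {2} u v w = a * (u - v) * ycoef P ∅ u v w ∧
    ycoef (coboundary (lambda4 a b) P) {0, 1} u v w =
      (b * v - a * w) * ycoef P {1} u v w - (a * w - b * u) * ycoef P {0} u v w
      + (u + 2) * ycoef P {0} (u + 1) (v + 1) (w - 2)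
      + (v + 2) * ycoef P {1} (u + 1) (v + 1) (w - 2)
      - 2 * ycoef P {2} (u + 1) (v + 1) (w - 2) ∧
    ycoef (coboundary (lambda4 a b) P) {0, 2} u v w =
      (b * v - a * w) * ycoef P {2} u v w - a * (u - v) * ycoef P {0} u v w
      + (v + 1) * ycoef P {2} (u + 1) (v + 1) (w - 2) ∧
    ycoef (coboundary (lambda4 a b) P) {1, 2} u v w =
      (a * w - b * u) * ycoef P {2} u v w - a * (u - v) * ycoef P {1} u v w
      - (u + 1) * ycoef P {2} (u + 1) (v + 1) (w - 2) ∧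
    ycoef (coboundary (lambda4 a b) P) {0, 1, 2} u v w =
      (b * v - a * w) * ycoef P {1, 2} u v w - (a * w - b * u) * ycoef P {0, 2} u v w
      + a * (u - v) * ycoef P {0, 1} u v w
      + (v + 2) * ycoef P {1, 2} (u + 1) (v + 1) (w - 2)
      + (u + 2) * ycoef P {0, 2} (u + 1) (v + 1) (w - 2) := by
  change ycoef (schouten _ P) _ _ _ _ = _ ∧ _ = _ ∧ _ = _ ∧ _ = _ ∧ _ = _ ∧ _ = _ ∧ _ = _ ∧ _ = _
  simp only [coboundary, LinearMap.coe_mk, AddHom.coe_mk]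
  rw [lambda4_eq]
  obtain ⟨e, e0, e1, e2, e01, e02, e12, e012⟩ := schouten_bivec
    (C a * X 1 * X 2) (C a * X 0 * X 2) (C b * X 0 * X 1 + X 2 ^ 2) P
  have h2 (i : Fin 3) : pderiv ℝ i (2 : Coef) = 0 := (pderiv ℝ i).map_natCast 2
  have i0 : ind 0 ∅ = 0 ∧ ind 0 {0} = 1 ∧ ind 0 {1} = 0 ∧ ind 0 {2} = 0 ∧ ind 0 {0, 1} = 1 ∧
    ind 0 {0, 2} = 1 ∧ ind 0 {1, 2} = 0 ∧ ind 0 {0, 1, 2} = 1 := by decide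
  have i1 : ind 1 ∅ = 0 ∧ ind 1 {0} = 0 ∧ ind 1 {1} = 1 ∧ ind 1 {2} = 0 ∧ ind 1 {0, 1} = 1 ∧
    ind 1 {0, 2} = 0 ∧ ind 1 {1, 2} = 1 ∧ ind 1 {0, 1, 2} = 1 := by decide
  have i2 : ind 2 ∅ = 0 ∧ ind 2 {0} = 0 ∧ ind 2 {1} = 0 ∧ ind 2 {2} = 1 ∧ ind 2 {0, 1} = 0 ∧
    ind 2 {0, 2} = 1 ∧ ind 2 {1, 2} = 1 ∧ ind 2 {0, 1, 2} = 1 := by decide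
  simp only [ycoef, e, e0, e1, e2, e01, e02, e12, e012, i0, i1, i2]
  have ht (f : Coef) : (2 : Coef) * f = C 2 * f := by congr 1
  have d00 : pderiv ℝ (0 : Fin 3) (X 1 : Coef) = 0 := pderiv_X_of_ne (by decide)
  have d02 : pderiv ℝ (0 : Fin 3) (X 2 : Coef) = 0 := pderiv_X_of_ne (by decide)
  have d10 : pderiv ℝ (1 : Fin 3) (X 0 : Coef) = 0 := pderiv_X_of_ne (by decide)
  have d12 : pderiv ℝ (1 : Fin 3) (X 2 : Coef) = 0 := pderiv_X_of_ne (by decide)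
  have d20 : pderiv ℝ (2 : Fin 3) (X 0 : Coef) = 0 := pderiv_X_of_ne (by decide)
  have d21 : pderiv ℝ (2 : Fin 3) (X 1 : Coef) = 0 := pderiv_X_of_ne (by decide)
  simp only [Derivation.leibniz, Derivation.leibniz_pow, map_add, smul_eq_mul, d00, d02, d10, d12,
    d20, d21, pderiv_X_self, MvPowerSeries.pderiv_C, mul_zero, zero_add, add_zero, mul_one]
  refine ⟨by simp, ?_, ?_, ?_, ?_, ?_, ?_, ?_⟩ <;>
  · simp [add_mul, mul_assoc, pow_two, ht]
    ring_nf

theorem ycoef_of_neg {P : Polyvec} {S : Finset (Fin 3)} {u v w : ℤ}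
    (h : u + ind 0 S < 0 ∨ v + ind 1 S < 0 ∨ w + ind 2 S < 0) : ycoef P S u v w = 0 :=
  ycoef_of_not_adm fun ⟨h0, h1, h2⟩ => by lia

theorem ind_nonneg (i : Fin 3) (S : Finset (Fin 3)) : 0 ≤ ind i S := by
  unfold ind; split_ifs <;> simp

theorem ind_le_one (i : Fin 3) (S : Finset (Fin 3)) : ind i S ≤ 1 := by
  unfold ind; split_ifs <;> simp

theorem ycoef_of_lt_neg_one {P : Polyvec} {S : Finset (Fin 3)} {u v w : ℤ}
    (h : u < -1 ∨ v < -1 ∨ w < -1) : ycoef P S u v w = 0 := by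
  have h0 := ind_le_one 0 S
  have h1 := ind_le_one 1 S
  have h2 := ind_le_one 2 S
  exact ycoef_of_neg (by lia)

/-! ### The diagonal lines -/

/-- The combination `B + C - 2 D` of the coefficients `B, C, D` of `Y₁, Y₂, Y₃` at the exponents
`(u, u, w)`. For cocycles it verifies a two-term recursion along the diagonal line through
`(u, u, w)`, and it is what remains of a 1-cochain in the coefficient of `∂₁₂` at the end
`u = -1` of the line. -/
def qcoef (P : Polyvec) (u w : ℤ) : ℝ :=
  ycoef P {0} u u w + ycoef P {1} u u w - 2 * ycoef P {2} u u w

/-- The difference of the coefficients of `Y₂₃` and `Y₃₁ = -Y₁₃` at the exponents `(u, u, w)`. It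
is the analogue of `qcoef` for 2-cochains. -/
def mcoef (P : Polyvec) (u w : ℤ) : ℝ := ycoef P {1, 2} u u w + ycoef P {0, 2} u u w

theorem coboundary_diag_zero (a b : ℝ) (P : Polyvec) (u w : ℤ) :
    ycoef (coboundary (lambda4 a b) P) {0} u u w =
      (b * u - a * w) * ycoef P ∅ u u w + (u + 1) * ycoef P ∅ (u + 1) (u + 1) (w - 2) :=
  (ycoef_coboundary a b P u u w).2.1

theorem coboundary_diag_two (a b : ℝ) (P : Polyvec) (u w : ℤ) :
    ycoef (coboundary (lambda4 a b) P) {0, 2} u u w =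
      (b * u - a * w) * ycoef P {2} u u w + (u + 1) * ycoef P {2} (u + 1) (u + 1) (w - 2) := by
  rw [(ycoef_coboundary a b P u u w).2.2.2.2.2.1]; ring

theorem coboundary_diag_q (a b : ℝ) (P : Polyvec) (u w : ℤ) :
    ycoef (coboundary (lambda4 a b) P) {0, 1} u u w -
        2 * ycoef (coboundary (lambda4 a b) P) {0, 2} u u w =
      (b * u - a * w) * qcoef P u w + (u + 2) * qcoef P (u + 1) (w - 2) := by
  obtain ⟨-, -, -, -, h1, h2, -⟩ := ycoef_coboundary a b P u u w
  rw [h1, h2, qcoef, qcoef]; ring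

theorem coboundary_diag_m (a b : ℝ) (P : Polyvec) (u w : ℤ) :
    ycoef (coboundary (lambda4 a b) P) {0, 1, 2} u u w =
      (b * u - a * w) * mcoef P u w + (u + 2) * mcoef P (u + 1) (w - 2) := by
  obtain ⟨-, -, -, -, -, -, -, h⟩ := ycoef_coboundary a b P u u w
  rw [h, mcoef, mcoef]; ring

/-- A finitely supported solution of a two-term recursion vanishes, if the coefficients of the
terms that do not vanish for other reasons are invertible. -/
theorem recursion_vanish {f lam g : ℕ → ℝ} {m : ℕ} (hm : ∀ j, m ≤ j → f j = 0)
    (hr : ∀ j, 1 ≤ j → lam j * f j + g j * f (j + 1) = 0)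
    (hl : ∀ j, 1 ≤ j → f j = 0 ∨ lam j ≠ 0) : ∀ j, 1 ≤ j → f j = 0 := by
  have key : ∀ n j, 1 ≤ j → m ≤ j + n → f j = 0 := by
    intro n
    induction n with
    | zero => exact fun j _ h => hm j h
    | succ n ih =>
      intro j h1 h2
      have h3 := hr j h1
      rw [ih (j + 1) (by lia) (by lia), mul_zero, add_zero] at h3
      rcases hl j h1 with h | h
      · exact h
      · exact (mul_eq_zero.1 h3).resolve_left h
  exact fun j h => key m j h (by lia)

/-- The exponents `(u, u, w)`, `u ≥ 0`, at which `Λ_{4,I}` has vanishing Koszul vector. -/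
def Resonant (a b : ℝ) (u w : ℤ) : Prop := 0 ≤ u ∧ -1 ≤ w ∧ b * u = a * w

/-- If a two-term recursion on the diagonal line through a resonant point is verified at all
points that precede the resonant one, then the solution vanishes there. -/
theorem Resonant.vanish {a b : ℝ} (ha : a ≠ 0) {u w : ℤ} (h : Resonant a b u w) {f : ℤ → ℤ → ℝ}
    (hf : ∀ u' w', w' < -1 → f u' w' = 0) (g : ℤ → ℝ)
    (hr : ∀ u' w', w' < w →
      (b * u' - a * w') * f u' w' + g u' * f (u' + 1) (w' - 2) = 0) :
    f (u + 1) (w - 2) = 0 := by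
  obtain ⟨hu, hw, huw⟩ := h
  have := recursion_vanish (f := fun j => f (u + j) (w - 2 * j))
    (lam := fun j => b * ((u + j : ℤ) : ℝ) - a * ((w - 2 * j : ℤ) : ℝ))
    (g := fun j => g (u + j)) (m := (w + 2).toNat) (fun j hj => hf _ _ (by lia))
    (fun j hj => by
      have := hr (u + j) (w - 2 * j) (by lia)
      rw [← this]
      push_cast
      ring_nf)
    (fun j hj => by
      by_cases hμ : 2 * a + b = 0
      · left
        apply hf
        have h1 : a * (w + 2 * u : ℤ) = 0 := by push_cast; linear_combination hμ * u - huw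
        have h2 : w + 2 * u = 0 := by exact_mod_cast (mul_eq_zero.1 h1).resolve_left ha
        lia
      · right
        have : b * ((u + j : ℤ) : ℝ) - a * ((w - 2 * j : ℤ) : ℝ) = (2 * a + b) * j := by
          push_cast; linear_combination huw
        rw [this]
        exact mul_ne_zero hμ (by exact_mod_cast (by lia : j ≠ 0)))
    1 le_rfl
  simpa using this

/-! ### Leading parts that represent the classes -/

/-- The exponents at which the Koszul complex of `Λ_{4,I}` is not acyclic: the components of the
Koszul vector vanish, except possibly those in the directions where the exponent is `-1`. -/
def Harm (a b : ℝ) (u v w : ℤ) : Prop :=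
  (u ≠ -1 → b * v - a * w = 0) ∧ (v ≠ -1 → a * w - b * u = 0) ∧ (w ≠ -1 → a * (u - v) = 0)

/-- The diagonal line through `(-1, -1, w)` contains a resonant point `(u, u, w - 2(u+1))` with
`u < N`. -/
def Crit (a b : ℝ) (N w : ℤ) : Prop := ∃ u < N, Resonant a b u (w - 2 * (u + 1))

/-- The polyvector fields whose coefficients at level `w` verify the conditions that characterize
the leading parts of the representatives of the terms of a package: they live where the Koszul
complex of `Λ_{4,I}` is not acyclic, the obstructions `qcoef` and `mcoef` to closedness, which are
met within the first `2 N` levels, vanish, and the components at `u = v = -1` that are coboundaries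
of such obstructed cochains are absent. -/
def leadSpace (a b : ℝ) (N w : ℤ) : Submodule ℝ Polyvec where
  carrier := {P | (∀ S u v, ¬ Harm a b u v w → ycoef P S u v w = 0) ∧
    (∀ u, 0 ≤ u → u < N → qcoef P u w = 0) ∧ (∀ u, 0 ≤ u → u < N → mcoef P u w = 0) ∧
    (Crit a b N w → ycoef P {0, 1} (-1) (-1) w = 0 ∧ ycoef P {0, 1, 2} (-1) (-1) w = 0)}
  zero_mem' := by simp [qcoef, mcoef]
  add_mem' := by
    rintro P Q ⟨h1, h2, h3, h4⟩ ⟨k1, k2, k3, k4⟩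
    refine ⟨fun S u v h => by simp [h1 S u v h, k1 S u v h], fun u hu hN => ?_, fun u hu hN => ?_,
      fun h => by simp [h4 h, k4 h]⟩
    · rw [← add_zero 0]
      nth_rw 2 [← h2 u hu hN]
      rw [← k2 u hu hN]
      simp only [qcoef, ycoef_add]; ring
    · rw [← add_zero 0]
      nth_rw 2 [← h3 u hu hN]
      rw [← k3 u hu hN]
      simp only [mcoef, ycoef_add]; ring
  smul_mem' := by
    rintro c P ⟨h1, h2, h3, h4⟩
    refine ⟨fun S u v h => by simp [h1 S u v h], fun u hu hN => ?_, fun u hu hN => ?_,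
      fun h => by simp [h4 h]⟩
    · rw [← mul_zero c, ← h2 u hu hN]
      simp only [qcoef, ycoef_smul]; ring
    · rw [← mul_zero c, ← h3 u hu hN]
      simp only [mcoef, ycoef_smul]; ring

theorem qcoef_of_lt {P : Polyvec} {u w : ℤ} (h : u < 0 ∨ w < -1) : qcoef P u w = 0 := by
  rw [qcoef, ycoef_of_neg (by simp [ind]; lia), ycoef_of_neg (by simp [ind]; lia),
    ycoef_of_neg (by simp [ind]; lia)]
  simp

theorem mcoef_of_lt {P : Polyvec} {u w : ℤ} (h : u < 0 ∨ w < -1) : mcoef P u w = 0 := by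
  rw [mcoef, ycoef_of_neg (by simp [ind]; lia), ycoef_of_neg (by simp [ind]; lia)]
  simp

/-- A nonzero leading part in `leadSpace a b N w` is not hit by the differential of a cochain of
level at least `w - (2 N + 1)`. -/
theorem leadSpace_not_hit {a b : ℝ} (ha : a ≠ 0) (hb : b ≠ 0) {N w : ℤ} (hN : 0 ≤ N)
    {P Q : Polyvec} (hP : P ∈ leadSpace a b N w)
    (hQ : ∀ S u v w', w' < w - (2 * N + 1) → ycoef Q S u v w' = 0)
    (hd : ∀ S u v w', w' < w → ycoef (coboundary (lambda4 a b) Q) S u v w' = 0)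
    (hPQ : ∀ S u v, ycoef P S u v w = ycoef (coboundary (lambda4 a b) Q) S u v w) :
    ∀ S u v, ycoef P S u v w = 0 := by
  obtain ⟨h1, -, -, h4⟩ := hP
  intro S u v
  by_cases hH : Harm a b u v w
  swap
  · exact h1 S u v hH
  by_cases hlt : u < -1 ∨ v < -1 ∨ w < -1
  · exact ycoef_of_lt_neg_one hlt
  push Not at hlt
  obtain ⟨x1, x2, x3⟩ := hH
  obtain ⟨c, c0, c1, c2, c01, c02, c12, c012⟩ := ycoef_coboundary a b Q u v w
  have rA (u' w' : ℤ) (h : w' < w) := (coboundary_diag_zero a b Q u' w').symm.trans (hd _ _ _ _ h)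
  have rD (u' w' : ℤ) (h : w' < w) := (coboundary_diag_two a b Q u' w').symm.trans (hd _ _ _ _ h)
  have rM (u' w' : ℤ) (h : w' < w) := (coboundary_diag_m a b Q u' w').symm.trans (hd _ _ _ _ h)
  have rQ (u' w' : ℤ) (h : w' < w) := (coboundary_diag_q a b Q u' w').symm.trans
    (show _ = (0 : ℝ) by rw [hd _ _ _ _ h, hd _ _ _ _ h]; simp)
  by_cases hu : u = -1
  · subst hu
    by_cases hv : v = -1
    · subst hv
      by_cases hC : Crit a b N w
      · revert S
        refine forall_fin3 ?_ ?_ ?_ ?_ (h4 hC).1 ?_ ?_ (h4 hC).2 <;>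
        exact ycoef_of_neg (by simp [ind])
      · -- Without a resonant point in reach, everything on the line vanishes.
        have key (f : ℤ → ℤ → ℝ) (g : ℤ → ℝ) (hf : ∀ u' w', w' < -1 → f u' w' = 0)
            (hf' : ∀ u' w', w' < w - (2 * N + 1) → f u' w' = 0)
            (hr : ∀ u' w', w' < w →
              (b * u' - a * w') * f u' w' + g u' * f (u' + 1) (w' - 2) = 0) :
            f 0 (w - 2) = 0 := by
          have := recursion_vanish (f := fun j => f (j - 1) (w - 2 * j))
            (lam := fun j => b * ((j - 1 : ℤ) : ℝ) - a * ((w - 2 * j : ℤ) : ℝ))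
            (g := fun j => g (j - 1)) (m := (N + 1).toNat) (fun j hj => hf' _ _ (by lia))
            (fun j hj => by
              have := hr (j - 1) (w - 2 * j) (by lia)
              rw [← this]
              push_cast
              ring_nf)
            (fun j hj => by
              by_cases h5 : w - 2 * j < w - (2 * N + 1)
              · exact Or.inl (hf' _ _ h5)
              by_cases h6 : w - 2 * (j : ℤ) < -1
              · exact Or.inl (hf _ _ h6)
              refine Or.inr fun h7 => hC ⟨j - 1, by lia, by lia, by lia, ?_⟩
              rw [show w - 2 * ((j : ℤ) - 1 + 1) = w - 2 * j by ring]
              linear_combination h7)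
            1 le_rfl
          simpa using this
        have eD := key (fun u' w' => ycoef Q {2} u' u' w') (fun u' => u' + 1)
          (fun u' w' h => ycoef_of_lt_neg_one (by lia)) (fun u' w' h => hQ _ _ _ _ h) rD
        have eQ := key (qcoef Q) (fun u' => u' + 2) (fun u' w' h => qcoef_of_lt (Or.inr h))
          (fun u' w' h => by simp [qcoef, hQ _ _ _ _ h]) rQ
        have eM := key (mcoef Q) (fun u' => u' + 2) (fun u' w' h => mcoef_of_lt (Or.inr h))
          (fun u' w' h => by simp [mcoef, hQ _ _ _ _ h]) rM
        revert S
        refine forall_fin3 ?_ ?_ ?_ ?_ ?_ ?_ ?_ ?_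
        · exact ycoef_of_neg (by simp [ind])
        · exact ycoef_of_neg (by simp [ind])
        · exact ycoef_of_neg (by simp [ind])
        · exact ycoef_of_neg (by simp [ind])
        · have k1 := coboundary_diag_q a b Q (-1) w
          have k2 : ycoef (coboundary (lambda4 a b) Q) {0, 2} (-1) (-1) w = 0 :=
            ycoef_of_neg (by simp [ind])
          rw [hPQ]
          rw [qcoef_of_lt (by lia)] at k1
          simp only [Int.reduceNeg, Int.reduceAdd] at k1
          rw [eQ] at k1
          linear_combination k1 + 2 * k2
        · exact ycoef_of_neg (by simp [ind])
        · exact ycoef_of_neg (by simp [ind])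
        · have k1 := coboundary_diag_m a b Q (-1) w
          rw [hPQ]
          rw [mcoef_of_lt (by lia)] at k1
          simp only [Int.reduceNeg, Int.reduceAdd] at k1
          rw [eM] at k1
          linear_combination k1
    · have hw : w = -1 := by
        by_contra hw
        have := (mul_eq_zero.1 (x3 hw)).resolve_left ha
        exact hv (by exact_mod_cast (sub_eq_zero.1 this).symm)
      subst hw
      have y2 := x2 hv
      revert S
      refine forall_fin3 ?_ ?_ ?_ ?_ ?_ ?_ ?_ ?_
      · exact ycoef_of_neg (by simp [ind])
      · exact ycoef_of_neg (by simp [ind])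
      · exact ycoef_of_neg (by simp [ind])
      · exact ycoef_of_neg (by simp [ind])
      · exact ycoef_of_neg (by simp [ind])
      · rw [hPQ, c02, ycoef_of_neg (S := {2}) (by simp [ind]),
          ycoef_of_neg (S := {0}) (by simp [ind]), ycoef_of_neg (S := {2}) (by simp [ind])]
        ring
      · exact ycoef_of_neg (by simp [ind])
      · rw [hPQ, c012, y2, ycoef_of_neg (S := {1, 2}) (by simp [ind]),
          ycoef_of_neg (S := {0, 1}) (by simp [ind]),
          ycoef_of_neg (S := {1, 2}) (by simp [ind]),
          ycoef_of_neg (S := {0, 2}) (u := -1 + 1) (by simp [ind])]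
        ring
  · by_cases hv : v = -1
    · subst hv
      have hw : w = -1 := by
        by_contra hw
        have := (mul_eq_zero.1 (x3 hw)).resolve_left ha
        exact hu (by exact_mod_cast (sub_eq_zero.1 this))
      subst hw
      have y1 := x1 hu
      revert S
      refine forall_fin3 ?_ ?_ ?_ ?_ ?_ ?_ ?_ ?_
      · exact ycoef_of_neg (by simp [ind])
      · exact ycoef_of_neg (by simp [ind])
      · exact ycoef_of_neg (by simp [ind])
      · exact ycoef_of_neg (by simp [ind])
      · exact ycoef_of_neg (by simp [ind])
      · exact ycoef_of_neg (by simp [ind])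
      · rw [hPQ, c12, ycoef_of_neg (S := {2}) (by simp [ind]),
          ycoef_of_neg (S := {1}) (by simp [ind]), ycoef_of_neg (S := {2}) (by simp [ind])]
        ring
      · rw [hPQ, c012, y1, ycoef_of_neg (S := {0, 2}) (v := -1) (by simp [ind]),
          ycoef_of_neg (S := {0, 1}) (by simp [ind]),
          ycoef_of_neg (S := {1, 2}) (v := -1 + 1) (by simp [ind]),
          ycoef_of_neg (S := {0, 2}) (by simp [ind])]
        ring
    · have y1 := x1 hu
      have y2 := x2 hv
      have huv : u = v := by
        have : b * ((u : ℝ) - v) = 0 := by linear_combination -y1 - y2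
        exact_mod_cast sub_eq_zero.1 ((mul_eq_zero.1 this).resolve_left hb)
      subst huv
      have hres : Resonant a b u w := ⟨by lia, by lia, by linear_combination y1⟩
      have eA := hres.vanish ha (f := fun u' w' => ycoef Q ∅ u' u' w')
        (fun u' w' h => ycoef_of_lt_neg_one (by lia)) (fun u' => u' + 1) rA
      have eD := hres.vanish ha (f := fun u' w' => ycoef Q {2} u' u' w')
        (fun u' w' h => ycoef_of_lt_neg_one (by lia)) (fun u' => u' + 1) rD
      have eQ := hres.vanish ha (f := qcoef Q)
        (fun u' w' h => qcoef_of_lt (by lia)) (fun u' => u' + 2) rQ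
      have eM := hres.vanish ha (f := mcoef Q)
        (fun u' w' h => mcoef_of_lt (by lia)) (fun u' => u' + 2) rM
      rw [qcoef, eD] at eQ
      rw [mcoef] at eM
      rw [hPQ]
      revert S
      refine forall_fin3 c ?_ ?_ ?_ ?_ ?_ ?_ ?_
      · rw [c0, y1, eA]; ring
      · rw [c1, y2, eA]; ring
      · rw [c2]; ring
      · rw [c01, y1, y2, eD]; linear_combination (u + 2) * eQ
      · rw [c02, y1, eD]; ring
      · rw [c12, y2, eD]; ring
      · rw [c012, y1, y2]; linear_combination (u + 2) * eM

/-! ### Contracting homotopy of the Koszul complexes -/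

/-- Contraction with the `i`-th coordinate, of an exterior form on a three-dimensional space given
by its components in the basis of increasing wedge products. -/
def contract (i : Fin 3) (f : Finset (Fin 3) → ℝ) (S : Finset (Fin 3)) : ℝ :=
  if i ∈ S then 0 else (-1) ^ (S.filter fun j => j < i).card * f (insert i S)

theorem contract_zero (f : Finset (Fin 3) → ℝ) :
    contract 0 f ∅ = f {0} ∧ contract 0 f {0} = 0 ∧ contract 0 f {1} = f {0, 1} ∧
    contract 0 f {2} = f {0, 2} ∧ contract 0 f {0, 1} = 0 ∧ contract 0 f {0, 2} = 0 ∧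
    contract 0 f {1, 2} = f {0, 1, 2} ∧ contract 0 f {0, 1, 2} = 0 := by
  simp [contract]

theorem contract_one (f : Finset (Fin 3) → ℝ) :
    contract 1 f ∅ = f {1} ∧ contract 1 f {0} = -f {0, 1} ∧ contract 1 f {1} = 0 ∧
    contract 1 f {2} = f {1, 2} ∧ contract 1 f {0, 1} = 0 ∧ contract 1 f {0, 2} = -f {0, 1, 2} ∧
    contract 1 f {1, 2} = 0 ∧ contract 1 f {0, 1, 2} = 0 := by
  simp [contract, Finset.filter_insert, Finset.filter_singleton, Finset.insert_comm (1 : Fin 3) 0,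
    Finset.pair_comm (1 : Fin 3) 0]

theorem contract_two (f : Finset (Fin 3) → ℝ) :
    contract 2 f ∅ = f {2} ∧ contract 2 f {0} = -f {0, 2} ∧ contract 2 f {1} = -f {1, 2} ∧
    contract 2 f {2} = 0 ∧ contract 2 f {0, 1} = f {0, 1, 2} ∧ contract 2 f {0, 2} = 0 ∧
    contract 2 f {1, 2} = 0 ∧ contract 2 f {0, 1, 2} = 0 := by
  simp [contract, Finset.filter_insert, Finset.filter_singleton, Finset.insert_comm (2 : Fin 3) 0,
    Finset.pair_comm (2 : Fin 3) 0, Finset.pair_comm (2 : Fin 3) 1]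

theorem contract_ne_zero {i : Fin 3} {f : Finset (Fin 3) → ℝ} {S : Finset (Fin 3)}
    (h : contract i f S ≠ 0) : i ∉ S ∧ f (insert i S) ≠ 0 := by
  unfold contract at h
  split_ifs at h with hi
  · exact absurd rfl h
  · exact ⟨hi, right_ne_zero_of_mul h⟩

theorem ind_insert_self (i : Fin 3) (S : Finset (Fin 3)) : ind i (insert i S) = 1 := by simp [ind]

theorem ind_insert_ne {i j : Fin 3} (h : j ≠ i) (S : Finset (Fin 3)) :
    ind j (insert i S) = ind j S := by simp [ind, h]

open Classical in
/-- The contraction that inverts `d'` at level `w`: at each exponent, one divides by a nonzero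
component of the Koszul vector in a direction in which the exponent is not `-1`. -/
def homotopyCoef (a b : ℝ) (P : Polyvec) (w : ℤ) (S : Finset (Fin 3)) (u v w' : ℤ) : ℝ :=
  if w' = w then
    if u ≠ -1 ∧ b * v - a * w ≠ 0 then
      contract 0 (fun T => ycoef P T u v w) S / (b * v - a * w)
    else if v ≠ -1 ∧ a * w - b * u ≠ 0 then
      contract 1 (fun T => ycoef P T u v w) S / (a * w - b * u)
    else if w ≠ -1 ∧ a * ((u : ℝ) - v) ≠ 0 then
      contract 2 (fun T => ycoef P T u v w) S / (a * (u - v))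
    else 0
  else 0

theorem homotopyCoef_ne_zero {a b : ℝ} {P : Polyvec} {w : ℤ} {S : Finset (Fin 3)} {u v w' : ℤ}
    (h : homotopyCoef a b P w S u v w' ≠ 0) :
    Adm S u v w' ∧ w' = w ∧ ∃ i ∉ S, ycoef P (insert i S) u v w ≠ 0 := by
  unfold homotopyCoef at h
  split_ifs at h with h1 h2 h3 h4
  · subst h1
    obtain ⟨hi, hne⟩ := contract_ne_zero (left_ne_zero_of_mul h)
    refine ⟨?_, rfl, 0, hi, hne⟩
    obtain ⟨k0, k1, k2⟩ := not_not.1 (mt ycoef_of_not_adm hne)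
    rw [ind_insert_self] at k0
    rw [ind_insert_ne (by decide)] at k1 k2
    exact ⟨by have := ind_nonneg 0 S; lia, k1, k2⟩
  · subst h1
    obtain ⟨hi, hne⟩ := contract_ne_zero (left_ne_zero_of_mul h)
    refine ⟨?_, rfl, 1, hi, hne⟩
    obtain ⟨k0, k1, k2⟩ := not_not.1 (mt ycoef_of_not_adm hne)
    rw [ind_insert_self] at k1
    rw [ind_insert_ne (by decide)] at k0 k2
    exact ⟨k0, by have := ind_nonneg 1 S; lia, k2⟩
  · subst h1
    obtain ⟨hi, hne⟩ := contract_ne_zero (left_ne_zero_of_mul h)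
    refine ⟨?_, rfl, 2, hi, hne⟩
    obtain ⟨k0, k1, k2⟩ := not_not.1 (mt ycoef_of_not_adm hne)
    rw [ind_insert_self] at k2
    rw [ind_insert_ne (by decide)] at k0 k1
    exact ⟨k0, k1, by have := ind_nonneg 2 S; lia⟩
  · exact absurd rfl h
  · exact absurd rfl h

/-- If the leading part of `P`, at level `w`, is a cocycle of `d'`, then it can be changed by a
coboundary so that it is concentrated in the exponents where the Koszul complex of `Λ_{4,I}`
is not acyclic. -/
theorem exists_homotopy {a b : ℝ} {P : Polyvec} {w : ℤ}
    (h0 : ∀ S u v w', w' < w → ycoef P S u v w' = 0)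
    (hd : ∀ S u v, ycoef (coboundary (lambda4 a b) P) S u v w = 0) :
    ∃ Q : Polyvec, (∀ S u v w', ycoef Q S u v w' ≠ 0 →
        w' = w ∧ ∃ i ∉ S, ycoef P (insert i S) u v w ≠ 0) ∧
      ∀ S u v, ¬ Harm a b u v w →
        ycoef P S u v w = ycoef (coboundary (lambda4 a b) Q) S u v w := by
  have hQ (S : Finset (Fin 3)) (u v w' : ℤ) : ycoef (ofYcoef (homotopyCoef a b P w)) S u v w' =
      homotopyCoef a b P w S u v w' := by
    rw [ycoef_ofYcoef]
    split_ifs with h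
    · rfl
    · by_contra hne
      exact h (homotopyCoef_ne_zero (Ne.symm hne)).1
  refine ⟨ofYcoef (homotopyCoef a b P w), fun S u v w' h => ?_, fun S u v hH => ?_⟩
  · rw [hQ] at h
    exact (homotopyCoef_ne_zero h).2
  have hz (S : Finset (Fin 3)) (u v : ℤ) : homotopyCoef a b P w S u v (w - 2) = 0 := by
    rw [homotopyCoef, if_neg (by lia)]
  obtain ⟨-, k0, k1, k2, k01, k02, k12, k012⟩ := ycoef_coboundary a b P u v w
  simp only [hd, h0 _ _ _ _ (show w - 2 < w by lia), mul_zero, add_zero, sub_zero]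
    at k0 k1 k2 k01 k02 k12 k012
  obtain ⟨c, c0, c1, c2, c01, c02, c12, c012⟩ :=
    ycoef_coboundary a b (ofYcoef (homotopyCoef a b P w)) u v w
  simp only [hQ, hz, mul_zero, add_zero, sub_zero] at c c0 c1 c2 c01 c02 c12 c012
  revert S
  by_cases h1 : u ≠ -1 ∧ b * v - a * w ≠ 0
  · have e (S) : homotopyCoef a b P w S u v w =
        contract 0 (fun T => ycoef P T u v w) S / (b * v - a * w) := by
      rw [homotopyCoef, if_pos rfl, if_pos h1]
    obtain ⟨t, t0, t1, t2, t01, t02, t12, t012⟩ := contract_zero (fun T => ycoef P T u v w)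
    have hX := h1.2
    simp only [e, t, t0, t1, t2, t01, t02, t12] at c0 c1 c2 c01 c02 c12 c012
    generalize b * (v : ℝ) - a * w = X at *
    refine forall_fin3 ?_ ?_ ?_ ?_ ?_ ?_ ?_ ?_
    · rw [c]; exact (mul_eq_zero.1 k0.symm).resolve_left hX
    · rw [c0]; field_simp
    · rw [c1]; field_simp; linear_combination -k01
    · rw [c2]; field_simp; linear_combination -k02
    · rw [c01]; field_simp; ring
    · rw [c02]; field_simp; ring
    · rw [c12]; field_simp; linear_combination -k012
    · rw [c012]; field_simp; ring
  by_cases h2 : v ≠ -1 ∧ a * w - b * u ≠ 0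
  · have e (S) : homotopyCoef a b P w S u v w =
        contract 1 (fun T => ycoef P T u v w) S / (a * w - b * u) := by
      rw [homotopyCoef, if_pos rfl, if_neg h1, if_pos h2]
    obtain ⟨t, t0, t1, t2, t01, t02, t12, t012⟩ := contract_one (fun T => ycoef P T u v w)
    have hX := h2.2
    simp only [e, t, t0, t1, t2, t01, t02, t12] at c0 c1 c2 c01 c02 c12 c012
    generalize a * (w : ℝ) - b * u = X at *
    refine forall_fin3 ?_ ?_ ?_ ?_ ?_ ?_ ?_ ?_
    · rw [c]; exact (mul_eq_zero.1 k1.symm).resolve_left hX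
    · rw [c0]; field_simp; linear_combination k01
    · rw [c1]; field_simp
    · rw [c2]; field_simp; linear_combination -k12
    · rw [c01]; field_simp; ring
    · rw [c02]; field_simp; linear_combination k012
    · rw [c12]; field_simp; ring
    · rw [c012]; field_simp; ring
  by_cases h3 : w ≠ -1 ∧ a * ((u : ℝ) - v) ≠ 0
  · have e (S) : homotopyCoef a b P w S u v w =
        contract 2 (fun T => ycoef P T u v w) S / (a * (u - v)) := by
      rw [homotopyCoef, if_pos rfl, if_neg h1, if_neg h2, if_pos h3]
    obtain ⟨t, t0, t1, t2, t01, t02, t12, t012⟩ := contract_two (fun T => ycoef P T u v w)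
    have hX := h3.2
    simp only [e, t, t0, t1, t2, t01, t02, t12] at c0 c1 c2 c01 c02 c12 c012
    generalize a * ((u : ℝ) - v) = X at *
    refine forall_fin3 ?_ ?_ ?_ ?_ ?_ ?_ ?_ ?_
    · rw [c]; exact (mul_eq_zero.1 k2.symm).resolve_left hX
    · rw [c0]; field_simp; linear_combination k02
    · rw [c1]; field_simp; linear_combination k12
    · rw [c2]; field_simp
    · rw [c01]; field_simp; linear_combination -k012
    · rw [c02]; field_simp; ring
    · rw [c12]; field_simp; ring
    · rw [c012]; field_simp; ring
  · exact absurd ⟨fun h => by_contra fun h' => h1 ⟨h, h'⟩, fun h => by_contra fun h' => h2 ⟨h, h'⟩,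
      fun h => by_contra fun h' => h3 ⟨h, h'⟩⟩ hH

/-! ### Cochains that hit the critical classes -/

theorem Resonant.koszul_eq {a b : ℝ} {u w : ℤ} (h : Resonant a b u w) (u' : ℤ) :
    b * u' - a * ((w + 2 * (u - u') : ℤ) : ℝ) = (2 * a + b) * (u' - u) := by
  push_cast; linear_combination h.2.2

/-- If `2 a + b = 0`, the Koszul vector is constant along the diagonal lines, and the origin is
the only resonant point. -/
theorem Resonant.two_mul_add_ne_zero {a b : ℝ} (ha : a ≠ 0) {u w : ℤ} (h : Resonant a b u w)
    (hu : u ≠ 0) : 2 * a + b ≠ 0 := by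
  intro hμ
  have h1 : a * (w + 2 * u : ℤ) = 0 := by push_cast; linear_combination hμ * u - h.2.2
  have h2 : w + 2 * u = 0 := by exact_mod_cast (mul_eq_zero.1 h1).resolve_left ha
  have := h.1
  have := h.2.1
  lia

/-- A solution of a two-term recursion along the diagonal line, from a resonant point downwards
to the end of the line. -/
theorem Resonant.exists_chain {a b : ℝ} (ha : a ≠ 0) {u w : ℤ} (h : Resonant a b u w) {c : ℝ}
    (hc : 0 < c) : ∃ f : ℤ → ℝ, f u = 1 ∧ f 0 ≠ 0 ∧ (∀ u', u' < 0 ∨ u < u' → f u' = 0) ∧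
      ∀ u', 0 ≤ u' → (2 * a + b) * (u' - u) * f u' + (u' + c) * f (u' + 1) = 0 := by
  set F : ℕ → ℝ := fun k =>
    Nat.rec 1 (fun k r => (u - k - 1 + c) / ((2 * a + b) * (k + 1)) * r) k with hF
  have hF1 (k : ℕ) : F (k + 1) = (u - k - 1 + c) / ((2 * a + b) * (k + 1)) * F k := rfl
  have hne : ∀ k : ℕ, (k : ℤ) ≤ u → F k ≠ 0 := by
    intro k
    induction k with
    | zero => exact fun _ => one_ne_zero
    | succ k ih =>
      intro hk
      have h1 : (0 : ℝ) ≤ u - k - 1 := by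
        have : ((k + 1 : ℕ) : ℝ) ≤ u := by exact_mod_cast hk
        push_cast at this; linarith
      rw [hF1]
      exact mul_ne_zero (div_ne_zero (by positivity)
        (mul_ne_zero (h.two_mul_add_ne_zero ha (by lia)) (by positivity))) (ih (by lia))
  have hu := h.1
  refine ⟨fun u' => if 0 ≤ u' ∧ u' ≤ u then F (u - u').toNat else 0, ?_, ?_, ?_, ?_⟩
  · simp [hu, hF]
  · simpa [hu] using hne _ (by lia)
  · exact fun u' h' => if_neg (by lia)
  · intro u' hu'
    beta_reduce
    rcases lt_trichotomy u' u with h1 | h1 | h1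
    · rw [if_pos ⟨hu', h1.le⟩, if_pos ⟨by lia, by lia⟩]
      obtain ⟨k, hk⟩ : ∃ k : ℕ, u - u' = k + 1 := ⟨(u - u' - 1).toNat, by lia⟩
      rw [show (u - u').toNat = k + 1 by lia, show (u - (u' + 1)).toNat = k by lia, hF1]
      have hk' : (u' : ℝ) = u - k - 1 := by
        have : (u : ℝ) - u' = k + 1 := by exact_mod_cast hk
        linarith
      have h3 : 2 * a + b ≠ 0 := h.two_mul_add_ne_zero ha (by lia)
      have h4 : (k : ℝ) + 1 ≠ 0 := by positivity
      rw [hk']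
      field_simp
      ring
    · subst h1
      rw [if_neg (show ¬ (0 ≤ u' + 1 ∧ u' + 1 ≤ u') by lia)]
      ring
    · rw [if_neg (by lia), if_neg (by lia)]
      ring

/-- From each resonant point starts a 1-cochain whose coboundary is `Y₁₂`, at the end of the
diagonal line. -/
theorem Resonant.exists_kill_two {a b : ℝ} (ha : a ≠ 0) {u w : ℤ} (h : Resonant a b u w) :
    ∃ Q : Polyvec, (∀ S u' v' w', w' < w → ycoef Q S u' v' w' = 0) ∧
      ∀ S u' v' w', ycoef (coboundary (lambda4 a b) Q) S u' v' w' =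
        if S = {0, 1} ∧ u' = -1 ∧ v' = -1 ∧ w' = w + 2 * (u + 1) then 1 else 0 := by
  obtain ⟨f, f1, -, f2, f3⟩ := h.exists_chain ha one_pos
  obtain ⟨g, g1, g0, g2, g3⟩ := h.exists_chain ha two_pos
  obtain ⟨hu, hw, huw⟩ := id h
  -- The combination `qcoef` of the coefficients equals `-2 g`; the coefficient of `Y₁` vanishes
  -- at the resonant point itself, where the exponent of `z` can be `-1`.
  set c : Finset (Fin 3) → ℤ → ℤ → ℤ → ℝ := fun S u' v' w' =>
    if u' = v' ∧ w' = w + 2 * (u - u') then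
      if S = {0} then 2 * (f u' - g u') else if S = {2} then f u' else 0
    else 0 with hc
  have hQ (S : Finset (Fin 3)) (u' v' w' : ℤ) : ycoef (ofYcoef c) S u' v' w' = c S u' v' w' := by
    rw [ycoef_ofYcoef]
    split_ifs with hA
    · rfl
    · simp only [hc]
      split_ifs with h1 h2 h3
      · obtain ⟨rfl, rfl⟩ := h1
        subst h2
        simp only [Adm, ind] at hA
        by_cases h4 : u' < 0 ∨ u < u'
        · rw [f2 _ h4, g2 _ h4]; simp
        · obtain rfl : u' = u := by
            by_contra h5
            exact hA ⟨by simp; lia, by simp; lia, by simp; lia⟩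
          rw [f1, g1]; simp
      · obtain ⟨rfl, rfl⟩ := h1
        subst h3
        rw [f2]
        by_contra h5
        exact hA ⟨by simp [ind]; lia, by simp [ind]; lia, by simp [ind]; lia⟩
      · rfl
      · rfl
  have key (S u' v' w') : ycoef (coboundary (lambda4 a b) (ofYcoef c)) S u' v' w' =
      if S = {0, 1} ∧ u' = -1 ∧ v' = -1 ∧ w' = w + 2 * (u + 1) then -2 * g 0 else 0 := by
    obtain ⟨k, k0, k1, k2, k01, k02, k12, k012⟩ := ycoef_coboundary a b (ofYcoef c) u' v' w'
    simp only [hQ] at k0 k1 k2 k01 k02 k12 k012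
    by_cases hline : u' = v' ∧ w' = w + 2 * (u - u')
    swap
    · rw [if_neg (by rintro ⟨-, rfl, rfl, rfl⟩; exact hline ⟨rfl, by ring⟩)]
      have z1 (S) : c S u' v' w' = 0 := if_neg hline
      have z2 (S) : c S (u' + 1) (v' + 1) (w' - 2) = 0 := if_neg (by lia)
      simp only [z1, z2, mul_zero, add_zero, sub_zero] at k0 k1 k2 k01 k02 k12 k012
      revert S
      exact forall_fin3 k k0 k1 k2 k01 k02 k12 k012
    obtain ⟨rfl, rfl⟩ := hline
    have z1 (S) : c S u' u' (w + 2 * (u - u')) =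
      if S = {0} then 2 * (f u' - g u') else if S = {2} then f u' else 0 := if_pos ⟨rfl, rfl⟩
    have z2 (S) : c S (u' + 1) (u' + 1) (w + 2 * (u - u') - 2) =
      if S = {0} then 2 * (f (u' + 1) - g (u' + 1)) else if S = {2} then f (u' + 1) else 0 :=
      if_pos ⟨rfl, by ring⟩
    have d1 : (∅ : Finset (Fin 3)) ≠ {0} ∧ (∅ : Finset (Fin 3)) ≠ {2} ∧
      ({1} : Finset (Fin 3)) ≠ {0} ∧ ({1} : Finset (Fin 3)) ≠ {2} ∧
      ({2} : Finset (Fin 3)) ≠ {0} ∧ ({0, 1} : Finset (Fin 3)) ≠ {0} ∧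
      ({0, 1} : Finset (Fin 3)) ≠ {2} ∧ ({0, 2} : Finset (Fin 3)) ≠ {0} ∧
      ({0, 2} : Finset (Fin 3)) ≠ {2} ∧ ({1, 2} : Finset (Fin 3)) ≠ {0} ∧
      ({1, 2} : Finset (Fin 3)) ≠ {2} := by decide
    have hlam := h.koszul_eq u'
    have hlam' : a * ((w + 2 * (u - u') : ℤ) : ℝ) - b * u' = -((2 * a + b) * (u' - u)) := by
      rw [← hlam]; ring
    simp only [z1, z2, d1, if_true, if_false, hlam, hlam', sub_self, mul_zero, add_zero, sub_zero,
      zero_mul, zero_sub] at k0 k1 k2 k01 k02 k12 k012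
    have hend (hne : u' ≠ -1) :
        (2 * a + b) * (u' - u) * f u' + (u' + 1) * f (u' + 1) = 0 ∧
        (2 * a + b) * (u' - u) * g u' + (u' + 2) * g (u' + 1) = 0 := by
      by_cases hu' : 0 ≤ u'
      · exact ⟨f3 _ hu', g3 _ hu'⟩
      · rw [f2 _ (by lia), g2 _ (by lia), f2 _ (by lia), g2 _ (by lia)]; simp
    have hf : (2 * a + b) * (u' - u) * f u' + (u' + 1) * f (u' + 1) = 0 := by
      by_cases hne : u' = -1
      · subst hne
        rw [f2 (-1) (by lia)]; simp
      · exact (hend hne).1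
    revert S
    refine forall_fin3 ?_ ?_ ?_ ?_ ?_ ?_ ?_ ?_
    · rw [k, if_neg fun h => absurd h.1 (by decide)]
    · rw [k0, if_neg fun h => absurd h.1 (by decide)]
    · rw [k1, if_neg fun h => absurd h.1 (by decide)]
    · rw [k2, if_neg fun h => absurd h.1 (by decide)]
    · rw [k01]
      by_cases hne : u' = -1
      · subst hne
        rw [if_pos ⟨rfl, rfl, rfl, by ring⟩, f2 (-1) (by lia), g2 (-1) (by lia)]
        push_cast
        ring_nf
      · rw [if_neg (by simp [hne])]
        linear_combination 2 * (hend hne).1 - 2 * (hend hne).2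
    · rw [k02, if_neg fun h => absurd h.1 (by decide)]
      linear_combination hf
    · rw [k12, if_neg fun h => absurd h.1 (by decide)]
      linear_combination -hf
    · rw [k012, if_neg fun h => absurd h.1 (by decide)]
  refine ⟨(-2 * g 0)⁻¹ • ofYcoef c, fun S u' v' w' hlt => ?_, fun S u' v' w' => ?_⟩
  · rw [ycoef_smul, hQ, mul_eq_zero]
    right
    simp only [hc]
    split_ifs with h1 h2 h3
    · rw [f2 _ (by lia), g2 _ (by lia)]; simp
    · exact f2 _ (by lia)
    · rfl
    · rfl
  · rw [map_smul, ycoef_smul, key]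
    split_ifs
    · exact inv_mul_cancel₀ (mul_ne_zero (by norm_num) g0)
    · simp

/-- From each resonant point starts a 2-cochain whose coboundary is `Y₁₂₃`, at the end of the
diagonal line. -/
theorem Resonant.exists_kill_three {a b : ℝ} (ha : a ≠ 0) {u w : ℤ} (h : Resonant a b u w) :
    ∃ Q : Polyvec, (∀ S u' v' w', w' < w → ycoef Q S u' v' w' = 0) ∧
      ∀ S u' v' w', ycoef (coboundary (lambda4 a b) Q) S u' v' w' =
        if S = {0, 1, 2} ∧ u' = -1 ∧ v' = -1 ∧ w' = w + 2 * (u + 1) then 1 else 0 := by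
  obtain ⟨g, g1, g0, g2, g3⟩ := h.exists_chain ha two_pos
  obtain ⟨hu, hw, huw⟩ := id h
  set c : Finset (Fin 3) → ℤ → ℤ → ℤ → ℝ := fun S u' v' w' =>
    if u' = v' ∧ w' = w + 2 * (u - u') then if S = {1, 2} then g u' else 0 else 0 with hc
  have hQ (S : Finset (Fin 3)) (u' v' w' : ℤ) : ycoef (ofYcoef c) S u' v' w' = c S u' v' w' := by
    rw [ycoef_ofYcoef]
    split_ifs with hA
    · rfl
    · simp only [hc]
      split_ifs with h1 h2
      · obtain ⟨rfl, rfl⟩ := h1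
        subst h2
        rw [g2]
        by_contra h5
        exact hA ⟨by simp [ind]; lia, by simp [ind]; lia, by simp [ind]; lia⟩
      · rfl
      · rfl
  have key (S u' v' w') : ycoef (coboundary (lambda4 a b) (ofYcoef c)) S u' v' w' =
      if S = {0, 1, 2} ∧ u' = -1 ∧ v' = -1 ∧ w' = w + 2 * (u + 1) then g 0 else 0 := by
    obtain ⟨k, k0, k1, k2, k01, k02, k12, k012⟩ := ycoef_coboundary a b (ofYcoef c) u' v' w'
    have d1 : (∅ : Finset (Fin 3)) ≠ {1, 2} ∧ ({0} : Finset (Fin 3)) ≠ {1, 2} ∧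
      ({1} : Finset (Fin 3)) ≠ {1, 2} ∧ ({2} : Finset (Fin 3)) ≠ {1, 2} ∧
      ({0, 1} : Finset (Fin 3)) ≠ {1, 2} ∧ ({0, 2} : Finset (Fin 3)) ≠ {1, 2} := by decide
    simp only [hQ] at k0 k1 k2 k01 k02 k12 k012
    simp only [hc, d1, if_false, ite_self, mul_zero, add_zero, sub_zero, if_true]
      at k0 k1 k2 k01 k02 k12 k012
    revert S
    refine forall_fin3 ?_ ?_ ?_ ?_ ?_ ?_ ?_ ?_
    · rw [k, if_neg fun h => absurd h.1 (by decide)]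
    · rw [k0, if_neg fun h => absurd h.1 (by decide)]
    · rw [k1, if_neg fun h => absurd h.1 (by decide)]
    · rw [k2, if_neg fun h => absurd h.1 (by decide)]
    · rw [k01, if_neg fun h => absurd h.1 (by decide)]
    · rw [k02, if_neg fun h => absurd h.1 (by decide)]
    · rw [k12, if_neg fun h => absurd h.1 (by decide)]
    · rw [k012]
      by_cases hline : u' = v' ∧ w' = w + 2 * (u - u')
      · obtain ⟨rfl, rfl⟩ := hline
        rw [if_pos ⟨rfl, rfl⟩, if_pos ⟨rfl, by ring⟩, h.koszul_eq u']
        by_cases hne : u' = -1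
        · subst hne
          rw [if_pos ⟨rfl, rfl, rfl, by ring⟩, g2 (-1) (by lia)]
          push_cast
          ring_nf
        · rw [if_neg (by simp [hne])]
          by_cases hu' : 0 ≤ u'
          · exact g3 _ hu'
          · rw [g2 _ (by lia), g2 _ (by lia)]; simp
      · rw [if_neg hline, if_neg (by lia), if_neg]
        · simp
        · rintro ⟨-, rfl, rfl, rfl⟩; exact hline ⟨rfl, by ring⟩
  refine ⟨(g 0)⁻¹ • ofYcoef c, fun S u' v' w' hlt => ?_, fun S u' v' w' => ?_⟩
  · rw [ycoef_smul, hQ, mul_eq_zero]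
    right
    simp only [hc]
    split_ifs with h1 h2
    · exact g2 _ (by lia)
    · rfl
    · rfl
  · rw [map_smul, ycoef_smul, key]
    split_ifs
    · exact inv_mul_cancel₀ g0
    · simp

/-! ### Reduction of the leading part -/

/-- If the relations that express closedness hold along the whole diagonal line below a point with
`u ≥ 0`, then the solution of the two-term recursion vanishes at this point: the recursion is
solved upwards from the end `u = -1` of the line. -/
theorem recursion_vanish_up {f : ℤ → ℤ → ℝ} {lam : ℤ → ℤ → ℝ} {u w : ℤ} (hu : 0 ≤ u)
    (hf : ∀ w', f (-1) w' = 0)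
    (hr : ∀ u', -1 ≤ u' → u' < u →
      lam u' (w + 2 * (u - u')) * f u' (w + 2 * (u - u')) +
        (u' + 2) * f (u' + 1) (w + 2 * (u - u') - 2) = 0) : f u w = 0 := by
  have key : ∀ i : ℕ, (i : ℤ) ≤ u + 1 → f (-1 + i) (w + 2 * (u - (-1 + i))) = 0 := by
    intro i
    induction i with
    | zero => exact fun _ => hf _
    | succ i ih =>
      intro hi
      have h1 := hr (-1 + i) (by lia) (by lia)
      rw [ih (by lia), mul_zero, zero_add] at h1
      have h2 : ((-1 + i : ℤ) : ℝ) + 2 ≠ 0 := by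
        rw [show ((-1 + i : ℤ) : ℝ) + 2 = (i : ℝ) + 1 by push_cast; ring]
        positivity
      have h3 := (mul_eq_zero.1 h1).resolve_left h2
      rw [← h3]
      congr 1
      · push_cast; ring
      · push_cast; ring
  have := key (u + 1).toNat (by lia)
  rw [← this]
  congr 1 <;> lia

/-- Every cochain whose coboundary vanishes below level `w + 2 M + 4` can be changed by a
coboundary so that its leading part, at level `w`, lies in `leadSpace a b N w`, provided that there
are no resonant points with `M < u < N`. -/
theorem exists_reduction {a b : ℝ} (ha : a ≠ 0) {N M w n : ℤ} (hM : -1 ≤ M)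
    (hgap : ∀ u w', Resonant a b u w' → u < N → u ≤ M) {P : Polyvec} (hn : P ∈ diag n)
    (h0 : ∀ S u v w', w' < w → ycoef P S u v w' = 0)
    (hd : ∀ S u v w', w' < w + 2 * M + 4 → ycoef (coboundary (lambda4 a b) P) S u v w' = 0) :
    ∃ Q : Polyvec, (∀ S u v w', w' < w - (2 * M + 3) → ycoef Q S u v w' = 0) ∧
      coboundary (lambda4 a b) Q ∈ diag n ∧
      (∀ S u v w', w' < w → ycoef (coboundary (lambda4 a b) Q) S u v w' = 0) ∧
      P - coboundary (lambda4 a b) Q ∈ leadSpace a b N w := by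
  obtain ⟨Q₁, hQ₁, hQ₁'⟩ := exists_homotopy h0 (fun S u v => hd S u v w (by lia))
  have hdiag : coboundary (lambda4 a b) Q₁ ∈ diag n := by
    rw [← sub_add_cancel n 1]
    refine coboundary_diag a b (n - 1) Q₁ ((mem_diag_iff _ _).2 fun S u v w' hne => ?_)
    obtain ⟨rfl, i, hi, hne'⟩ := hQ₁ S u v w' hne
    have := (mem_diag_iff _ _).1 hn _ _ _ _ hne'
    rw [Finset.card_insert_of_notMem hi] at this
    push_cast at this
    lia
  have hlow : ∀ S u v w', w' < w → ycoef (coboundary (lambda4 a b) Q₁) S u v w' = 0 := by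
    have h1 : Q₁ ∈ hfil (w + 1) := (mem_hfil_iff _ _).2 fun S u v w' hne => by
      rw [(hQ₁ S u v w' hne).1]
    intro S u v w' hlt
    by_contra hne
    have := (mem_hfil_iff _ _).1 (coboundary_hfil a b _ _ h1) _ _ _ _ hne
    lia
  set P₁ := P - coboundary (lambda4 a b) Q₁ with hP₁
  have hP₁0 : ∀ S u v w', w' < w → ycoef P₁ S u v w' = 0 := fun S u v w' h => by
    rw [hP₁, ycoef_sub, h0 _ _ _ _ h, hlow _ _ _ _ h, sub_zero]
  have hP₁d : coboundary (lambda4 a b) P₁ = coboundary (lambda4 a b) P := by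
    rw [hP₁, map_sub, coboundary_lambda4_sq, sub_zero]
  have hP₁n : P₁ ∈ diag n := sub_mem hn hdiag
  have hP₁h : ∀ S u v, ¬ Harm a b u v w → ycoef P₁ S u v w = 0 := fun S u v h => by
    rw [hP₁, ycoef_sub, hQ₁' S u v h, sub_self]
  -- The components at the end of a line through a resonant point are coboundaries.
  obtain ⟨Q₂, hQ₂, hQ₂', hQ₂''⟩ : ∃ Q₂ : Polyvec,
      (∀ S u v w', w' < w - (2 * M + 3) → ycoef Q₂ S u v w' = 0) ∧
      (Crit a b N w → ∀ S, S = {0, 1} ∨ S = {0, 1, 2} →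
        ycoef (coboundary (lambda4 a b) Q₂) S (-1) (-1) w = ycoef P₁ S (-1) (-1) w) ∧
      (∀ S u v w', ycoef (coboundary (lambda4 a b) Q₂) S u v w' ≠ 0 →
        u = -1 ∧ v = -1 ∧ w' = w ∧ ycoef P₁ S u v w' ≠ 0) := by
    by_cases hC : Crit a b N w
    swap
    · exact ⟨0, by simp, fun h => absurd h hC, by simp⟩
    obtain ⟨u, huN, hres⟩ := hC
    have huM := hgap _ _ hres huN
    obtain ⟨G, hG, hG'⟩ := hres.exists_kill_two ha
    obtain ⟨H, hH, hH'⟩ := hres.exists_kill_three ha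
    simp only [show w - 2 * (u + 1) + 2 * (u + 1) = w by ring] at hG' hH'
    refine ⟨ycoef P₁ {0, 1} (-1) (-1) w • G + ycoef P₁ {0, 1, 2} (-1) (-1) w • H,
      fun S u' v' w' h => ?_, fun _ S hS => ?_, fun S u' v' w' hne => ?_⟩
    · rw [ycoef_add, ycoef_smul, ycoef_smul, hG _ _ _ _ (by lia), hH _ _ _ _ (by lia)]
      simp
    · rw [map_add, map_smul, map_smul, ycoef_add, ycoef_smul, ycoef_smul, hG', hH']
      rcases hS with rfl | rfl
      · rw [if_pos ⟨rfl, rfl, rfl, rfl⟩, if_neg fun h => absurd h.1 (by decide)]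
        ring
      · rw [if_neg fun h => absurd h.1 (by decide), if_pos ⟨rfl, rfl, rfl, rfl⟩]
        ring
    · rw [map_add, map_smul, map_smul, ycoef_add, ycoef_smul, ycoef_smul, hG', hH'] at hne
      by_cases h1 : S = {0, 1} ∧ u' = -1 ∧ v' = -1 ∧ w' = w
      · obtain ⟨rfl, rfl, rfl, rfl⟩ := h1
        rw [if_pos ⟨rfl, rfl, rfl, rfl⟩, if_neg fun h => absurd h.1 (by decide)] at hne
        exact ⟨rfl, rfl, rfl, by simpa using hne⟩
      · rw [if_neg h1, mul_zero, zero_add] at hne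
        by_cases h2 : S = {0, 1, 2} ∧ u' = -1 ∧ v' = -1 ∧ w' = w
        · obtain ⟨rfl, rfl, rfl, rfl⟩ := h2
          exact ⟨rfl, rfl, rfl, left_ne_zero_of_mul hne⟩
        · rw [if_neg h2, mul_zero] at hne
          exact absurd rfl hne
  have hQ₂n : coboundary (lambda4 a b) Q₂ ∈ diag n := (mem_diag_iff _ _).2 fun S u v w' hne =>
    (mem_diag_iff _ _).1 hP₁n _ _ _ _ (hQ₂'' S u v w' hne).2.2.2
  set P₂ := P₁ - coboundary (lambda4 a b) Q₂ with hP₂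
  have hP₂e : P - coboundary (lambda4 a b) (Q₁ + Q₂) = P₂ := by
    rw [hP₂, hP₁, map_add, sub_sub]
  have hP₂d : ∀ S u v w', w' < w + 2 * M + 4 →
      ycoef (coboundary (lambda4 a b) P₂) S u v w' = 0 := fun S u v w' h => by
    rw [hP₂, map_sub, coboundary_lambda4_sq, sub_zero, hP₁d, hd _ _ _ _ h]
  have hP₂h : ∀ S u v, ¬ Harm a b u v w → ycoef P₂ S u v w = 0 := fun S u v h => by
    rw [hP₂, ycoef_sub, hP₁h S u v h, zero_sub, neg_eq_zero]
    by_contra hne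
    obtain ⟨rfl, rfl, -, hne'⟩ := hQ₂'' _ _ _ _ hne
    exact hne' (hP₁h _ _ _ h)
  have hgap' (u : ℤ) (hu : 0 ≤ u) (hN : u < N) (f : Polyvec → ℤ → ℤ → ℝ)
      (hf : (∀ S, ycoef P₂ S u u w = 0) → f P₂ u w = 0)
      (hup : u ≤ M → f P₂ u w = 0) : f P₂ u w = 0 := by
    by_cases hres : Resonant a b u w
    · exact hup (hgap u w hres hN)
    · refine hf fun S => ?_
      by_cases hw : w < -1
      · exact ycoef_of_lt_neg_one (by lia)
      · refine hP₂h S u u fun hH => hres ⟨hu, by lia, ?_⟩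
        linear_combination hH.1 (by lia)
  refine ⟨Q₁ + Q₂, fun S u v w' h => ?_, ?_, fun S u v w' h => ?_, ?_⟩
  · rw [ycoef_add, hQ₂ _ _ _ _ h, add_zero]
    by_contra hne
    have := (hQ₁ _ _ _ _ hne).1
    lia
  · rw [map_add]
    exact add_mem hdiag hQ₂n
  · rw [map_add, ycoef_add, hlow _ _ _ _ h, zero_add]
    by_contra hne
    have := (hQ₂'' _ _ _ _ hne).2.2.1
    lia
  · rw [hP₂e]
    refine ⟨hP₂h, fun u hu hN => ?_, fun u hu hN => ?_, fun hC => ?_⟩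
    · refine hgap' u hu hN qcoef (fun h => by simp [qcoef, h]) fun huM => ?_
      refine recursion_vanish_up (lam := fun u w => b * u - a * w) hu
        (fun w' => qcoef_of_lt (Or.inl (by lia))) fun u' h1 h2 => ?_
      rw [← coboundary_diag_q, hP₂d _ _ _ _ (by lia), hP₂d _ _ _ _ (by lia)]
      ring
    · refine hgap' u hu hN mcoef (fun h => by simp [mcoef, h]) fun huM => ?_
      refine recursion_vanish_up (lam := fun u w => b * u - a * w) hu
        (fun w' => mcoef_of_lt (Or.inl (by lia))) fun u' h1 h2 => ?_
      rw [← coboundary_diag_m, hP₂d _ _ _ _ (by lia)]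
    · constructor
      · rw [hP₂, ycoef_sub P₁, hQ₂' hC _ (Or.inl rfl), sub_self]
      · rw [hP₂, ycoef_sub P₁, hQ₂' hC _ (Or.inr rfl), sub_self]

/-! ### The terms of a package -/

theorem mem_hfil_iff_eq_zero (p : ℤ) (P : Polyvec) :
    P ∈ hfil p ↔ ∀ S u v w, w < p - 1 → ycoef P S u v w = 0 := by
  rw [mem_hfil_iff]
  constructor
  · intro h S u v w hw
    by_contra hne
    have := h S u v w hne
    lia
  · intro h S u v w hne
    by_contra hw
    exact hne (h S u v w (by lia))

theorem mem_hfil_succ {p : ℤ} {P : Polyvec} (h : P ∈ hfil p)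
    (h' : ∀ S u v, ycoef P S u v (p - 1) = 0) : P ∈ hfil (p + 1) := by
  rw [mem_hfil_iff_eq_zero] at h ⊢
  intro S u v w hw
  rcases (show w ≤ p - 1 by lia).lt_or_eq with h1 | rfl
  · exact h S u v w h1
  · exact h' S u v

/-- The bounds of a package: the orders of its terms lie between `2 M + 4` and `2 N + 2`. Since
there are no resonant points with `M < u < N`, the obstructed cochains are the same for all these
orders. -/
structure IsPackage (a b : ℝ) (M N : ℤ) : Prop where
  a_ne : a ≠ 0
  b_ne : b ≠ 0
  neg_one_le : -1 ≤ M
  nonneg : 0 ≤ N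
  gap : ∀ u w, Resonant a b u w → u < N → u ≤ M

variable {a b : ℝ} {M N : ℤ}

/-- Every element of `Z_r^{pq}` is, modulo an element of `B_{r-1}^{pq}`, a cochain with leading
part in `leadSpace`. -/
theorem IsPackage.exists_sub_mem (h : IsPackage a b M N) {r p q : ℤ} (hr : 2 * M + 4 ≤ r)
    {x : Polyvec} (hx : x ∈ (complex4 a b).Z r p q) :
    ∃ y ∈ (complex4 a b).fil (p - (r - 1)), (complex4 a b).d y ∈ (complex4 a b).B (r - 1) p q ∧
      x - (complex4 a b).d y ∈ leadSpace a b N (p - 1) := by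
  obtain ⟨⟨h1, h2⟩, h3⟩ := hx
  have h1' := (mem_hfil_iff_eq_zero _ _).1 h1
  have h2' := (mem_hfil_iff_eq_zero _ _).1 (show coboundary (lambda4 a b) x ∈ hfil (p + r) from h2)
  obtain ⟨y, y1, y2, y3, y4⟩ := exists_reduction (w := p - 1) h.a_ne h.neg_one_le h.gap h3 h1'
    (fun S u v w' hw => h2' S u v w' (by lia))
  have hy : y ∈ (complex4 a b).fil (p - (r - 1)) :=
    (mem_hfil_iff_eq_zero _ _).2 fun S u v w hw => y1 S u v w (by lia)
  exact ⟨y, hy, ⟨⟨(mem_hfil_iff_eq_zero _ _).2 y3, y, hy, rfl⟩, y2⟩, y4⟩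

/-- A cochain with leading part in `leadSpace` that differs from a coboundary by an element of
higher filtration has vanishing leading part. -/
theorem IsPackage.lead_eq_zero (h : IsPackage a b M N) {r p : ℤ} (hr : r ≤ 2 * N + 2)
    {x y : Polyvec} (hx : x ∈ leadSpace a b N (p - 1)) (hxp : x ∈ hfil p)
    (hy : y ∈ (complex4 a b).fil (p - (r - 1)))
    (hxy : x - (complex4 a b).d y ∈ hfil (p + 1)) : ∀ S u v, ycoef x S u v (p - 1) = 0 := by
  have h1 := (mem_hfil_iff_eq_zero _ _).1 hxy
  have h2 := (mem_hfil_iff_eq_zero _ _).1 hxp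
  have h3 := (mem_hfil_iff_eq_zero _ _).1 (show y ∈ hfil _ from hy)
  have h4 (S u v w) (hw : w < p) :
      ycoef x S u v w = ycoef (coboundary (lambda4 a b) y) S u v w := by
    have := h1 S u v w (by lia)
    rw [ycoef_sub] at this
    exact sub_eq_zero.1 this
  exact leadSpace_not_hit h.a_ne h.b_ne h.nonneg hx (fun S u v w' hw => h3 S u v w' (by lia))
    (fun S u v w' hw => by rw [← h4 S u v w' (by lia), h2 S u v w' hw])
    (fun S u v => h4 S u v _ (by lia))

theorem d_B_eq_zero {r p q : ℤ} {x : Polyvec} (hx : x ∈ (complex4 a b).B r p q) :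
    (complex4 a b).d x = 0 := by
  obtain ⟨⟨-, y, -, rfl⟩, -⟩ := hx
  exact (complex4 a b).d_d y

theorem B_le_Z {r s p q : ℤ} : (complex4 a b).B r p q ≤ (complex4 a b).Z s p q := by
  intro x hx
  refine ⟨⟨hx.1.1, Submodule.mem_comap.2 ?_⟩, hx.2⟩
  rw [d_B_eq_zero hx]
  exact Submodule.zero_mem _

theorem B_mono {r s p q : ℤ} (h : r ≤ s) : (complex4 a b).B r p q ≤ (complex4 a b).B s p q := by
  rintro x ⟨⟨h1, y, hy, rfl⟩, h3⟩
  exact ⟨⟨h1, y, (complex4 a b).fil_anti (by lia) hy, rfl⟩, h3⟩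

theorem Z_succ_of_hfil {r p q : ℤ} {x : Polyvec} (hx : x ∈ (complex4 a b).Z r p q)
    (h : x ∈ hfil (p + 1)) : x ∈ (complex4 a b).Z (r - 1) (p + 1) (q - 1) := by
  obtain ⟨⟨h1, h2⟩, h3⟩ := hx
  refine ⟨⟨h, ?_⟩, ?_⟩
  · rw [show p + 1 + (r - 1) = p + r by ring]; exact h2
  · rw [show p + 1 + (q - 1) = p + q by ring]; exact h3

theorem Z_pred_le {r p q : ℤ} {x : Polyvec} (hx : x ∈ (complex4 a b).Z (r - 1) (p + 1) (q - 1)) :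
    x ∈ hfil (p + 1) := hx.1.1

/-- A system of representatives for the whole package: the cochains can be extended to the last
term of the package, and they correspond bijectively to the leading parts in `leadSpace`. -/
structure IsLeadSystem (a b : ℝ) (N p q : ℤ) (T : Set Polyvec) : Prop where
  mem_Z : ∀ x ∈ T, x ∈ (complex4 a b).Z (2 * N + 2) p q
  mem_lead : ∀ x ∈ T, x ∈ leadSpace a b N (p - 1)
  exists_eq : ∀ x ∈ hfil p, x ∈ diag (p + q) → x ∈ leadSpace a b N (p - 1) →
    ∃ s ∈ T, ∀ S u v, ycoef x S u v (p - 1) = ycoef s S u v (p - 1)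
  eq_of_eq : ∀ s ∈ T, ∀ s' ∈ T, (∀ S u v, ycoef s S u v (p - 1) = ycoef s' S u v (p - 1)) → s = s'

theorem IsLeadSystem.exists_sub_mem (h : IsPackage a b M N) {r p q : ℤ} {T : Set Polyvec}
    (hT : IsLeadSystem a b N p q T) (h1 : 2 * M + 4 ≤ r) (h2 : r ≤ 2 * N + 2) {x : Polyvec}
    (hx : x ∈ (complex4 a b).Z r p q) :
    ∃ s ∈ T, x - s ∈
      (complex4 a b).Z (r - 1) (p + 1) (q - 1) ⊔ (complex4 a b).B (r - 1) p q := by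
  obtain ⟨y, hy, hB, hl⟩ := h.exists_sub_mem h1 hx
  have hxy : x - (complex4 a b).d y ∈ (complex4 a b).Z r p q := sub_mem hx (B_le_Z hB)
  obtain ⟨s, hs, hs'⟩ := hT.exists_eq _ hxy.1.1 hxy.2 hl
  have hz : x - (complex4 a b).d y - s ∈ (complex4 a b).Z r p q :=
    sub_mem hxy ((complex4 a b).Z_le h2 p q (hT.mem_Z s hs))
  refine ⟨s, hs, Submodule.mem_sup.2 ⟨x - (complex4 a b).d y - s, Z_succ_of_hfil hz ?_,
    _, hB, by abel⟩⟩
  exact mem_hfil_succ hz.1.1 fun S u v => by rw [ycoef_sub, hs', sub_self]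

theorem IsLeadSystem.isRepSystem (h : IsPackage a b M N) {r p q : ℤ} {T : Set Polyvec}
    (hT : IsLeadSystem a b N p q T) (h1 : 2 * M + 4 ≤ r) (h2 : r ≤ 2 * N + 2) :
    (complex4 a b).IsRepSystem r p q T := by
  refine ⟨fun x hx => (complex4 a b).Z_le h2 p q (hT.mem_Z x hx), ?_, ?_⟩
  · rintro ⟨s, hs⟩ ⟨s', hs'⟩ heq
    have h3 := (Submodule.Quotient.eq _).1 heq
    obtain ⟨z, hz, β, hβ, hzβ⟩ := Submodule.mem_sup.1 (show s - s' ∈ _ from h3)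
    obtain ⟨⟨-, y, hy, rfl⟩, -⟩ := hβ
    have h4 := h.lead_eq_zero h2 (sub_mem (hT.mem_lead s hs) (hT.mem_lead s' hs'))
      (sub_mem (hT.mem_Z s hs).1.1 (hT.mem_Z s' hs').1.1) hy
      (by rw [← hzβ, add_sub_cancel_right]; exact Z_pred_le hz)
    refine Subtype.ext (hT.eq_of_eq s hs s' hs' fun S u v => ?_)
    have := h4 S u v
    rwa [ycoef_sub, sub_eq_zero] at this
  · intro c
    obtain ⟨⟨x, hx⟩, rfl⟩ := Submodule.Quotient.mk_surjective _ c
    obtain ⟨s, hs, hs'⟩ := hT.exists_sub_mem h h1 h2 hx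
    refine ⟨⟨s, hs⟩, ((Submodule.Quotient.eq _).2 ?_).symm⟩
    exact hs'

/-- Within a package, the classes of the elements of `Z_{r'}^{pq}` that vanish in `E_{r'}^{pq}` are
those that vanish in `E_r^{pq}`, `r ≤ r'`. -/
theorem IsPackage.mem_bound_iff (h : IsPackage a b M N) {r r' p q : ℤ} (h1 : 2 * M + 4 ≤ r)
    (hr : r ≤ r') (h2 : r' ≤ 2 * N + 2) {x : Polyvec} (hx : x ∈ (complex4 a b).Z r' p q) :
    x ∈ (complex4 a b).Z (r' - 1) (p + 1) (q - 1) ⊔ (complex4 a b).B (r' - 1) p q ↔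
      x ∈ (complex4 a b).Z (r - 1) (p + 1) (q - 1) ⊔ (complex4 a b).B (r - 1) p q := by
  constructor
  · intro hb
    obtain ⟨z, hz, β, hβ, hzβ⟩ := Submodule.mem_sup.1 hb
    obtain ⟨⟨-, y, hy, rfl⟩, -⟩ := hβ
    have hx' := (complex4 a b).Z_le hr p q hx
    obtain ⟨y', hy', hB, hl⟩ := h.exists_sub_mem h1 hx'
    have hxy : x - (complex4 a b).d y' ∈ (complex4 a b).Z r p q := sub_mem hx' (B_le_Z hB)
    have h4 := h.lead_eq_zero (y := y - y') h2 hl hxy.1.1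
      (sub_mem hy ((complex4 a b).fil_anti (by lia) hy'))
      (by
        rw [map_sub, sub_sub_sub_cancel_right, ← hzβ, add_sub_cancel_right]
        exact Z_pred_le hz)
    exact Submodule.mem_sup.2 ⟨_, Z_succ_of_hfil hxy (mem_hfil_succ hxy.1.1 h4), _, hB, by abel⟩
  · intro hb
    obtain ⟨z, hz, β, hβ, hzβ⟩ := Submodule.mem_sup.1 hb
    refine Submodule.mem_sup.2 ⟨z, ?_, β, B_mono (by lia) hβ, hzβ⟩
    refine Z_succ_of_hfil ?_ (Z_pred_le hz)
    rw [show z = x - β by rw [← hzβ, add_sub_cancel_right]]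
    exact sub_mem hx (B_le_Z hβ)

theorem IsLeadSystem.exists_equiv (h : IsPackage a b M N) {r r' p q : ℤ} {T : Set Polyvec}
    (hT : IsLeadSystem a b N p q T) (h1 : 2 * M + 4 ≤ r) (hr : r ≤ r') (h2 : r' ≤ 2 * N + 2) :
    ∃ e : (complex4 a b).E r' p q ≃ₗ[ℝ] (complex4 a b).E r p q,
      ∀ z : (complex4 a b).Z r' p q, e ((complex4 a b).cls r' p q z) =
        (complex4 a b).cls r p q ⟨z.1, (complex4 a b).Z_le hr p q z.2⟩ := by
  have hb : (complex4 a b).bound r' p q = ((complex4 a b).bound r p q).comap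
      (Submodule.inclusion ((complex4 a b).Z_le hr p q)) := by
    ext ⟨x, hx⟩
    exact h.mem_bound_iff h1 hr h2 hx
  refine ⟨LinearEquiv.ofBijective (Submodule.mapQ _ _
    (Submodule.inclusion ((complex4 a b).Z_le hr p q)) hb.le) ⟨?_, ?_⟩, fun z => rfl⟩
  · rw [← LinearMap.ker_eq_bot, Submodule.ker_mapQ, ← hb, Submodule.mkQ_map_self]
  · intro c
    obtain ⟨⟨x, hx⟩, rfl⟩ := Submodule.Quotient.mk_surjective _ c
    obtain ⟨s, hs, hs'⟩ := hT.exists_sub_mem h h1 (hr.trans h2) hx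
    refine ⟨Submodule.Quotient.mk ⟨s, (complex4 a b).Z_le h2 p q (hT.mem_Z s hs)⟩, ?_⟩
    refine ((Submodule.Quotient.eq ((complex4 a b).bound r p q)).2 ?_).symm
    exact hs'

theorem IsLeadSystem.dE_eq_zero (h : IsPackage a b M N) {r p q : ℤ} {T : Set Polyvec}
    (hT : IsLeadSystem a b N p q T) (h1 : 2 * M + 4 ≤ r) (h2 : r ≤ 2 * N) :
    (complex4 a b).dE r p q = 0 := by
  refine LinearMap.ext fun c => ?_
  obtain ⟨⟨s, hs⟩, rfl⟩ := (hT.isRepSystem h h1 (by lia)).2.2 c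
  refine (Submodule.Quotient.mk_eq_zero _).2 ?_
  have hs2 := hT.mem_Z s hs
  refine Submodule.mem_sup_left (Z_succ_of_hfil ?_ ?_)
  · exact (complex4 a b).d_mem_Z r p q s ((complex4 a b).Z_le (by lia) p q hs2)
  · exact (complex4 a b).fil_anti (by lia) hs2.1.2

/-! ### Exponents and resonant points -/

theorem al_pos {a b : ℝ} {al : ℕ} {be : ℤ} (hab : IsExponents a b al be) : 0 < al := by
  by_cases h1 : PosRatio a b
  · exact (hab.pos h1).1
  by_cases h2 : Accidental a b
  · exact (hab.acc h2).1
  · rw [hab.other h1 h2]; exact one_pos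

theorem mul_eq_mul_of_admissible {a b : ℝ} (ha : a ≠ 0) {al : ℕ} {be : ℤ}
    (hab : IsExponents a b al be) {i : ℕ} (hi : Admissible a b i) :
    b * (al * i : ℤ) = a * (be * i : ℤ) := by
  have h1 := al_pos hab
  have h2 : (al : ℝ) ≠ 0 := by exact_mod_cast h1.ne'
  have key (h : b / a = be / al) : b * (al * i : ℤ) = a * (be * i : ℤ) := by
    rw [div_eq_div_iff ha h2] at h
    push_cast
    linear_combination i * h
  rcases hi with (h | h) | ⟨h, -⟩
  · exact key (hab.pos h).2.2.2
  · simp [h]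
  · exact key (hab.acc h).2.2

/-- The resonant points are those with the exponents of the admissible powers of
`D'^α z^β`. -/
theorem resonant_iff {a b : ℝ} (ha : a ≠ 0) (hb : b ≠ 0) {al : ℕ} {be : ℤ}
    (hab : IsExponents a b al be) (u w : ℤ) :
    Resonant a b u w ↔ ∃ i : ℕ, Admissible a b i ∧ u = al * i ∧ w = be * i := by
  constructor
  · rintro ⟨hu, hw, h⟩
    have hdiv (hu0 : 0 < u) : b / a = w / u := by
      rw [div_eq_div_iff ha (by exact_mod_cast hu0.ne')]
      linear_combination h
    rcases hu.eq_or_lt with rfl | hu0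
    · refine ⟨0, Or.inl (Or.inr rfl), by simp, ?_⟩
      have : a * (w : ℝ) = 0 := by rw [← h]; simp
      simpa using (mul_eq_zero.1 this).resolve_left ha
    rcases lt_trichotomy w 0 with hw0 | rfl | hw0
    · obtain rfl : w = -1 := by lia
      have hacc : Accidental a b := by
        refine ⟨u.toNat, by lia, ?_⟩
        have : ((u.toNat : ℕ) : ℝ) = u := by exact_mod_cast Int.toNat_of_nonneg hu
        rw [hdiv hu0, this]; simp
      obtain ⟨h1, rfl, h3⟩ := hab.acc hacc
      refine ⟨1, Or.inr ⟨hacc, rfl⟩, ?_, by simp⟩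
      rw [hdiv hu0, div_eq_div_iff (by exact_mod_cast hu0.ne') (by exact_mod_cast h1.ne')] at h3
      have h4 : (-1 : ℤ) * al = -1 * u := by exact_mod_cast h3
      simp; lia
    · exact absurd h (by simp [hb, hu0.ne'])
    · have hpos : PosRatio a b := by
        refine ⟨w / u, by positivity, ?_⟩
        rw [hdiv hu0]; push_cast; rfl
      obtain ⟨h1, h2, h3, h4⟩ := hab.pos hpos
      rw [hdiv hu0, div_eq_div_iff (by exact_mod_cast hu0.ne') (by exact_mod_cast h1.ne')] at h4
      have h5 : w * al = be * u := by exact_mod_cast h4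
      obtain ⟨i, hi⟩ : (al : ℤ) ∣ u := h3.dvd_of_dvd_mul_left ⟨w, by rw [← h5]; ring⟩
      have hal : (0 : ℤ) < al := by exact_mod_cast h1
      have hi0 : 0 < i := by
        by_contra hneg
        have := mul_nonpos_of_nonneg_of_nonpos hal.le (not_lt.1 hneg)
        lia
      have hw' : w = be * i := by
        have : (al : ℤ) * w = al * (be * i) := by rw [hi] at h5; linear_combination h5
        exact mul_left_cancel₀ hal.ne' this
      exact ⟨i.toNat, Or.inl (Or.inl hpos), by rw [Int.toNat_of_nonneg hi0.le, hi],
        by rw [Int.toNat_of_nonneg hi0.le, hw']⟩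
  · rintro ⟨i, hi, rfl, rfl⟩
    refine ⟨by positivity, ?_, mul_eq_mul_of_admissible ha hab hi⟩
    rcases hi with (h | rfl) | ⟨h, rfl⟩
    · have := (hab.pos h).2.1
      have : 0 ≤ be * i := by positivity
      lia
    · simp
    · rw [(hab.acc h).2.1]; simp

theorem admissible_unique {a b : ℝ} (ha : a ≠ 0) (hb : b ≠ 0) {al : ℕ} {be : ℤ}
    (hab : IsExponents a b al be) {i j : ℕ} (hi : Admissible a b i) (hj : Admissible a b j)
    (h : be * i = be * j) : i = j := by
  have h1 := mul_eq_mul_of_admissible ha hab hi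
  rw [h, ← mul_eq_mul_of_admissible ha hab hj] at h1
  have h2 : (al * i : ℤ) = al * j := by exact_mod_cast mul_left_cancel₀ hb h1
  have := al_pos hab
  exact_mod_cast mul_left_cancel₀ (by lia) h2

theorem casIndex_of_nonneg {a b : ℝ} {al : ℕ} {be : ℤ} (hab : IsExponents a b al be) {i : ℕ}
    (hi : Admissible a b i) (h : 0 ≤ be * i) : CasIndex a b i := by
  rcases hi with hi | ⟨h1, rfl⟩
  · exact hi
  · rw [(hab.acc h1).2.1] at h
    simp at h

theorem CasIndex.nonneg {a b : ℝ} {al : ℕ} {be : ℤ} (hab : IsExponents a b al be) {i : ℕ}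
    (hi : CasIndex a b i) : 0 ≤ be * i := by
  rcases hi with hi | rfl
  · have := (hab.pos hi).2.1
    positivity
  · simp

/-- Resonant points with `u < α n` have an index less than `n`. -/
theorem isPackage {a b : ℝ} (ha : a ≠ 0) (hb : b ≠ 0) {al : ℕ} {be : ℤ}
    (hab : IsExponents a b al be) (n : ℕ) :
    IsPackage a b (if n = 0 then -1 else (al * (n - 1 : ℤ))) (al * n) where
  a_ne := ha
  b_ne := hb
  neg_one_le := by
    split_ifs with h
    · rfl
    · have : (0 : ℤ) ≤ al * (n - 1 : ℤ) := mul_nonneg (by positivity) (by lia)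
      lia
  nonneg := by positivity
  gap u w h hu := by
    obtain ⟨i, -, rfl, -⟩ := (resonant_iff ha hb hab u w).1 h
    have hal : (0 : ℤ) < al := by exact_mod_cast al_pos hab
    have hin := lt_of_mul_lt_mul_left hu hal.le
    rw [if_neg (by lia)]
    exact mul_le_mul_of_nonneg_left (by lia) hal.le

/-! ### Coefficients of monomial polyvector fields -/

theorem coef_one (i j k : ℤ) : coef 1 i j k = if i = 0 ∧ j = 0 ∧ k = 0 then 1 else 0 := by
  classical
  unfold coef
  by_cases h : 0 ≤ i ∧ 0 ≤ j ∧ 0 ≤ k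
  · rw [if_pos h, MvPowerSeries.coeff_one]
    refine if_congr ⟨fun h' => ?_, ?_⟩ rfl rfl
    · have h0 := DFunLike.congr_fun h' 0
      have h1 := DFunLike.congr_fun h' 1
      have h2 := DFunLike.congr_fun h' 2
      simp at h0 h1 h2
      lia
    · rintro ⟨rfl, rfl, rfl⟩
      exact exps_ext (by simp) (by simp) (by simp)
  · rw [if_neg h, if_neg (by lia)]

theorem coef_X_zero_pow_mul (n : ℕ) (f : Coef) (i j k : ℤ) :
    coef (MvPowerSeries.X 0 ^ n * f) i j k = coef f (i - n) j k := by
  induction n generalizing i with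
  | zero => simp
  | succ n ih =>
    rw [pow_succ', mul_assoc, coef_X_zero_mul, ih]; congr 1; push_cast; ring

theorem coef_X_one_pow_mul (n : ℕ) (f : Coef) (i j k : ℤ) :
    coef (MvPowerSeries.X 1 ^ n * f) i j k = coef f i (j - n) k := by
  induction n generalizing j with
  | zero => simp
  | succ n ih =>
    rw [pow_succ', mul_assoc, coef_X_one_mul, ih]; congr 1; push_cast; ring

theorem coef_X_two_pow_mul (n : ℕ) (f : Coef) (i j k : ℤ) :
    coef (MvPowerSeries.X 2 ^ n * f) i j k = coef f i j (k - n) := by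
  induction n generalizing k with
  | zero => simp
  | succ n ih =>
    rw [pow_succ', mul_assoc, coef_X_two_mul, ih]; congr 1; push_cast; ring

theorem ycoef_single (T S : Finset (Fin 3)) (f : Coef) (u v w : ℤ) :
    ycoef (Pi.single T f) S u v w =
      if S = T then coef f (u + ind 0 T) (v + ind 1 T) (w + ind 2 T) else 0 := by
  unfold ycoef
  split_ifs with h
  · subst h; simp
  · simp [h]

theorem one_eq : one = Pi.single ∅ 1 := rfl

theorem Y_eq (i : Fin 3) : Y i = (Pi.single {i} (MvPowerSeries.X i : Coef) : Polyvec) := by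
  funext S
  by_cases h : S = {i}
  · subst h; simp [Y, partialField]
  · simp [Y, partialField, h]

theorem Y12_eq : Y12 = Pi.single {0, 1} (MvPowerSeries.X 0 * MvPowerSeries.X 1) := by
  refine funext (forall_fin3 ?_ ?_ ?_ ?_ ?_ ?_ ?_ ?_) <;>
  simp +decide [Y12, Y, partialField, wedge_0, wedge_single, wedge_pair, wedge_univ]

theorem Y23_eq : Y23 = Pi.single {1, 2} (MvPowerSeries.X 1 * MvPowerSeries.X 2) := by
  refine funext (forall_fin3 ?_ ?_ ?_ ?_ ?_ ?_ ?_ ?_) <;>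
  simp +decide [Y23, Y, partialField, wedge_0, wedge_single, wedge_pair, wedge_univ]

theorem Y31_eq : Y31 = Pi.single {0, 2} (-(MvPowerSeries.X 0 * MvPowerSeries.X 2)) := by
  refine funext (forall_fin3 ?_ ?_ ?_ ?_ ?_ ?_ ?_ ?_) <;>
  simp +decide [Y31, Y, partialField, wedge_0, wedge_single, wedge_pair, wedge_univ, mul_comm]

theorem Y123_eq : Y123 =
    Pi.single {0, 1, 2} (MvPowerSeries.X 0 * (MvPowerSeries.X 1 * MvPowerSeries.X 2)) := by
  refine funext (forall_fin3 ?_ ?_ ?_ ?_ ?_ ?_ ?_ ?_) <;>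
  simp +decide [Y123, Y, partialField, wedge_0, wedge_single, wedge_pair, wedge_univ]

theorem d12_eq : d12 = Pi.single {0, 1} 1 := by
  refine funext (forall_fin3 ?_ ?_ ?_ ?_ ?_ ?_ ?_ ?_) <;>
  simp +decide [d12, partialField, wedge_0, wedge_single, wedge_pair, wedge_univ]

theorem d23_eq : d23 = Pi.single {1, 2} 1 := by
  refine funext (forall_fin3 ?_ ?_ ?_ ?_ ?_ ?_ ?_ ?_) <;>
  simp +decide [d23, partialField, wedge_0, wedge_single, wedge_pair, wedge_univ]

theorem d31_eq : d31 = Pi.single {0, 2} (-1) := by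
  refine funext (forall_fin3 ?_ ?_ ?_ ?_ ?_ ?_ ?_ ?_) <;>
  simp +decide [d31, partialField, wedge_0, wedge_single, wedge_pair, wedge_univ]

theorem d123_eq : d123 = Pi.single {0, 1, 2} 1 := by
  refine funext (forall_fin3 ?_ ?_ ?_ ?_ ?_ ?_ ?_ ?_) <;>
  simp +decide [d123, partialField, wedge_0, wedge_single, wedge_pair, wedge_univ]

/-- The polyvector field `x^u y^v z^w Y_T`, or `0` if the exponents are not admissible. -/
def ymono (T : Finset (Fin 3)) (u v w : ℤ) : Polyvec :=
  ofYcoef fun S u' v' w' => if S = T ∧ u' = u ∧ v' = v ∧ w' = w then 1 else 0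

theorem ycoef_ymono {T : Finset (Fin 3)} {u v w : ℤ} (h : Adm T u v w) (S : Finset (Fin 3))
    (u' v' w' : ℤ) : ycoef (ymono T u v w) S u' v' w' =
      if S = T ∧ u' = u ∧ v' = v ∧ w' = w then 1 else 0 := by
  rw [ymono, ycoef_ofYcoef]
  split_ifs with h1 h2 h2
  · rfl
  · rfl
  · obtain ⟨rfl, rfl, rfl, rfl⟩ := h2
    exact absurd h h1
  · rfl

theorem ycoef_laurent (e : Fin 3 → ℤ) (P : Polyvec) (S : Finset (Fin 3)) (u v w : ℤ) :
    ycoef (laurent e P) S u v w =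
      if Adm S u v w then ycoef P S (u - e 0) (v - e 1) (w - e 2) else 0 := by
  by_cases hA : Adm S u v w
  swap
  · rw [if_neg hA, ycoef_of_not_adm hA]
  rw [if_pos hA]
  obtain ⟨h0, h1, h2⟩ := id hA
  rw [ycoef, coef, if_pos ⟨h0, h1, h2⟩]
  change (if _ then _ else _) = _
  have hJ (K : Fin 3 →₀ ℕ) : (∀ i, e i ≤ K i) ↔ e 0 ≤ K 0 ∧ e 1 ≤ K 1 ∧ e 2 ≤ K 2 := by
    rw [Fin.forall_fin_succ, Fin.forall_fin_succ, Fin.forall_fin_one]; rfl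
  rw [ycoef, coef]
  refine if_ctx_congr ?_ (fun h => ?_) fun _ => rfl
  · rw [hJ]
    simp only [exps_apply_zero, exps_apply_one, exps_apply_two]
    lia
  · refine congrArg (fun K => MvPowerSeries.coeff K (P S)) (exps_ext ?_ ?_ ?_)
    · change (((exps _ _ _ 0 : ℕ) : ℤ) - e 0).toNat = _
      simp only [exps_apply_zero]; lia
    · change (((exps _ _ _ 1 : ℕ) : ℤ) - e 1).toNat = _
      simp only [exps_apply_one]; lia
    · change (((exps _ _ _ 2 : ℕ) : ℤ) - e 2).toNat = _
      simp only [exps_apply_two]; lia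

/-! ### Representatives of type 2 -/

theorem coef_X_zero (i j k : ℤ) : coef (MvPowerSeries.X 0) i j k = coef 1 (i - 1) j k := by
  rw [← coef_X_zero_mul, mul_one]

theorem coef_X_one (i j k : ℤ) : coef (MvPowerSeries.X 1) i j k = coef 1 i (j - 1) k := by
  rw [← coef_X_one_mul, mul_one]

theorem coef_X_two (i j k : ℤ) : coef (MvPowerSeries.X 2) i j k = coef 1 i j (k - 1) := by
  rw [← coef_X_two_mul, mul_one]

theorem ycoef_one (S : Finset (Fin 3)) (u v w : ℤ) : ycoef one S u v w =
    if u = 0 ∧ v = 0 ∧ w = 0 then (if S = ∅ then 1 else 0) else 0 := by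
  rw [one_eq, ycoef_single, coef_one]
  simp only [ind, Finset.notMem_empty, if_false, add_zero]
  split_ifs <;> rfl

theorem ycoef_Y_zero (S : Finset (Fin 3)) (u v w : ℤ) : ycoef (Y 0) S u v w =
    if u = 0 ∧ v = 0 ∧ w = 0 then (if S = {0} then 1 else 0) else 0 := by
  rw [Y_eq, ycoef_single, coef_X_zero, coef_one]
  simp [ind]
  split_ifs <;> rfl

theorem ycoef_Y_one (S : Finset (Fin 3)) (u v w : ℤ) : ycoef (Y 1) S u v w =
    if u = 0 ∧ v = 0 ∧ w = 0 then (if S = {1} then 1 else 0) else 0 := by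
  rw [Y_eq, ycoef_single, coef_X_one, coef_one]
  simp [ind]
  split_ifs <;> rfl

theorem ycoef_Y_two (S : Finset (Fin 3)) (u v w : ℤ) : ycoef (Y 2) S u v w =
    if u = 0 ∧ v = 0 ∧ w = 0 then (if S = {2} then 1 else 0) else 0 := by
  rw [Y_eq, ycoef_single, coef_X_two, coef_one]
  simp [ind]
  split_ifs <;> rfl

theorem ycoef_Y23 (S : Finset (Fin 3)) (u v w : ℤ) : ycoef Y23 S u v w =
    if u = 0 ∧ v = 0 ∧ w = 0 then (if S = {1, 2} then 1 else 0) else 0 := by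
  rw [Y23_eq, ycoef_single, coef_X_one_mul, coef_X_two, coef_one]
  simp [ind]
  split_ifs <;> rfl

theorem ycoef_Y31 (S : Finset (Fin 3)) (u v w : ℤ) : ycoef Y31 S u v w =
    if u = 0 ∧ v = 0 ∧ w = 0 then (if S = {0, 2} then -1 else 0) else 0 := by
  rw [Y31_eq, ycoef_single, coef_neg, coef_X_zero_mul, coef_X_two, coef_one]
  simp [ind]
  split_ifs <;> simp

theorem ycoef_Y12 (S : Finset (Fin 3)) (u v w : ℤ) : ycoef Y12 S u v w =
    if u = 0 ∧ v = 0 ∧ w = 0 then (if S = {0, 1} then 1 else 0) else 0 := by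
  rw [Y12_eq, ycoef_single, coef_X_zero_mul, coef_X_one, coef_one]
  simp [ind]
  split_ifs <;> rfl

theorem ycoef_Y123 (S : Finset (Fin 3)) (u v w : ℤ) : ycoef Y123 S u v w =
    if u = 0 ∧ v = 0 ∧ w = 0 then (if S = {0, 1, 2} then 1 else 0) else 0 := by
  rw [Y123_eq, ycoef_single, coef_X_zero_mul, coef_X_one_mul, coef_X_two, coef_one]
  simp [ind]
  split_ifs <;> rfl

theorem laurent_Y12 {u w : ℤ} (hu : 0 ≤ u) (hw : 0 ≤ w) :
    laurent ![u, u, w] Y12 = ymono {0, 1} u u w := by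
  refine ycoef_ext fun S u' v' w' => ?_
  have hA : Adm {0, 1} u u w := ⟨by simp [ind]; lia, by simp [ind]; lia, by simp [ind]; lia⟩
  rw [ycoef_laurent, ycoef_Y12, ycoef_ymono hA]
  by_cases hS : S = {0, 1}
  · subst hS
    by_cases h : u' = u ∧ v' = u ∧ w' = w
    · obtain ⟨rfl, rfl, rfl⟩ := h
      rw [if_pos hA]; simp
    · have h' : ¬ (u' - ![u, u, w] 0 = 0 ∧ v' - ![u, u, w] 1 = 0 ∧ w' - ![u, u, w] 2 = 0) := by
        simpa [sub_eq_zero] using h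
      rw [if_neg h', ite_self, if_neg fun h3 => h h3.2]
  · simp [hS]

theorem laurent_Y123 {u w : ℤ} (hu : 0 ≤ u) (hw : -1 ≤ w) :
    laurent ![u, u, w] Y123 = ymono {0, 1, 2} u u w := by
  refine ycoef_ext fun S u' v' w' => ?_
  have hA : Adm {0, 1, 2} u u w := ⟨by simp [ind]; lia, by simp [ind]; lia, by simp [ind]; lia⟩
  rw [ycoef_laurent, ycoef_Y123, ycoef_ymono hA]
  by_cases hS : S = {0, 1, 2}
  · subst hS
    by_cases h : u' = u ∧ v' = u ∧ w' = w
    · obtain ⟨rfl, rfl, rfl⟩ := h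
      rw [if_pos hA]; simp
    · have h' : ¬ (u' - ![u, u, w] 0 = 0 ∧ v' - ![u, u, w] 1 = 0 ∧ w' - ![u, u, w] 2 = 0) := by
        simpa [sub_eq_zero] using h
      rw [if_neg h', ite_self, if_neg fun h3 => h h3.2]
  · simp [hS]

theorem ycoef_coef_smul (f : Coef) (P : Polyvec) (S : Finset (Fin 3)) (u v w : ℤ) :
    ycoef (f • P) S u v w = coef (f * P S) (u + ind 0 S) (v + ind 1 S) (w + ind 2 S) := rfl

theorem X_two_pow_smul_d12 (k : ℕ) :
    (MvPowerSeries.X 2 ^ k : Coef) • d12 = ymono {0, 1} (-1) (-1) k := by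
  refine ycoef_ext fun S u v w => ?_
  rw [ycoef_coef_smul, coef_X_two_pow_mul, ycoef_ymono (by simp [Adm, ind]), d12_eq]
  by_cases hS : S = {0, 1}
  · subst hS
    simp only [Pi.single_eq_same, coef_one, ind]
    refine if_congr ?_ rfl rfl
    simp; lia
  · simp [hS]

theorem X_two_pow_smul_d123 (k : ℕ) :
    (MvPowerSeries.X 2 ^ k : Coef) • d123 = ymono {0, 1, 2} (-1) (-1) (k - 1) := by
  refine ycoef_ext fun S u v w => ?_
  rw [ycoef_coef_smul, coef_X_two_pow_mul, ycoef_ymono (by simp [Adm, ind]), d123_eq]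
  by_cases hS : S = {0, 1, 2}
  · subst hS
    simp only [Pi.single_eq_same, coef_one, ind]
    refine if_congr ?_ rfl rfl
    simp; lia
  · simp [hS]

theorem X_zero_pow_smul_d123 (k : ℕ) :
    (MvPowerSeries.X 0 ^ k : Coef) • d123 = ymono {0, 1, 2} (k - 1) (-1) (-1) := by
  refine ycoef_ext fun S u v w => ?_
  rw [ycoef_coef_smul, coef_X_zero_pow_mul, ycoef_ymono (by simp [Adm, ind]), d123_eq]
  by_cases hS : S = {0, 1, 2}
  · subst hS
    simp only [Pi.single_eq_same, coef_one, ind]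
    refine if_congr ?_ rfl rfl
    simp; lia
  · simp [hS]

theorem X_one_pow_smul_d123 (k : ℕ) :
    (MvPowerSeries.X 1 ^ k : Coef) • d123 = ymono {0, 1, 2} (-1) (k - 1) (-1) := by
  refine ycoef_ext fun S u v w => ?_
  rw [ycoef_coef_smul, coef_X_one_pow_mul, ycoef_ymono (by simp [Adm, ind]), d123_eq]
  by_cases hS : S = {0, 1, 2}
  · subst hS
    simp only [Pi.single_eq_same, coef_one, ind]
    refine if_congr ?_ rfl rfl
    simp; lia
  · simp [hS]

theorem X_zero_pow_smul_d23 (k : ℕ) :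
    (MvPowerSeries.X 0 ^ k : Coef) • d23 = ymono {1, 2} k (-1) (-1) := by
  refine ycoef_ext fun S u v w => ?_
  rw [ycoef_coef_smul, coef_X_zero_pow_mul, ycoef_ymono (by simp [Adm, ind]), d23_eq]
  by_cases hS : S = {1, 2}
  · subst hS
    simp only [Pi.single_eq_same, coef_one, ind]
    refine if_congr ?_ rfl rfl
    simp; lia
  · simp [hS]

theorem X_one_pow_smul_d31 (k : ℕ) :
    (MvPowerSeries.X 1 ^ k : Coef) • d31 = (-1 : ℝ) • ymono {0, 2} (-1) k (-1) := by
  refine ycoef_ext fun S u v w => ?_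
  rw [ycoef_coef_smul, coef_X_one_pow_mul, ycoef_smul, ycoef_ymono (by simp [Adm, ind]), d31_eq]
  by_cases hS : S = {0, 2}
  · subst hS
    simp only [Pi.single_eq_same, coef_neg, coef_one, ind, neg_one_mul]
    refine congrArg _ (if_congr ?_ rfl rfl)
    simp; lia
  · simp [hS]

/-- The positions `(S, u, v, w)` of the monomials `x^u y^v z^w Y_S` that are, up to sign,
representatives of type 2 in the `n`-th package, with `N = α n`. -/
def IsType2Pos (a b : ℝ) (N : ℤ) (S : Finset (Fin 3)) (u v w : ℤ) : Prop :=
  Adm S u v w ∧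
    (((S = {0, 1} ∨ S = {0, 1, 2}) ∧ u = v ∧ Resonant a b u w) ∨
    ((S = {0, 1} ∨ S = {0, 1, 2}) ∧ u = -1 ∧ v = -1 ∧ ¬ Crit a b N w) ∨
    (b = a ∧ (S = {1, 2} ∨ S = {0, 1, 2}) ∧ v = -1 ∧ w = -1) ∨
    (b = a ∧ (S = {0, 2} ∨ S = {0, 1, 2}) ∧ u = -1 ∧ w = -1))

theorem crit_iff {a b : ℝ} (ha : a ≠ 0) (hb : b ≠ 0) {al : ℕ} {be : ℤ}
    (hab : IsExponents a b al be) (n : ℕ) (w : ℤ) :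
    Crit a b (al * n) w ↔ ∃ i < n, Admissible a b i ∧ w = i * (2 * al + be) + 2 := by
  constructor
  · rintro ⟨u, hu, h⟩
    obtain ⟨i, hi, rfl, hw⟩ := (resonant_iff ha hb hab _ _).1 h
    refine ⟨i, ?_, hi, by linear_combination hw⟩
    exact_mod_cast lt_of_mul_lt_mul_left hu (by positivity)
  · rintro ⟨i, hin, hi, rfl⟩
    refine ⟨al * i, ?_, (resonant_iff ha hb hab _ _).2 ⟨i, hi, rfl, by ring⟩⟩
    have : (0 : ℤ) < al := by exact_mod_cast al_pos hab
    exact mul_lt_mul_of_pos_left (by exact_mod_cast hin) this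

/-- The representatives of type 2 are the monomials at the positions of type 2, up to sign. -/
theorem IsType2.exists_ymono {a b : ℝ} (ha : a ≠ 0) (hb : b ≠ 0) {al : ℕ} {be : ℤ}
    (hab : IsExponents a b al be) {n : ℕ} {t : Polyvec} (ht : IsType2 a b al be n t) :
    ∃ S u v w, IsType2Pos a b (al * n) S u v w ∧ ∃ c : ℝ, t = c • ymono S u v w := by
  cases ht with
  | cas12 i hi =>
    have h2 := (resonant_iff ha hb hab _ _).2 ⟨i, Or.inl hi, rfl, rfl⟩
    have h1 := hi.nonneg hab
    exact ⟨{0, 1}, _, _, _, ⟨⟨by simp [ind]; lia, by simp [ind]; lia, by simp [ind]; lia⟩,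
      Or.inl ⟨Or.inl rfl, rfl, h2⟩⟩, 1, by rw [one_smul]; exact laurent_Y12 h2.1 h1⟩
  | cas123 i hi =>
    have h2 := (resonant_iff ha hb hab _ _).2 ⟨i, hi, rfl, rfl⟩
    have h1 := h2.2.1
    exact ⟨{0, 1, 2}, _, _, _, ⟨⟨by simp [ind]; lia, by simp [ind]; lia, by simp [ind]; lia⟩,
      Or.inl ⟨Or.inr rfl, rfl, h2⟩⟩, 1, by rw [one_smul]; exact laurent_Y123 h2.1 h2.2.1⟩
  | z12 k hk =>
    refine ⟨{0, 1}, -1, -1, k, ⟨by simp [Adm, ind], Or.inr (Or.inl ⟨Or.inl rfl, rfl, rfl, ?_⟩)⟩, 1,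
      by rw [one_smul]; exact X_two_pow_smul_d12 k⟩
    rw [crit_iff ha hb hab]
    rintro ⟨i, hin, hi, h⟩
    exact hk i hin hi h
  | z123 k hk =>
    refine ⟨{0, 1, 2}, -1, -1, k - 1, ⟨by simp [Adm, ind],
      Or.inr (Or.inl ⟨Or.inr rfl, rfl, rfl, ?_⟩)⟩, 1, by rw [one_smul]; exact X_two_pow_smul_d123 k⟩
    rw [crit_iff ha hb hab]
    rintro ⟨i, hin, hi, h⟩
    exact hk i hin hi (by lia)
  | x23 k hk =>
    exact ⟨{1, 2}, k, -1, -1, ⟨by simp [Adm, ind],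
      Or.inr (Or.inr (Or.inl ⟨hk, Or.inl rfl, rfl, rfl⟩))⟩, 1,
      by rw [one_smul]; exact X_zero_pow_smul_d23 k⟩
  | y31 k hk =>
    exact ⟨{0, 2}, -1, k, -1, ⟨by simp [Adm, ind],
      Or.inr (Or.inr (Or.inr ⟨hk, Or.inl rfl, rfl, rfl⟩))⟩, -1, X_one_pow_smul_d31 k⟩
  | x123 k hk =>
    exact ⟨{0, 1, 2}, k - 1, -1, -1, ⟨by simp [Adm, ind],
      Or.inr (Or.inr (Or.inl ⟨hk, Or.inr rfl, rfl, rfl⟩))⟩, 1,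
      by rw [one_smul]; exact X_zero_pow_smul_d123 k⟩
  | y123 k hk =>
    exact ⟨{0, 1, 2}, -1, k - 1, -1, ⟨by simp [Adm, ind],
      Or.inr (Or.inr (Or.inr ⟨hk, Or.inr rfl, rfl, rfl⟩))⟩, 1,
      by rw [one_smul]; exact X_one_pow_smul_d123 k⟩

theorem IsType2Pos.isType2 {a b : ℝ} (ha : a ≠ 0) (hb : b ≠ 0) {al : ℕ} {be : ℤ}
    (hab : IsExponents a b al be) {n : ℕ} {S : Finset (Fin 3)} {u v w : ℤ}
    (h : IsType2Pos a b (al * n) S u v w) :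
    ∃ c : ℝ, c ≠ 0 ∧ IsType2 a b al be n (c • ymono S u v w) := by
  obtain ⟨⟨h0, h1, h2⟩, ⟨hS, rfl, h⟩ | ⟨hS, rfl, rfl, h⟩ | ⟨hba, hS, rfl, rfl⟩ |
    ⟨hba, hS, rfl, rfl⟩⟩ := h
  · obtain ⟨i, hi, rfl, rfl⟩ := (resonant_iff ha hb hab _ _).1 h
    refine ⟨1, one_ne_zero, ?_⟩
    rw [one_smul]
    rcases hS with rfl | rfl
    · simp only [ind] at h2
      rw [← laurent_Y12 h.1 (by simpa using h2)]
      exact .cas12 i (casIndex_of_nonneg hab hi (by simpa using h2))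
    · rw [← laurent_Y123 h.1 h.2.1]
      exact .cas123 i hi
  · rw [crit_iff ha hb hab] at h
    refine ⟨1, one_ne_zero, ?_⟩
    rw [one_smul]
    rcases hS with rfl | rfl
    · obtain ⟨k, rfl⟩ : ∃ k : ℕ, w = k := ⟨w.toNat, by simp [ind] at h2; lia⟩
      rw [← X_two_pow_smul_d12]
      exact .z12 k fun i hin hi hk => h ⟨i, hin, hi, hk⟩
    · obtain ⟨k, rfl⟩ : ∃ k : ℕ, w = k - 1 := ⟨(w + 1).toNat, by simp [ind] at h2; lia⟩
      rw [← X_two_pow_smul_d123]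
      exact .z123 k fun i hin hi hk => h ⟨i, hin, hi, by lia⟩
  · rcases hS with rfl | rfl
    · obtain ⟨k, rfl⟩ : ∃ k : ℕ, u = k := ⟨u.toNat, by simp [ind] at h0; lia⟩
      refine ⟨1, one_ne_zero, ?_⟩
      rw [one_smul, ← X_zero_pow_smul_d23]
      exact .x23 k hba
    · obtain ⟨k, rfl⟩ : ∃ k : ℕ, u = k - 1 := ⟨(u + 1).toNat, by simp [ind] at h0; lia⟩
      refine ⟨1, one_ne_zero, ?_⟩
      rw [one_smul, ← X_zero_pow_smul_d123]
      exact .x123 k hba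
  · rcases hS with rfl | rfl
    · obtain ⟨k, rfl⟩ : ∃ k : ℕ, v = k := ⟨v.toNat, by simp [ind] at h1; lia⟩
      refine ⟨-1, by norm_num, ?_⟩
      rw [← X_one_pow_smul_d31]
      exact .y31 k hba
    · obtain ⟨k, rfl⟩ : ∃ k : ℕ, v = k - 1 := ⟨(v + 1).toNat, by simp [ind] at h1; lia⟩
      refine ⟨1, one_ne_zero, ?_⟩
      rw [one_smul, ← X_one_pow_smul_d123]
      exact .y123 k hba

theorem IsType2Pos.two_le_card {a b : ℝ} {N : ℤ} {S : Finset (Fin 3)} {u v w : ℤ}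
    (h : IsType2Pos a b N S u v w) : 2 ≤ S.card := by
  obtain ⟨-, ⟨rfl | rfl, -⟩ | ⟨rfl | rfl, -⟩ | ⟨-, rfl | rfl, -⟩ | ⟨-, rfl | rfl, -⟩⟩ := h <;>
    decide

theorem IsType2Pos.eq_of_one_two {a b : ℝ} {N : ℤ} {u v w : ℤ}
    (h : IsType2Pos a b N {1, 2} u v w) : b = a ∧ v = -1 ∧ w = -1 := by
  obtain ⟨-, ⟨h1 | h1, -⟩ | ⟨h1 | h1, -⟩ | ⟨h1, -, h2⟩ | ⟨-, h1 | h1, -⟩⟩ := h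
  all_goals first | exact ⟨h1, h2⟩ | exact absurd h1 (by decide)

theorem IsType2Pos.eq_of_zero_two {a b : ℝ} {N : ℤ} {u v w : ℤ}
    (h : IsType2Pos a b N {0, 2} u v w) : b = a ∧ u = -1 ∧ w = -1 := by
  obtain ⟨-, ⟨h1 | h1, -⟩ | ⟨h1 | h1, -⟩ | ⟨-, h1 | h1, -⟩ | ⟨h1, -, h2⟩⟩ := h
  all_goals first | exact ⟨h1, h2⟩ | exact absurd h1 (by decide)

theorem IsType2Pos.eq_of_zero_one {a b : ℝ} {N : ℤ} {u v w : ℤ}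
    (h : IsType2Pos a b N {0, 1} u v w) : u = v := by
  obtain ⟨-, ⟨-, h2, -⟩ | ⟨-, rfl, rfl, -⟩ | ⟨-, h1 | h1, -⟩ | ⟨-, h1 | h1, -⟩⟩ := h
  all_goals first | exact h2 | rfl | exact absurd h1 (by decide)

/-- `IsType2Pos` is compatible with the conditions that define `leadSpace`. -/
theorem IsType2Pos.harm {a b : ℝ} {N : ℤ} {S : Finset (Fin 3)} {u v w : ℤ}
    (h : IsType2Pos a b N S u v w) : Harm a b u v w := by
  obtain ⟨-, ⟨-, rfl, h⟩ | ⟨-, rfl, rfl, -⟩ | ⟨rfl, -, rfl, rfl⟩ | ⟨rfl, -, rfl, rfl⟩⟩ := h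
  · exact ⟨fun _ => by linear_combination h.2.2, fun _ => by linear_combination -h.2.2,
      fun _ => by ring⟩
  · exact ⟨fun h => absurd rfl h, fun h => absurd rfl h, fun _ => by ring⟩
  · exact ⟨fun _ => by ring, fun h => absurd rfl h, fun h => absurd rfl h⟩
  · exact ⟨fun h => absurd rfl h, fun _ => by ring, fun h => absurd rfl h⟩

theorem IsType2Pos.not_crit {a b : ℝ} {N : ℤ} {S : Finset (Fin 3)} {w : ℤ}
    (h : IsType2Pos a b N S (-1) (-1) w) : ¬ Crit a b N w := by
  have hw (hw : w = -1) : ¬ Crit a b N w := by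
    rintro ⟨u, -, h1, h2, -⟩
    lia
  obtain ⟨-, ⟨-, -, h⟩ | ⟨-, -, -, h⟩ | ⟨-, -, -, h⟩ | ⟨-, -, -, h⟩⟩ := h
  · exact absurd h.1 (by lia)
  · exact h
  · exact hw h
  · exact hw h

section Type2

variable {a b : ℝ} {N w : ℤ} {P : Polyvec}

theorem coboundary_eq_zero_of_type2 (h : ∀ S u v w, ycoef P S u v w ≠ 0 →
    IsType2Pos a b N S u v w) : coboundary (lambda4 a b) P = 0 := by
  have h1 {S : Finset (Fin 3)} (hS : S.card < 2) (u v w : ℤ) : ycoef P S u v w = 0 := by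
    by_contra hne
    have := (h _ _ _ _ hne).two_le_card
    lia
  refine ycoef_ext fun S u v w => ?_
  rw [ycoef_zero]
  obtain ⟨c, c0, c1, c2, c01, c02, c12, c012⟩ := ycoef_coboundary a b P u v w
  simp only [h1 (S := ∅) (by decide), h1 (S := {0}) (by decide), h1 (S := {1}) (by decide),
    h1 (S := {2}) (by decide), mul_zero, add_zero, sub_zero] at c c0 c1 c2 c01 c02 c12
  have e1 : (b * v - a * w) * ycoef P {1, 2} u v w = 0 := by
    by_cases h0 : ycoef P {1, 2} u v w = 0
    · rw [h0, mul_zero]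
    · obtain ⟨rfl, rfl, rfl⟩ := (h _ _ _ _ h0).eq_of_one_two
      ring
  have e2 : (a * w - b * u) * ycoef P {0, 2} u v w = 0 := by
    by_cases h0 : ycoef P {0, 2} u v w = 0
    · rw [h0, mul_zero]
    · obtain ⟨rfl, rfl, rfl⟩ := (h _ _ _ _ h0).eq_of_zero_two
      ring
  have e3 : a * (u - v) * ycoef P {0, 1} u v w = 0 := by
    by_cases h0 : ycoef P {0, 1} u v w = 0
    · rw [h0, mul_zero]
    · obtain rfl := (h _ _ _ _ h0).eq_of_zero_one
      ring
  have e4 : ((v : ℝ) + 2) * ycoef P {1, 2} (u + 1) (v + 1) (w - 2) = 0 := by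
    by_cases h0 : ycoef P {1, 2} (u + 1) (v + 1) (w - 2) = 0
    · rw [h0, mul_zero]
    · have hv : v = -2 := by have := (h _ _ _ _ h0).eq_of_one_two.2.1; lia
      rw [hv]; simp
  have e5 : ((u : ℝ) + 2) * ycoef P {0, 2} (u + 1) (v + 1) (w - 2) = 0 := by
    by_cases h0 : ycoef P {0, 2} (u + 1) (v + 1) (w - 2) = 0
    · rw [h0, mul_zero]
    · have hu : u = -2 := by have := (h _ _ _ _ h0).eq_of_zero_two.2.1; lia
      rw [hu]; simp
  revert S
  refine forall_fin3 c c0 c1 c2 c01 c02 c12 ?_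
  rw [c012, e1, e2, e3, e4, e5]
  ring

theorem mem_leadSpace_of_type2 (h : ∀ S u v, ycoef P S u v w ≠ 0 → IsType2Pos a b N S u v w) :
    P ∈ leadSpace a b N w := by
  have h1 {S : Finset (Fin 3)} (hS : S.card < 2) (u v : ℤ) : ycoef P S u v w = 0 := by
    by_contra hne
    have := (h _ _ _ hne).two_le_card
    lia
  refine ⟨fun S u v hH => ?_, fun u _ _ => ?_, fun u hu _ => ?_, fun hC => ⟨?_, ?_⟩⟩
  · by_contra hne
    exact hH (h _ _ _ hne).harm
  · rw [qcoef, h1 (by decide), h1 (by decide), h1 (by decide)]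
    ring
  · have e1 : ycoef P {1, 2} u u w = 0 := by
      by_contra hne
      have := (h _ _ _ hne).eq_of_one_two
      lia
    have e2 : ycoef P {0, 2} u u w = 0 := by
      by_contra hne
      have := (h _ _ _ hne).eq_of_zero_two
      lia
    rw [mcoef, e1, e2, add_zero]
  · by_contra hne
    exact (h _ _ _ hne).not_crit hC
  · by_contra hne
    exact (h _ _ _ hne).not_crit hC

/-- The nonzero coefficients of a leading part are at positions of type 2, or at resonant points
with one of the components of the representatives of type 1. -/
theorem leadSpace_cases (ha : a ≠ 0) (hb : b ≠ 0) (hP : P ∈ leadSpace a b N w)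
    {S : Finset (Fin 3)} {u v : ℤ} (hne : ycoef P S u v w ≠ 0) :
    IsType2Pos a b N S u v w ∨ (u = v ∧ Resonant a b u w ∧ S ≠ {0, 1} ∧ S ≠ {0, 1, 2}) := by
  have hA : Adm S u v w := not_not.1 (mt ycoef_of_not_adm hne)
  have hlt : ¬ (u < -1 ∨ v < -1 ∨ w < -1) := mt ycoef_of_lt_neg_one hne
  push Not at hlt
  obtain ⟨x1, x2, x3⟩ : Harm a b u v w := not_not.1 fun h => hne (hP.1 S u v h)
  by_cases hu : u = -1
  · subst hu
    by_cases hv : v = -1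
    · subst hv
      have hS : S = {0, 1} ∨ S = {0, 1, 2} := by
        obtain ⟨h0, h1, -⟩ := hA
        unfold ind at h0 h1
        have h0' : 0 ∈ S := by by_contra h; simp [h] at h0
        have h1' : 1 ∈ S := by by_contra h; simp [h] at h1
        clear hne h0 h1
        revert S; decide
      refine Or.inl ⟨hA, Or.inr (Or.inl ⟨hS, rfl, rfl, fun hC => hne ?_⟩)⟩
      rcases hS with rfl | rfl
      · exact (hP.2.2.2 hC).1
      · exact (hP.2.2.2 hC).2
    · have hw : w = -1 := by
        by_contra hw
        have := (mul_eq_zero.1 (x3 hw)).resolve_left ha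
        exact hv (by exact_mod_cast (sub_eq_zero.1 this).symm)
      subst hw
      have hba : b = a := by have := x2 hv; push_cast at this; linear_combination this
      have hS : S = {0, 2} ∨ S = {0, 1, 2} := by
        obtain ⟨h0, -, h1⟩ := hA
        unfold ind at h0 h1
        have h0' : 0 ∈ S := by by_contra h; simp [h] at h0
        have h1' : 2 ∈ S := by by_contra h; simp [h] at h1
        clear hne h0 h1
        revert S; decide
      exact Or.inl ⟨hA, Or.inr (Or.inr (Or.inr ⟨hba, hS, rfl, rfl⟩))⟩
  · by_cases hv : v = -1
    · subst hv
      have hw : w = -1 := by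
        by_contra hw
        have := (mul_eq_zero.1 (x3 hw)).resolve_left ha
        exact hu (by exact_mod_cast (sub_eq_zero.1 this))
      subst hw
      have hba : b = a := by have := x1 hu; push_cast at this; linear_combination -this
      have hS : S = {1, 2} ∨ S = {0, 1, 2} := by
        obtain ⟨-, h0, h1⟩ := hA
        unfold ind at h0 h1
        have h0' : 1 ∈ S := by by_contra h; simp [h] at h0
        have h1' : 2 ∈ S := by by_contra h; simp [h] at h1
        clear hne h0 h1
        revert S; decide
      exact Or.inl ⟨hA, Or.inr (Or.inr (Or.inl ⟨hba, hS, rfl, rfl⟩))⟩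
    · have y1 := x1 hu
      have y2 := x2 hv
      have huv : u = v := by
        have : b * ((u : ℝ) - v) = 0 := by linear_combination -y1 - y2
        exact_mod_cast sub_eq_zero.1 ((mul_eq_zero.1 this).resolve_left hb)
      subst huv
      have hres : Resonant a b u w := ⟨by lia, by lia, by linear_combination y1⟩
      by_cases hS : S = {0, 1} ∨ S = {0, 1, 2}
      · exact Or.inl ⟨hA, Or.inl ⟨hS, rfl, hres⟩⟩
      · push Not at hS
        exact Or.inr ⟨rfl, hres, hS⟩

theorem not_type2Pos_of_resonant {S : Finset (Fin 3)} {u v : ℤ} (h : Resonant a b u w)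
    (h0 : S ≠ {0, 1}) (h1 : S ≠ {0, 1, 2}) (huv : u = v) : ¬ IsType2Pos a b N S u v w := by
  subst huv
  have := h.1
  rintro ⟨-, ⟨rfl | rfl, -⟩ | ⟨rfl | rfl, -⟩ | ⟨-, -, h2, -⟩ | ⟨-, -, h2, -⟩⟩
  all_goals first | exact absurd rfl h0 | exact absurd rfl h1 | lia

end Type2

/-- The span of the representatives of type 2 of given bidegree consists of the polyvector fields
that are supported in the positions of type 2 of this bidegree. -/
theorem mem_type2Part_iff {a b : ℝ} (ha : a ≠ 0) (hb : b ≠ 0) {al : ℕ} {be : ℤ}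
    (hab : IsExponents a b al be) (n : ℕ) (p q : ℤ) (P : Polyvec) :
    P ∈ type2Part a b al be n p q ↔ ∀ S u v w, ycoef P S u v w ≠ 0 →
      IsType2Pos a b (al * n) S u v w ∧ u + v + 2 + S.card = q ∧ w + 1 = p := by
  constructor
  · intro hP
    refine Submodule.span_induction (p := fun P _ => ∀ S u v w, ycoef P S u v w ≠ 0 →
      IsType2Pos a b (al * n) S u v w ∧ u + v + 2 + S.card = q ∧ w + 1 = p) ?_ ?_ ?_ ?_ hP
    · rintro t ⟨ht, hd⟩ S u v w hne
      refine ⟨?_, (mem_bideg_iff _ _ _).1 hd _ _ _ _ hne⟩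
      obtain ⟨S', u', v', w', hpos, c, rfl⟩ := ht.exists_ymono ha hb hab
      rw [ycoef_smul, ycoef_ymono hpos.1] at hne
      split_ifs at hne with h
      · obtain ⟨rfl, rfl, rfl, rfl⟩ := h
        exact hpos
      · simp at hne
    · intro S u v w hne
      simp at hne
    · intro x y _ _ hx hy S u v w hne
      by_cases h : ycoef x S u v w = 0
      · refine hy _ _ _ _ fun h' => hne ?_
        rw [ycoef_add, h, h', add_zero]
      · exact hx _ _ _ _ h
    · intro c x _ hx S u v w hne
      refine hx _ _ _ _ fun h => hne ?_
      rw [ycoef_smul, h, mul_zero]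
  · intro h
    have hsum : P = ∑ x ∈ (Finset.univ : Finset (Finset (Fin 3))) ×ˢ Finset.Icc (-1 : ℤ) q,
        ycoef P x.1 x.2 (q - 2 - x.1.card - x.2) (p - 1) •
          ymono x.1 x.2 (q - 2 - x.1.card - x.2) (p - 1) := by
      refine ycoef_ext fun S u v w => ?_
      rw [ycoef_sum]
      have hterm (x : Finset (Fin 3) × ℤ) :
          ycoef (ycoef P x.1 x.2 (q - 2 - x.1.card - x.2) (p - 1) •
            ymono x.1 x.2 (q - 2 - x.1.card - x.2) (p - 1)) S u v w =
          if x = (S, u) then ycoef P S u v w else 0 := by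
        rw [ycoef_smul]
        by_cases hA : Adm x.1 x.2 (q - 2 - x.1.card - x.2) (p - 1)
        swap
        · rw [ycoef_of_not_adm hA, zero_mul]
          split_ifs with hx
          · subst hx
            by_contra hne
            obtain ⟨hpos, h1, h2⟩ := h _ _ _ _ (Ne.symm hne)
            refine hA ?_
            have e1 : q - 2 - (S.card : ℤ) - u = v := by lia
            have e2 : p - 1 = w := by lia
            change Adm S u (q - 2 - (S.card : ℤ) - u) (p - 1)
            rw [e1, e2]
            exact hpos.1
          · rfl
        rw [ycoef_ymono hA]
        by_cases hx : x = (S, u)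
        · subst hx
          rw [if_pos rfl]
          split_ifs with h1
          · obtain ⟨-, -, h1, h2⟩ := h1
            rw [mul_one, ← h1, ← h2]
          · rw [mul_zero]
            by_contra hne
            obtain ⟨-, h2, h3⟩ := h _ _ _ _ (Ne.symm hne)
            exact h1 ⟨rfl, rfl, by simp only; lia, by lia⟩
        · rw [if_neg hx, if_neg fun h' => hx (Prod.ext h'.1.symm h'.2.1.symm), mul_zero]
      simp only [hterm]
      rw [Finset.sum_ite_eq']
      split_ifs with hmem
      · rfl
      · by_contra hne
        obtain ⟨hpos, h1, h2⟩ := h _ _ _ _ hne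
        have h3 := mt ycoef_of_lt_neg_one hne
        have h4 := hpos.two_le_card
        refine hmem (Finset.mem_product.2 ⟨Finset.mem_univ _, Finset.mem_Icc.2 ?_⟩)
        simp only
        lia
    rw [hsum]
    refine Submodule.sum_mem _ fun x _ => ?_
    by_cases hne : ycoef P x.1 x.2 (q - 2 - x.1.card - x.2) (p - 1) = 0
    · rw [hne, zero_smul]
      exact zero_mem _
    refine Submodule.smul_mem _ _ ?_
    obtain ⟨hpos, h1, h2⟩ := h _ _ _ _ hne
    obtain ⟨c, hc0, hc⟩ := hpos.isType2 ha hb hab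
    have hmem : c • ymono x.1 x.2 (q - 2 - x.1.card - x.2) (p - 1) ∈
        type2Part a b al be n p q := by
      refine Submodule.subset_span ⟨hc, (mem_bideg_iff _ _ _).2 fun S u v w hne' => ?_⟩
      rw [ycoef_smul, ycoef_ymono hpos.1] at hne'
      split_ifs at hne' with h'
      · obtain ⟨rfl, rfl, rfl, rfl⟩ := h'
        exact ⟨h1, h2⟩
      · simp at hne'
    have := Submodule.smul_mem _ c⁻¹ hmem
    rwa [smul_smul, inv_mul_cancel₀ hc0, one_smul] at this

/-! ### Representatives of type 1 -/

/-- `W` is the combination of the `Y_S` with the constant coefficients `κ S`. -/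
def HasConst (W : Polyvec) (κ : Finset (Fin 3) → ℝ) : Prop :=
  ∀ S u v w, ycoef W S u v w = if u = 0 ∧ v = 0 ∧ w = 0 then κ S else 0

/-- The sequences of constant coefficients `κ k`, up to `k = K`, of the cochains
`∑_{k ≤ K} binom(αi, k) (2a+b)^{-k} D'^{αi-k} z^{βi+2k} (κ k)` whose coboundary vanishes up to the
step `K`. The first condition excludes negative exponents of `z`. -/
structure IsDiagSeq (al : ℕ) (be : ℤ) (i K : ℕ) (κ : ℕ → Finset (Fin 3) → ℝ) : Prop where
  adm : ∀ S, κ 0 S ≠ 0 → 0 ≤ be * i + ind 2 S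
  le : K ≤ al * i
  recA : ∀ k < K, κ (k + 1) ∅ = κ k ∅
  recD : ∀ k < K, κ (k + 1) {2} = κ k {2}
  recS : ∀ k < K, ((al : ℝ) * i - k) * (κ (k + 1) {0} + κ (k + 1) {1}) =
    (al * i - k + 1) * (κ k {0} + κ k {1}) - 2 * κ k {2}
  recM : ∀ k < K, ((al : ℝ) * i - k) * (κ (k + 1) {1, 2} + κ (k + 1) {0, 2}) =
    (al * i - k + 1) * (κ k {1, 2} + κ k {0, 2})

theorem ycoef_zTerm (a b : ℝ) (al : ℕ) (be : ℤ) (i k : ℕ) {W : Polyvec}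
    {κ : Finset (Fin 3) → ℝ} (hW : HasConst W κ) (S : Finset (Fin 3)) (u v w : ℤ) :
    ycoef (zTerm a b al be i k W) S u v w =
      if Adm S u v w ∧ u = al * i - k ∧ v = al * i - k ∧ w = be * i + 2 * k then
        ((al * i).choose k : ℝ) / (2 * a + b) ^ k * κ S else 0 := by
  rw [zTerm, ycoef_smul, ycoef_laurent, hW]
  by_cases hA : Adm S u v w
  · simp only [hA, true_and, if_true]
    rw [mul_ite, mul_zero]
    refine if_congr ?_ rfl rfl
    simp [sub_eq_zero]
  · simp [hA]

/-- The sum of the first terms of a diagonal sequence. -/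
def diagSum (a b : ℝ) (al : ℕ) (be : ℤ) (i K : ℕ) (W : ℕ → Polyvec) : Polyvec :=
  ∑ k ∈ Finset.range (K + 1), zTerm a b al be i k (W k)

section DiagSum

variable {a b : ℝ} {al : ℕ} {be : ℤ} {i K : ℕ} {W : ℕ → Polyvec} {κ : ℕ → Finset (Fin 3) → ℝ}

theorem ycoef_diagSum (hres : Resonant a b (al * i) (be * i)) (h : IsDiagSeq al be i K κ)
    (hW : ∀ k, HasConst (W k) (κ k)) (S : Finset (Fin 3)) (u v w : ℤ) :
    ycoef (diagSum a b al be i K W) S u v w =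
      ∑ k ∈ Finset.range (K + 1), if u = al * i - k ∧ v = al * i - k ∧ w = be * i + 2 * k then
        ((al * i).choose k : ℝ) / (2 * a + b) ^ k * κ k S else 0 := by
  rw [diagSum, ycoef_sum]
  refine Finset.sum_congr rfl fun k hk => ?_
  rw [ycoef_zTerm a b al be i k (hW k)]
  split_ifs with h1 h2 h2
  · rfl
  · exact absurd h1.2 h2
  · by_cases h0 : κ k S = 0
    · rw [h0, mul_zero]
    refine absurd ⟨?_, h2⟩ h1
    obtain ⟨rfl, rfl, rfl⟩ := h2
    have hkK := Finset.mem_range.1 hk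
    have hle : (K : ℤ) ≤ al * i := by exact_mod_cast h.le
    have i0 := ind_nonneg 0 S
    have i1 := ind_nonneg 1 S
    have i2 := ind_nonneg 2 S
    refine ⟨by lia, by lia, ?_⟩
    rcases Nat.eq_zero_or_pos k with rfl | hk0
    · have := h.adm S h0
      simpa using this
    · have := hres.2.1
      lia
  · rfl

theorem ycoef_diagSum_of_not (hres : Resonant a b (al * i) (be * i)) (h : IsDiagSeq al be i K κ)
    (hW : ∀ k, HasConst (W k) (κ k)) {S : Finset (Fin 3)} {u v w : ℤ}
    (hne : ¬ ∃ k : ℕ, k ≤ K ∧ u = al * i - k ∧ v = al * i - k ∧ w = be * i + 2 * k) :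
    ycoef (diagSum a b al be i K W) S u v w = 0 := by
  rw [ycoef_diagSum hres h hW]
  refine Finset.sum_eq_zero fun k hk => if_neg fun h' => hne ⟨k, ?_, h'⟩
  have := Finset.mem_range.1 hk
  lia

theorem ycoef_diagSum_apply (hres : Resonant a b (al * i) (be * i)) (h : IsDiagSeq al be i K κ)
    (hW : ∀ k, HasConst (W k) (κ k)) {k : ℕ} (hk : k ≤ K) (S : Finset (Fin 3)) :
    ycoef (diagSum a b al be i K W) S (al * i - k) (al * i - k) (be * i + 2 * k) =
      ((al * i).choose k : ℝ) / (2 * a + b) ^ k * κ k S := by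
  rw [ycoef_diagSum hres h hW, Finset.sum_eq_single k]
  · rw [if_pos ⟨rfl, rfl, rfl⟩]
  · exact fun j _ hj => if_neg (by lia)
  · exact fun h' => absurd (Finset.mem_range.2 (by lia)) h'

theorem coboundary_diag_eq_zero {P : Polyvec} {u w : ℤ}
    (hA : (b * u - a * w) * ycoef P ∅ u u w + (u + 1) * ycoef P ∅ (u + 1) (u + 1) (w - 2) = 0)
    (hD : (b * u - a * w) * ycoef P {2} u u w +
      (u + 1) * ycoef P {2} (u + 1) (u + 1) (w - 2) = 0)
    (hQ : (b * u - a * w) * qcoef P u w + (u + 2) * qcoef P (u + 1) (w - 2) = 0)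
    (hM : (b * u - a * w) * mcoef P u w + (u + 2) * mcoef P (u + 1) (w - 2) = 0)
    (S : Finset (Fin 3)) : ycoef (coboundary (lambda4 a b) P) S u u w = 0 := by
  obtain ⟨c, c0, c1, c2, c01, c02, c12, c012⟩ := ycoef_coboundary a b P u u w
  rw [qcoef, qcoef] at hQ
  rw [mcoef, mcoef] at hM
  revert S
  refine forall_fin3 c ?_ ?_ ?_ ?_ ?_ ?_ ?_
  · rw [c0, hA]
  · rw [c1]; linear_combination -hA
  · rw [c2]; ring
  · rw [c01]; linear_combination hQ + 2 * hD
  · rw [c02]; linear_combination hD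
  · rw [c12]; linear_combination -hD
  · rw [c012]; linear_combination hM

/-- The coefficients `binom(αi, k) / (2a+b)^k` compensate the Koszul vector. -/
theorem choose_div_succ (ha : a ≠ 0) (hres : Resonant a b (al * i) (be * i)) {k : ℕ}
    (hk : k < al * i) : (2 * a + b) * (k + 1) *
      (((al * i).choose (k + 1) : ℝ) / (2 * a + b) ^ (k + 1)) =
      (al * i - k) * (((al * i).choose k : ℝ) / (2 * a + b) ^ k) := by
  have hμ : 2 * a + b ≠ 0 := hres.two_mul_add_ne_zero ha (by
    have : (0 : ℤ) < al * i := by exact_mod_cast (Nat.zero_le k).trans_lt hk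
    exact this.ne')
  have h1 : ((al * i).choose (k + 1) : ℝ) * (k + 1) = (al * i).choose k * (al * i - k) := by
    have := Nat.choose_succ_right_eq (al * i) k
    have h2 : (((al * i).choose (k + 1) * (k + 1) : ℕ) : ℝ) =
        ((al * i).choose k * (al * i - k) : ℕ) := by rw [this]
    rw [Nat.cast_mul, Nat.cast_mul, Nat.cast_sub hk.le] at h2
    push_cast at h2
    exact h2
  rw [pow_succ]
  field_simp
  linear_combination h1

/-- The coboundary of the sum of a diagonal sequence is zero, except possibly at the step
`K + 1`. -/
theorem coboundary_diagSum (ha : a ≠ 0) (hres : Resonant a b (al * i) (be * i))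
    (h : IsDiagSeq al be i K κ) (hW : ∀ k, HasConst (W k) (κ k)) {S : Finset (Fin 3)} {u v w : ℤ}
    (hne : ycoef (coboundary (lambda4 a b) (diagSum a b al be i K W)) S u v w ≠ 0) :
    u = al * i - (K + 1) ∧ v = al * i - (K + 1) ∧ w = be * i + 2 * (K + 1) := by
  set P := diagSum a b al be i K W with hP
  have hoff {S u v w} := ycoef_diagSum_of_not (S := S) (u := u) (v := v) (w := w) hres h hW
  have hon {k} := ycoef_diagSum_apply hres h hW (k := k)
  rw [← hP] at hoff hon
  by_cases hline : u = v ∧ w = be * i + 2 * (al * i - u)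
  swap
  · have z1 (S) : ycoef P S u v w = 0 := hoff (by rintro ⟨k, -, h1, h2, h3⟩; lia)
    have z2 (S) : ycoef P S (u + 1) (v + 1) (w - 2) = 0 :=
      hoff (by rintro ⟨k, -, h1, h2, h3⟩; lia)
    obtain ⟨c, c0, c1, c2, c01, c02, c12, c012⟩ := ycoef_coboundary a b P u v w
    simp only [z1, z2, mul_zero, add_zero, sub_zero] at c0 c1 c2 c01 c02 c12 c012
    exact absurd (forall_fin3 (p := fun S => ycoef (coboundary (lambda4 a b) P) S u v w = 0)
      c c0 c1 c2 c01 c02 c12 c012 S) hne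
  obtain ⟨rfl, rfl⟩ := hline
  by_contra hcon
  refine hne ?_
  have hlam := hres.koszul_eq u
  rcases lt_trichotomy u (al * i) with hu | rfl | hu
  · obtain ⟨k, hk⟩ : ∃ k : ℕ, u = al * i - (k + 1) := ⟨(al * i - u - 1).toNat, by lia⟩
    subst hk
    by_cases hkK : k < K
    · have e1 : (al * i - (k + 1) : ℤ) = al * i - ((k + 1 : ℕ) : ℤ) := by push_cast; ring
      have e2 : be * i + 2 * (al * i - (al * i - (k + 1) : ℤ)) =
        be * i + 2 * ((k + 1 : ℕ) : ℤ) := by push_cast; ring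
      have e3 : (al * i - (k + 1) : ℤ) + 1 = al * i - k := by ring
      have e4 : be * i + 2 * (al * i - (al * i - (k + 1) : ℤ)) - 2 = be * i + 2 * k := by ring
      have hch := choose_div_succ ha hres (hkK.trans_le h.le)
      have a1 (S) := hon (k := k + 1) hkK S
      have a0 (S) := hon (k := k) hkK.le S
      rw [← e1, ← e2] at a1
      rw [← e3, ← e4] at a0
      have rA := h.recA k hkK
      have rD := h.recD k hkK
      have rS := h.recS k hkK
      have rM := h.recM k hkK
      have hu' : (((al * i - (k + 1) : ℤ)) : ℝ) = al * i - (k + 1) := by push_cast; ring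
      refine coboundary_diag_eq_zero ?_ ?_ ?_ ?_ S
      · rw [hlam, a1, a0, rA, hu']
        push_cast
        linear_combination -κ k ∅ * hch
      · rw [hlam, a1, a0, rD, hu']
        push_cast
        linear_combination -κ k {2} * hch
      · rw [hlam, qcoef, qcoef, a1, a0, a1, a0, a1, a0, rD, hu']
        push_cast
        linear_combination -(κ (k + 1) {0} + κ (k + 1) {1} - 2 * κ k {2}) * hch -
          (((al * i).choose k : ℝ) / (2 * a + b) ^ k) * rS
      · rw [hlam, mcoef, mcoef, a1, a0, a1, a0, hu']
        push_cast
        linear_combination -(κ (k + 1) {1, 2} + κ (k + 1) {0, 2}) * hch -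
          (((al * i).choose k : ℝ) / (2 * a + b) ^ k) * rM
    · have hk2 : k ≠ K := fun hk' => hcon (by subst hk'; exact ⟨rfl, rfl, by ring⟩)
      have z1 (S) : ycoef P S (al * i - (k + 1)) (al * i - (k + 1))
          (be * i + 2 * (al * i - (al * i - (k + 1)))) = 0 :=
        hoff (by rintro ⟨j, h0, h1, -, -⟩; lia)
      have z2 (S) : ycoef P S (al * i - (k + 1) + 1) (al * i - (k + 1) + 1)
          (be * i + 2 * (al * i - (al * i - (k + 1))) - 2) = 0 :=
        hoff (by rintro ⟨j, h0, h1, -, -⟩; lia)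
      refine coboundary_diag_eq_zero ?_ ?_ ?_ ?_ S <;> simp only [qcoef, mcoef, z1, z2] <;> ring
  · have z2 (S) : ycoef P S (al * i + 1) (al * i + 1)
        (be * i + 2 * (al * i - al * i) - 2) = 0 := hoff (by rintro ⟨j, h0, h1, -, -⟩; lia)
    refine coboundary_diag_eq_zero ?_ ?_ ?_ ?_ S <;> simp only [qcoef, mcoef, hlam, z2] <;> ring
  · have z1 (S) : ycoef P S u u (be * i + 2 * (al * i - u)) = 0 :=
      hoff (by rintro ⟨j, h0, h1, -, -⟩; lia)
    have z2 (S) : ycoef P S (u + 1) (u + 1) (be * i + 2 * (al * i - u) - 2) = 0 :=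
      hoff (by rintro ⟨j, h0, h1, -, -⟩; lia)
    refine coboundary_diag_eq_zero ?_ ?_ ?_ ?_ S <;> simp only [qcoef, mcoef, z1, z2] <;> ring

/-- The sum of a diagonal sequence that ends in a suitable way is a cocycle. -/
theorem coboundary_diagSum_eq_zero (ha : a ≠ 0) (hres : Resonant a b (al * i) (be * i))
    (h : IsDiagSeq al be i K κ) (hW : ∀ k, HasConst (W k) (κ k))
    (hA : ((al : ℝ) * i - K) * κ K ∅ = 0) (hD : ((al : ℝ) * i - K) * κ K {2} = 0)
    (hQ : κ K {0} + κ K {1} - 2 * κ K {2} = 0) (hM : κ K {1, 2} + κ K {0, 2} = 0) :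
    coboundary (lambda4 a b) (diagSum a b al be i K W) = 0 := by
  refine ycoef_ext fun S u v w => ?_
  rw [ycoef_zero]
  by_contra hne
  obtain ⟨rfl, rfl, rfl⟩ := coboundary_diagSum ha hres h hW hne
  refine hne ?_
  set P := diagSum a b al be i K W with hP
  have z1 (S) : ycoef P S (al * i - (K + 1)) (al * i - (K + 1)) (be * i + 2 * (K + 1)) = 0 :=
    ycoef_diagSum_of_not hres h hW (by rintro ⟨j, h0, h1, -, -⟩; lia)
  have a0 (S) := ycoef_diagSum_apply hres h hW le_rfl S
  rw [← hP, ← show (al * i - (K + 1) : ℤ) + 1 = al * i - K by ring,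
    ← show be * i + 2 * (K + 1) - 2 = be * i + 2 * (K : ℤ) by ring] at a0
  refine coboundary_diag_eq_zero ?_ ?_ ?_ ?_ S
  · rw [z1, a0]; push_cast
    linear_combination (((al * i).choose K : ℝ) / (2 * a + b) ^ K) * hA
  · rw [z1, a0]; push_cast
    linear_combination (((al * i).choose K : ℝ) / (2 * a + b) ^ K) * hD
  · simp only [qcoef, z1, a0]; push_cast
    linear_combination (al * i - (K + 1) + 2) * (((al * i).choose K : ℝ) / (2 * a + b) ^ K) * hQ
  · simp only [mcoef, z1, a0]; push_cast
    linear_combination (al * i - (K + 1) + 2) * (((al * i).choose K : ℝ) / (2 * a + b) ^ K) * hM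

/-- The binomial expansion of the cocycles `(D' + z²/(2a+b))^{αi} z^{βi} W`. -/
theorem fullTerm_eq (a b : ℝ) (al : ℕ) (be : ℤ) (i : ℕ) {W : Polyvec} {κ : Finset (Fin 3) → ℝ}
    (hW : HasConst W κ) (hadm : ∀ S, κ S ≠ 0 → 0 ≤ be * i + ind 2 S) :
    fullTerm a b al be i W = diagSum a b al be i (al * i) fun _ => W := by
  refine ycoef_ext fun S u v w => ?_
  rw [diagSum, ycoef_sum, fullTerm, add_comm, add_pow, Finset.sum_smul, ycoef_sum]
  refine Finset.sum_congr rfl fun k hk => ?_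
  have hk := Finset.mem_range.1 hk
  have hL (u v w : ℤ) : ycoef (laurent ![0, 0, be * i] W) S u v w =
      if u = 0 ∧ v = 0 ∧ w = be * i then κ S else 0 := by
    rw [ycoef_laurent, hW]
    simp only [Matrix.cons_val_zero, Matrix.cons_val_one, Matrix.cons_val, sub_zero,
      sub_eq_zero]
    have i0 := ind_nonneg 0 S
    have i1 := ind_nonneg 1 S
    split_ifs with h1 h2 h2
    · rfl
    · rfl
    · obtain ⟨rfl, rfl, rfl⟩ := h2
      by_contra hne
      exact h1 ⟨by lia, by lia, hadm S (Ne.symm hne)⟩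
    · rfl
  rw [ycoef_zTerm a b al be i k hW, ycoef_coef_smul]
  have hC : ((al * i).choose k : Coef) = MvPowerSeries.C ((al * i).choose k : ℝ) := by simp
  rw [mul_pow, ← pow_mul, ← map_pow, mul_pow, hC, mul_comm _ (MvPowerSeries.C _)]
  simp only [mul_assoc, coef_C_mul, coef_X_two_pow_mul, coef_X_zero_pow_mul, coef_X_one_pow_mul]
  have hL' := hL (u - (al * i - k)) (v - (al * i - k)) (w - 2 * k)
  rw [ycoef] at hL'
  have hcast : (((al * i - k : ℕ)) : ℤ) = al * i - k := by
    rw [Nat.cast_sub (by lia)]; push_cast; ring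
  rw [hcast, show u + ind 0 S - (al * i - k) = u - (al * i - k) + ind 0 S by ring,
    show v + ind 1 S - (al * i - k) = v - (al * i - k) + ind 1 S by ring,
    show w + ind 2 S - ((2 * k : ℕ) : ℤ) = w - 2 * k + ind 2 S by push_cast; ring, hL']
  split_ifs with h1 h2 h2
  · rw [one_div, inv_pow]; ring
  · by_cases h0 : κ S = 0
    · simp [h0]
    have h3 := hadm S h0
    have i0 := ind_nonneg 0 S
    have i1 := ind_nonneg 1 S
    have hle : (k : ℤ) ≤ al * i := by exact_mod_cast (by lia : k ≤ al * i)
    exact absurd ⟨⟨by lia, by lia, by lia⟩, by lia, by lia, by lia⟩ h2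
  · exact absurd ⟨by lia, by lia, by lia⟩ h1
  · simp

end DiagSum

/-- The representative of type 1 with the initial coefficients `κ S` of the `Y_S`. -/
def type1Of (a b : ℝ) (al : ℕ) (be : ℤ) (n : ℕ) (σ : CoefChoice) (i : ℕ)
    (κ : Finset (Fin 3) → ℝ) : Fin 3 → Polyvec
  | 0 => if n ≤ i then diagSum a b al be i (al * n) fun k => σ.A i (κ ∅) k • one
      else fullTerm a b al be i (κ ∅ • one)
  | 1 => if n ≤ i then diagSum a b al be i (al * n) fun k =>
        (σ.BCD i (κ {0}, κ {1}, κ {2}) k).1 • Y 0 + (σ.BCD i (κ {0}, κ {1}, κ {2}) k).2.1 • Y 1 +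
          (σ.BCD i (κ {0}, κ {1}, κ {2}) k).2.2 • Y 2
      else fullTerm a b al be i
        (κ {0} • (Y 0 + (1 / 2 : ℝ) • Y 2) + κ {1} • (Y 1 + (1 / 2 : ℝ) • Y 2))
  | 2 => if n ≤ i then diagSum a b al be i (al * n) fun k =>
        (σ.EF i (κ {1, 2}, -κ {0, 2}) k).1 • Y23 + (σ.EF i (κ {1, 2}, -κ {0, 2}) k).2 • Y31
      else laurent ![al * i, al * i, be * i] (κ {1, 2} • (Y23 + Y31))

/-- The initial coefficients of the representatives of type 1 with index `i` and cochain
degree `c`. -/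
structure IsInit (be : ℤ) (n i c : ℕ) (κ : Finset (Fin 3) → ℝ) : Prop where
  supp : ∀ S, κ S ≠ 0 → S.card = c ∧ S ≠ {0, 1}
  adm : ∀ S, κ S ≠ 0 → 0 ≤ be * i + ind 2 S
  q_eq : i < n → κ {0} + κ {1} - 2 * κ {2} = 0
  m_eq : i < n → κ {1, 2} + κ {0, 2} = 0

theorem IsInit.eq_zero {be : ℤ} {n i c : ℕ} {κ : Finset (Fin 3) → ℝ} (h : IsInit be n i c κ)
    {S : Finset (Fin 3)} (hS : S.card ≠ c ∨ S = {0, 1}) : κ S = 0 := by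
  by_contra hne
  obtain ⟨h1, h2⟩ := h.supp S hne
  rcases hS with h3 | h3
  · exact h3 h1
  · exact h2 h3

/-- The coefficients of `A`. -/
def kap0 (A : ℝ) (S : Finset (Fin 3)) : ℝ := if S = ∅ then A else 0

/-- The coefficients of `B Y₁ + C Y₂ + D Y₃`. -/
def kap1 (B C D : ℝ) (S : Finset (Fin 3)) : ℝ :=
  if S = {0} then B else if S = {1} then C else if S = {2} then D else 0

/-- The coefficients of `E Y₂₃ + F Y₃₁`; the second one refers to `Y₁₃ = -Y₃₁`. -/
def kap2 (E F : ℝ) (S : Finset (Fin 3)) : ℝ :=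
  if S = {1, 2} then E else if S = {0, 2} then -F else 0

theorem kap0_apply (A : ℝ) : kap0 A ∅ = A ∧ kap0 A {0} = 0 ∧ kap0 A {1} = 0 ∧ kap0 A {2} = 0 ∧
    kap0 A {0, 1} = 0 ∧ kap0 A {0, 2} = 0 ∧ kap0 A {1, 2} = 0 ∧ kap0 A {0, 1, 2} = 0 := by
  simp +decide [kap0]

theorem kap1_apply (B C D : ℝ) : kap1 B C D ∅ = 0 ∧ kap1 B C D {0} = B ∧ kap1 B C D {1} = C ∧
    kap1 B C D {2} = D ∧ kap1 B C D {0, 1} = 0 ∧ kap1 B C D {0, 2} = 0 ∧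
    kap1 B C D {1, 2} = 0 ∧ kap1 B C D {0, 1, 2} = 0 := by
  simp +decide [kap1]

theorem kap2_apply (E F : ℝ) : kap2 E F ∅ = 0 ∧ kap2 E F {0} = 0 ∧ kap2 E F {1} = 0 ∧
    kap2 E F {2} = 0 ∧ kap2 E F {0, 1} = 0 ∧ kap2 E F {0, 2} = -F ∧
    kap2 E F {1, 2} = E ∧ kap2 E F {0, 1, 2} = 0 := by
  simp +decide [kap2]

theorem hasConst_zero (A : ℝ) : HasConst (A • one) (kap0 A) := by
  intro S u v w
  rw [ycoef_smul, ycoef_one, kap0]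
  split_ifs <;> simp

theorem hasConst_one (B C D : ℝ) : HasConst (B • Y 0 + C • Y 1 + D • Y 2) (kap1 B C D) := by
  intro S u v w
  simp only [ycoef_add, ycoef_smul, ycoef_Y_zero, ycoef_Y_one, ycoef_Y_two]
  obtain ⟨k, k0, k1, k2, k01, k02, k12, k012⟩ := kap1_apply B C D
  by_cases h : u = 0 ∧ v = 0 ∧ w = 0
  · simp only [h, and_true, if_true]
    revert S
    refine forall_fin3 ?_ ?_ ?_ ?_ ?_ ?_ ?_ ?_ <;>
      simp +decide [k, k0, k1, k2, k01, k02, k12, k012]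
  · simp [h]

theorem hasConst_two (E F : ℝ) : HasConst (E • Y23 + F • Y31) (kap2 E F) := by
  intro S u v w
  simp only [ycoef_add, ycoef_smul, ycoef_Y23, ycoef_Y31]
  obtain ⟨k, k0, k1, k2, k01, k02, k12, k012⟩ := kap2_apply E F
  by_cases h : u = 0 ∧ v = 0 ∧ w = 0
  · simp only [h, and_true, if_true]
    revert S
    refine forall_fin3 ?_ ?_ ?_ ?_ ?_ ?_ ?_ ?_ <;>
      simp +decide [k, k0, k1, k2, k01, k02, k12, k012]
  · simp [h]

theorem IsInit.eq_kap0 {be : ℤ} {n i : ℕ} {κ : Finset (Fin 3) → ℝ} (h : IsInit be n i 0 κ) :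
    κ = kap0 (κ ∅) := by
  obtain ⟨k, k0, k1, k2, k01, k02, k12, k012⟩ := kap0_apply (κ ∅)
  refine funext (forall_fin3 k.symm ?_ ?_ ?_ ?_ ?_ ?_ ?_) <;>
    simp only [k0, k1, k2, k01, k02, k12, k012] <;> exact h.eq_zero (Or.inl (by decide))

theorem IsInit.eq_kap1 {be : ℤ} {n i : ℕ} {κ : Finset (Fin 3) → ℝ} (h : IsInit be n i 1 κ) :
    κ = kap1 (κ {0}) (κ {1}) (κ {2}) := by
  obtain ⟨k, k0, k1, k2, k01, k02, k12, k012⟩ := kap1_apply (κ {0}) (κ {1}) (κ {2})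
  refine funext (forall_fin3 ?_ k0.symm k1.symm k2.symm ?_ ?_ ?_ ?_) <;>
    simp only [k, k01, k02, k12, k012] <;> exact h.eq_zero (Or.inl (by decide))

theorem IsInit.eq_kap2 {be : ℤ} {n i : ℕ} {κ : Finset (Fin 3) → ℝ} (h : IsInit be n i 2 κ) :
    κ = kap2 (κ {1, 2}) (-κ {0, 2}) := by
  obtain ⟨k, k0, k1, k2, k01, k02, k12, k012⟩ := kap2_apply (κ {1, 2}) (-κ {0, 2})
  rw [neg_neg] at k02
  refine funext (forall_fin3 ?_ ?_ ?_ ?_ ?_ k02.symm k12.symm ?_) <;>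
    simp only [k, k0, k1, k2, k01, k012]
  on_goal 5 => exact h.eq_zero (Or.inr rfl)
  all_goals exact h.eq_zero (Or.inl (by decide))

theorem kap0_ne_zero {A : ℝ} {S : Finset (Fin 3)} (h : kap0 A S ≠ 0) : S = ∅ ∧ A ≠ 0 := by
  unfold kap0 at h
  split_ifs at h with h1
  · exact ⟨h1, h⟩
  · exact absurd rfl h

theorem kap1_ne_zero {B C D : ℝ} {S : Finset (Fin 3)} (h : kap1 B C D S ≠ 0) :
    (S = {0} ∧ B ≠ 0) ∨ (S = {1} ∧ C ≠ 0) ∨ (S = {2} ∧ D ≠ 0) := by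
  unfold kap1 at h
  split_ifs at h with h1 h2 h3
  · exact Or.inl ⟨h1, h⟩
  · exact Or.inr (Or.inl ⟨h2, h⟩)
  · exact Or.inr (Or.inr ⟨h3, h⟩)
  · exact absurd rfl h

theorem kap2_ne_zero {E F : ℝ} {S : Finset (Fin 3)} (h : kap2 E F S ≠ 0) :
    S = {1, 2} ∨ S = {0, 2} := by
  unfold kap2 at h
  split_ifs at h with h1 h2
  · exact Or.inl h1
  · exact Or.inr h2
  · exact absurd rfl h

section Type1

variable {a b : ℝ} {al : ℕ} {be : ℤ} {n i : ℕ} {σ : CoefChoice}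

theorem be_mul_nonneg (hab : IsExponents a b al be) (hi : Admissible a b i)
    (hacc : ¬ AccIndex a b i) : 0 ≤ be * i :=
  (hi.resolve_right hacc).nonneg hab

theorem mem_type1_iff (ha : a ≠ 0) (hb : b ≠ 0) (hab : IsExponents a b al be)
    (hi : Admissible a b i) (c : Fin 3) (s : Polyvec) :
    s ∈ type1 a b al be n σ i c ↔ ∃ κ, IsInit be n i c κ ∧ s = type1Of a b al be n σ i κ c := by
  have hres := (resonant_iff ha hb hab _ _).2 ⟨i, hi, rfl, rfl⟩
  have hw := hres.2.1
  have hacc0 {κ : Finset (Fin 3) → ℝ} {S : Finset (Fin 3)} (hS : ind 2 S = 0)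
      (h : κ S ≠ 0 → 0 ≤ be * i + ind 2 S) (h' : AccIndex a b i) : κ S = 0 := by
    by_contra hne
    have h1 := h hne
    rw [hS, h'.2, (hab.acc h'.1).2.1] at h1
    simp at h1
  have hnacc {A : ℝ} (hA : AccIndex a b i → A = 0) (h : A ≠ 0) : 0 ≤ be * i :=
    be_mul_nonneg hab hi fun h' => h (hA h')
  fin_cases c
  · constructor
    · rintro ⟨A, hA, rfl⟩
      obtain ⟨k, k0, k1, k2, k01, k02, k12, k012⟩ := kap0_apply A
      refine ⟨kap0 A, ⟨fun S h => ?_, fun S h => ?_, fun _ => by simp [k0, k1, k2],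
        fun _ => by simp [k12, k02]⟩, ?_⟩
      · rw [(kap0_ne_zero h).1]
        exact ⟨by simp, by decide⟩
      · have := hnacc hA (kap0_ne_zero h).2
        have := ind_nonneg 2 S
        lia
      · simp only [type1Of, k]
        rfl
    · rintro ⟨κ, h, rfl⟩
      exact ⟨κ ∅, hacc0 (by simp [ind]) (h.adm ∅), rfl⟩
  · constructor
    · rintro ⟨B, C, D, hBC, rfl⟩
      set D' := if n ≤ i then D else (B + C) / 2 with hD'
      obtain ⟨k, k0, k1, k2, k01, k02, k12, k012⟩ := kap1_apply B C D'
      refine ⟨kap1 B C D', ⟨fun S h => ?_, fun S h => ?_, fun hin => ?_,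
        fun _ => by simp [k12, k02]⟩, ?_⟩
      · obtain ⟨rfl, -⟩ | ⟨rfl, -⟩ | ⟨rfl, -⟩ := kap1_ne_zero h <;> exact ⟨by simp, by decide⟩
      · obtain ⟨rfl, h⟩ | ⟨rfl, h⟩ | ⟨rfl, h⟩ := kap1_ne_zero h
        · have := hnacc (fun h' => (hBC h').1) h
          simpa [ind] using this
        · have := hnacc (fun h' => (hBC h').2) h
          simpa [ind] using this
        · simp [ind]; lia
      · rw [k0, k1, k2, hD', if_neg (by lia)]; ring
      · simp only [type1Of, k0, k1, k2]
        by_cases hin : n ≤ i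
        · rw [hD', if_pos hin, if_pos hin, if_pos hin]; rfl
        · rw [if_neg hin, if_neg hin]
    · rintro ⟨κ, h, rfl⟩
      exact ⟨κ {0}, κ {1}, κ {2}, fun h' => ⟨hacc0 (by simp [ind]) (h.adm {0}) h',
        hacc0 (by simp [ind]) (h.adm {1}) h'⟩, rfl⟩
  · constructor
    · rintro ⟨E, F, rfl⟩
      set F' := if n ≤ i then F else E with hF'
      obtain ⟨k, k0, k1, k2, k01, k02, k12, k012⟩ := kap2_apply E F'
      refine ⟨kap2 E F', ⟨fun S h => ?_, fun S h => ?_, fun _ => by simp [k0, k1, k2],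
        fun hin => ?_⟩, ?_⟩
      · obtain rfl | rfl := kap2_ne_zero h <;> exact ⟨by simp, by decide⟩
      · obtain rfl | rfl := kap2_ne_zero h <;> simp [ind] <;> lia
      · rw [k12, k02, hF', if_neg (by lia)]; ring
      · simp only [type1Of, k12, k02, neg_neg]
        by_cases hin : n ≤ i
        · rw [hF', if_pos hin, if_pos hin, if_pos hin]; rfl
        · rw [if_neg hin, if_neg hin]
    · rintro ⟨κ, h, rfl⟩
      refine ⟨κ {1, 2}, -κ {0, 2}, rfl⟩

/-- The properties of a representative of type 1: its leading part, its support, and the step up to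
which it is closed. -/
structure IsType1Rep (a b : ℝ) (al : ℕ) (be : ℤ) (n i c : ℕ) (κ : Finset (Fin 3) → ℝ)
    (s : Polyvec) : Prop where
  lead : ∀ S u v, ycoef s S u v (be * i) = if u = al * i ∧ v = al * i then κ S else 0
  supp : ∀ S u v w, ycoef s S u v w ≠ 0 →
    S.card = c ∧ ∃ k : ℕ, u = al * i - k ∧ v = al * i - k ∧ w = be * i + 2 * k
  closed : ∀ S u v w, ycoef (coboundary (lambda4 a b) s) S u v w ≠ 0 →
    be * i + 2 * (al * n + 1) ≤ w

theorem diagSum_isType1Rep (ha : a ≠ 0) (hres : Resonant a b (al * i) (be * i)) {K c : ℕ}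
    {W : ℕ → Polyvec} {κ : ℕ → Finset (Fin 3) → ℝ} (h : IsDiagSeq al be i K κ)
    (hW : ∀ k, HasConst (W k) (κ k)) (hc : ∀ k S, κ k S ≠ 0 → S.card = c)
    (hd : K = al * n ∨ (((al : ℝ) * i - K) * κ K ∅ = 0 ∧ ((al : ℝ) * i - K) * κ K {2} = 0 ∧
      κ K {0} + κ K {1} - 2 * κ K {2} = 0 ∧ κ K {1, 2} + κ K {0, 2} = 0)) :
    IsType1Rep a b al be n i c (κ 0) (diagSum a b al be i K W) where
  lead S u v := by
    by_cases huv : u = al * i ∧ v = al * i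
    · obtain ⟨rfl, rfl⟩ := huv
      have := ycoef_diagSum_apply hres h hW (Nat.zero_le K) S
      simpa using this
    · rw [if_neg huv]
      exact ycoef_diagSum_of_not hres h hW (by rintro ⟨k, -, h1, h2, h3⟩; lia)
  supp S u v w hne := by
    obtain ⟨k, hk, rfl, rfl, rfl⟩ := not_not.1 (mt (ycoef_diagSum_of_not hres h hW) hne)
    rw [ycoef_diagSum_apply hres h hW hk] at hne
    exact ⟨hc k S (right_ne_zero_of_mul hne), k, rfl, rfl, rfl⟩
  closed S u v w hne := by
    rcases hd with hd | ⟨h1, h2, h3, h4⟩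
    · obtain ⟨-, -, rfl⟩ := coboundary_diagSum ha hres h hW hne
      rw [hd]
      push_cast
      lia
    · rw [coboundary_diagSum_eq_zero ha hres h hW h1 h2 h3 h4] at hne
      simp at hne

theorem type1Of_isType1Rep (ha : a ≠ 0) (hb : b ≠ 0) (hab : IsExponents a b al be)
    (hi : Admissible a b i) (hσ : σ.Valid a b al n) {c : Fin 3} {κ : Finset (Fin 3) → ℝ}
    (hκ : IsInit be n i c κ) :
    IsType1Rep a b al be n i c κ (type1Of a b al be n σ i κ c) := by
  have hres := (resonant_iff ha hb hab _ _).2 ⟨i, hi, rfl, rfl⟩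
  have hle (hin : n ≤ i) : al * n ≤ al * i := Nat.mul_le_mul_left al hin
  have hne (hin : n ≤ i) {k : ℕ} (hk : k < al * n) : (al : ℝ) * i - k ≠ 0 := by
    have : k < al * i := hk.trans_le (hle hin)
    have h1 : (k : ℝ) < ((al * i : ℕ) : ℝ) := by exact_mod_cast this
    push_cast at h1
    exact (sub_pos.2 h1).ne'
  -- Constant sequences with vanishing `Q` and `M` verify the recursions.
  have hconst {K : ℕ} (hin : i < n) (hK : K ≤ al * i) :
      IsDiagSeq al be i K fun _ => κ :=
    ⟨hκ.adm, hK, fun _ _ => rfl, fun _ _ => rfl,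
      fun k _ => by linear_combination -hκ.q_eq hin, fun k _ => by
        linear_combination -hκ.m_eq hin⟩
  fin_cases c
  · have e := IsInit.eq_kap0 hκ
    obtain ⟨k, k0, k1, k2, k01, k02, k12, k012⟩ := kap0_apply (κ ∅)
    simp only [type1Of]
    by_cases hin : n ≤ i
    · rw [if_pos hin]
      have hz : kap0 (σ.A i (κ ∅) 0) = κ := by rw [hσ.A_zero i hin hi, ← e]
      have := diagSum_isType1Rep (a := a) (b := b) (n := n) (c := 0) ha hres
        (κ := fun k => kap0 (σ.A i (κ ∅) k))
        ⟨fun S h => hκ.adm S (by simpa only [hz] using h), hle hin,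
          fun k hk => by rw [hσ.cond₀ i hin hi _ k hk], fun k hk => by simp [kap0_apply],
          fun k hk => by simp [kap0_apply], fun k hk => by simp [kap0_apply]⟩
        (fun k => hasConst_zero _) (fun k S h => by rw [(kap0_ne_zero h).1]; rfl) (Or.inl rfl)
      rwa [hz] at this
    · rw [if_neg hin]
      have hc : HasConst (κ ∅ • one) κ := by nth_rw 2 [e]; exact hasConst_zero _
      rw [fullTerm_eq a b al be i hc hκ.adm]
      exact diagSum_isType1Rep ha hres (hconst (by lia) le_rfl) (fun _ => hc)
        (fun _ S h => (hκ.supp S h).1)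
        (Or.inr ⟨by push_cast; ring, by push_cast; ring, hκ.q_eq (by lia), hκ.m_eq (by lia)⟩)
  · have e := IsInit.eq_kap1 hκ
    simp only [type1Of]
    by_cases hin : n ≤ i
    · rw [if_pos hin]
      set v := (κ {0}, κ {1}, κ {2}) with hv
      have hz : kap1 (σ.BCD i v 0).1 (σ.BCD i v 0).2.1 (σ.BCD i v 0).2.2 = κ := by
        rw [hσ.BCD_zero i hin hi, ← e]
      have := diagSum_isType1Rep (a := a) (b := b) (n := n) (c := 1) ha hres
        (κ := fun k => kap1 (σ.BCD i v k).1 (σ.BCD i v k).2.1 (σ.BCD i v k).2.2)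
        ⟨fun S h => hκ.adm S (by simpa only [hz] using h), hle hin,
          fun k hk => by simp [kap1_apply],
          fun k hk => by simp only [kap1_apply]; exact (hσ.cond₁ i hin hi v k hk).2,
          fun k hk => by
            simp only [kap1_apply]
            rw [(hσ.cond₁ i hin hi v k hk).1]
            field_simp [hne hin hk],
          fun k hk => by simp [kap1_apply]⟩
        (fun k => hasConst_one _ _ _)
        (fun k S h => by
          obtain ⟨rfl, -⟩ | ⟨rfl, -⟩ | ⟨rfl, -⟩ := kap1_ne_zero h <;> rfl) (Or.inl rfl)
      rwa [hz] at this
    · rw [if_neg hin]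
      have hc : HasConst
          (κ {0} • (Y 0 + (1 / 2 : ℝ) • Y 2) + κ {1} • (Y 1 + (1 / 2 : ℝ) • Y 2)) κ := by
        have h2 : κ {2} = κ {0} * (1 / 2) + κ {1} * (1 / 2) := by
          linear_combination -(1 / 2 : ℝ) * hκ.q_eq (by lia)
        have h3 := hasConst_one (κ {0}) (κ {1}) (κ {2})
        rw [← e] at h3
        convert h3 using 1
        rw [h2, smul_add, smul_add, smul_smul, smul_smul, add_smul]
        abel
      rw [fullTerm_eq a b al be i hc hκ.adm]
      exact diagSum_isType1Rep ha hres (hconst (by lia) le_rfl) (fun _ => hc)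
        (fun _ S h => (hκ.supp S h).1)
        (Or.inr ⟨by push_cast; ring, by push_cast; ring, hκ.q_eq (by lia), hκ.m_eq (by lia)⟩)
  · have e := IsInit.eq_kap2 hκ
    simp only [type1Of]
    by_cases hin : n ≤ i
    · rw [if_pos hin]
      set v := (κ {1, 2}, -κ {0, 2}) with hv
      have hz : kap2 (σ.EF i v 0).1 (σ.EF i v 0).2 = κ := by
        rw [hσ.EF_zero i hin hi, ← e]
      have := diagSum_isType1Rep (a := a) (b := b) (n := n) (c := 2) ha hres
        (κ := fun k => kap2 (σ.EF i v k).1 (σ.EF i v k).2)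
        ⟨fun S h => hκ.adm S (by simpa only [hz] using h), hle hin,
          fun k hk => by simp [kap2_apply], fun k hk => by simp [kap2_apply],
          fun k hk => by simp [kap2_apply],
          fun k hk => by
            simp only [kap2_apply, ← sub_eq_add_neg]
            rw [hσ.cond₂ i hin hi v k hk]
            field_simp [hne hin hk]⟩
        (fun k => hasConst_two _ _)
        (fun k S h => by obtain rfl | rfl := kap2_ne_zero h <;> rfl) (Or.inl rfl)
      rwa [hz] at this
    · rw [if_neg hin]
      have hc : HasConst (κ {1, 2} • (Y23 + Y31)) κ := by
        have h3 := hasConst_two (κ {1, 2}) (-κ {0, 2})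
        rw [← e] at h3
        convert h3 using 1
        rw [smul_add, show -κ {0, 2} = κ {1, 2} by linear_combination -hκ.m_eq (by lia)]
      have hl : laurent ![(al : ℤ) * i, al * i, be * i] (κ {1, 2} • (Y23 + Y31)) =
          diagSum a b al be i 0 fun _ => κ {1, 2} • (Y23 + Y31) := by
        simp [diagSum, zTerm]
      rw [hl]
      have h0 {S : Finset (Fin 3)} (hS : S.card ≠ 2) : κ S = 0 := hκ.eq_zero (Or.inl hS)
      exact diagSum_isType1Rep ha hres (hconst (by lia) (Nat.zero_le _))
        (fun _ => hc) (fun _ S h => (hκ.supp S h).1)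
        (Or.inr ⟨by rw [h0 (by decide), mul_zero], by rw [h0 (by decide), mul_zero],
          hκ.q_eq (by lia), hκ.m_eq (by lia)⟩)

end Type1

/-! ### The systems of representatives -/

section System

variable {a b : ℝ} {al : ℕ} {be : ℤ} {n : ℕ} {σ : CoefChoice} {p q : ℤ}

theorem IsType1Rep.mem_Z {i : ℕ} {c : Fin 3} {κ : Finset (Fin 3) → ℝ} {s : Polyvec}
    (h : IsType1Rep a b al be n i c κ s) (hd : HasType1Bideg al be p q i c) :
    s ∈ (complex4 a b).Z (2 * (al * n) + 2) p q := by
  obtain ⟨rfl, rfl⟩ := hd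
  refine ⟨⟨(mem_hfil_iff _ _).2 fun S u v w hne => ?_, Submodule.mem_comap.2 <|
    (mem_hfil_iff _ _).2 fun S u v w hne => ?_⟩, (mem_diag_iff _ _).2 fun S u v w hne => ?_⟩
  · obtain ⟨-, k, -, -, rfl⟩ := h.supp S u v w hne
    lia
  · have := h.closed S u v w hne
    lia
  · obtain ⟨hS, k, rfl, rfl, rfl⟩ := h.supp S u v w hne
    rw [hS]
    ring

theorem IsType1Rep.mem_leadSpace (ha : a ≠ 0) (hb : b ≠ 0) (hab : IsExponents a b al be) {i : ℕ}
    (hi : Admissible a b i) {c : ℕ} {κ : Finset (Fin 3) → ℝ} {s : Polyvec}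
    (h : IsType1Rep a b al be n i c κ s) (hκ : IsInit be n i c κ) :
    s ∈ leadSpace a b (al * n) (be * i) := by
  have hres := (resonant_iff ha hb hab _ _).2 ⟨i, hi, rfl, rfl⟩
  have hin {u : ℤ} (hu : u = al * i) (hN : u < al * n) : i < n := by
    rw [hu] at hN
    exact_mod_cast lt_of_mul_lt_mul_left hN (by positivity)
  have hneg (S : Finset (Fin 3)) : ycoef s S (-1) (-1) (be * i) = 0 := by
    rw [h.lead, if_neg]
    rintro ⟨h1, -⟩
    have := hres.1
    lia
  refine ⟨fun S u v hH => ?_, fun u _ hN => ?_, fun u _ hN => ?_, fun _ => ⟨hneg _, hneg _⟩⟩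
  · rw [h.lead, if_neg]
    rintro ⟨rfl, rfl⟩
    exact hH ⟨fun _ => by linear_combination hres.2.2, fun _ => by linear_combination -hres.2.2,
      fun _ => by ring⟩
  · simp only [qcoef, h.lead, and_self]
    split_ifs with hu
    · exact hκ.q_eq (hin hu hN)
    · ring
  · simp only [mcoef, h.lead, and_self]
    split_ifs with hu
    · exact hκ.m_eq (hin hu hN)
    · ring

theorem mem_type1Part_cases (ha : a ≠ 0) (hb : b ≠ 0) (hab : IsExponents a b al be)
    (hσ : σ.Valid a b al n) {s : Polyvec} (hs : s ∈ type1Part a b al be n σ p q) :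
    (∃ i c κ, Admissible a b i ∧ HasType1Bideg al be p q i c ∧ IsInit be n i c κ ∧
      s = type1Of a b al be n σ i κ c ∧ IsType1Rep a b al be n i c κ s) ∨
    ((¬ ∃ i c, Admissible a b i ∧ HasType1Bideg al be p q i c) ∧ s = 0) := by
  rcases hs with ⟨i, c, hi, hd, hs⟩ | hs
  · obtain ⟨κ, hκ, rfl⟩ := (mem_type1_iff ha hb hab hi c s).1 hs
    exact Or.inl ⟨i, c, κ, hi, hd, hκ, rfl, type1Of_isType1Rep ha hb hab hi hσ hκ⟩
  · exact Or.inr hs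

theorem not_type2Pos_of_type1 (ha : a ≠ 0) (hb : b ≠ 0) (hab : IsExponents a b al be)
    (hσ : σ.Valid a b al n) {s : Polyvec} (hs : s ∈ type1Part a b al be n σ p q)
    {N : ℤ} {S : Finset (Fin 3)} {u v : ℤ} (hne : ycoef s S u v (p - 1) ≠ 0) :
    ¬ IsType2Pos a b N S u v (p - 1) := by
  obtain ⟨i, c, κ, hi, hd, hκ, -, h⟩ | ⟨-, rfl⟩ := mem_type1Part_cases ha hb hab hσ hs
  swap
  · simp at hne
  have hp : p - 1 = be * i := by rw [hd.2]; ring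
  rw [hp, h.lead] at hne
  split_ifs at hne with huv
  · obtain ⟨rfl, rfl⟩ := huv
    obtain ⟨h1, h2⟩ := hκ.supp S hne
    refine not_type2Pos_of_resonant ((resonant_iff ha hb hab _ _).2 ⟨i, hi, rfl, hp⟩) h2 ?_ rfl
    rintro rfl
    have : (c : ℕ) = 3 := h1.symm
    lia
  · exact absurd rfl hne

/-- The representatives of type 1 are determined by their leading parts. -/
theorem eq_of_lead_eq (ha : a ≠ 0) (hb : b ≠ 0) (hab : IsExponents a b al be)
    (hσ : σ.Valid a b al n) {s s' : Polyvec} (hs : s ∈ type1Part a b al be n σ p q)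
    (hs' : s' ∈ type1Part a b al be n σ p q)
    (h : ∀ S u v, ycoef s S u v (p - 1) = ycoef s' S u v (p - 1)) : s = s' := by
  obtain ⟨i, c, κ, hi, hd, hκ, e, hr⟩ | ⟨h1, rfl⟩ := mem_type1Part_cases ha hb hab hσ hs <;>
  obtain ⟨j, c', κ', hj, hd', hκ', e', hr'⟩ | ⟨h1', rfl⟩ := mem_type1Part_cases ha hb hab hσ hs'
  · have hp : p - 1 = be * i := by rw [hd.2]; ring
    obtain rfl : i = j := admissible_unique ha hb hab hi hj (by linarith [hd.2, hd'.2])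
    obtain rfl : c = c' := by
      have h1 := hd.1
      rw [hd'.1] at h1
      exact Fin.ext (by lia)
    have hk : κ = κ' := by
      funext S
      have h1 := h S (al * i) (al * i)
      rw [hp, hr.lead, hr'.lead] at h1
      simpa using h1
    rw [e, e', hk]
  · exact absurd ⟨i, c, hi, hd⟩ h1'
  · exact absurd ⟨j, c', hj, hd'⟩ h1
  · rfl

/-- Every leading part is, outside the positions of type 2, that of a representative of type 1. -/
theorem exists_type1 (ha : a ≠ 0) (hb : b ≠ 0) (hab : IsExponents a b al be)
    (hσ : σ.Valid a b al n) {x : Polyvec} (hx : x ∈ diag (p + q))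
    (hl : x ∈ leadSpace a b (al * n) (p - 1)) :
    ∃ s ∈ type1Part a b al be n σ p q, ∀ S u v, ¬ IsType2Pos a b (al * n) S u v (p - 1) →
      ycoef x S u v (p - 1) = ycoef s S u v (p - 1) := by
  classical
  have hcard3 : ∀ S : Finset (Fin 3), S ≠ {0, 1, 2} → S.card < 3 := by decide
  -- A position of type 1 determines the bidegree.
  have hpos {S : Finset (Fin 3)} {u v : ℤ} (hne : ycoef x S u v (p - 1) ≠ 0)
      (h2 : ¬ IsType2Pos a b (al * n) S u v (p - 1)) :
      ∃ i c, Admissible a b i ∧ HasType1Bideg al be p q i c ∧ u = al * i ∧ v = al * i ∧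
        S.card = c ∧ S ≠ {0, 1} := by
    obtain ⟨rfl, hres, h01, h012⟩ := (leadSpace_cases ha hb hl hne).resolve_left h2
    obtain ⟨i, hi, rfl, hw⟩ := (resonant_iff ha hb hab _ _).1 hres
    have hc : S.card < 3 := hcard3 S h012
    have hd := (mem_diag_iff _ _).1 hx _ _ _ _ hne
    exact ⟨i, ⟨S.card, hc⟩, hi, ⟨by simp only; lia, by lia⟩, rfl, rfl, rfl, h01⟩
  by_cases hex : ∃ i c, Admissible a b i ∧ HasType1Bideg al be p q i c
  swap
  · refine ⟨0, Or.inr ⟨hex, rfl⟩, fun S u v h2 => ?_⟩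
    rw [ycoef_zero]
    by_contra hne
    obtain ⟨i, c, hi, hd, -⟩ := hpos hne h2
    exact hex ⟨i, c, hi, hd⟩
  obtain ⟨i, c, hi, hd⟩ := hex
  have hp : p - 1 = be * i := by rw [hd.2]; ring
  have hres := (resonant_iff ha hb hab _ _).2 ⟨i, hi, rfl, rfl⟩
  set κ : Finset (Fin 3) → ℝ := fun S =>
    if S.card = c ∧ S ≠ {0, 1} then ycoef x S (al * i) (al * i) (be * i) else 0 with hκ
  have hcard {S : Finset (Fin 3)} (h01 : S ≠ {0, 1}) (h012 : S ≠ {0, 1, 2}) :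
      κ S = ycoef x S (al * i) (al * i) (be * i) := by
    by_cases hne : ycoef x S (al * i) (al * i) (be * i) = 0
    · simp [hκ, hne]
    · refine if_pos ⟨?_, h01⟩
      have := (mem_diag_iff _ _).1 hx _ _ _ _ hne
      rw [hd.1, hd.2] at this
      lia
  have hlt (hin : i < n) : (al * i : ℤ) < al * n :=
    mul_lt_mul_of_pos_left (by exact_mod_cast hin) (by exact_mod_cast al_pos hab)
  rw [hp] at hl
  have hinit : IsInit be n i c κ := by
    refine ⟨fun S hne => ?_, fun S hne => ?_, fun hin => ?_, fun hin => ?_⟩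
    · by_contra hc
      exact hne (if_neg hc)
    · have hA : ycoef x S (al * i) (al * i) (be * i) ≠ 0 := by
        intro h0
        exact hne (by simp [hκ, h0])
      exact (not_not.1 (mt ycoef_of_not_adm hA)).2.2
    · rw [hcard (by decide) (by decide), hcard (by decide) (by decide),
        hcard (by decide) (by decide)]
      exact hl.2.1 _ hres.1 (hlt hin)
    · rw [hcard (by decide) (by decide), hcard (by decide) (by decide)]
      exact hl.2.2.1 _ hres.1 (hlt hin)
  have hs := type1Of_isType1Rep (σ := σ) ha hb hab hi hσ hinit
  refine ⟨_, Or.inl ⟨i, c, hi, hd, (mem_type1_iff ha hb hab hi c _).2 ⟨κ, hinit, rfl⟩⟩,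
    fun S u v h2 => ?_⟩
  rw [hp, hs.lead]
  by_cases huv : u = al * i ∧ v = al * i
  · obtain ⟨rfl, rfl⟩ := huv
    rw [if_pos ⟨rfl, rfl⟩]
    by_cases hS : S = {0, 1} ∨ S = {0, 1, 2}
    · rw [hinit.eq_zero ?_]
      · by_contra hne
        obtain ⟨-, -, h01, h012⟩ := (leadSpace_cases ha hb hl hne).resolve_left (hp ▸ h2)
        exact hS.elim h01 h012
      · rcases hS with rfl | rfl
        · exact Or.inr rfl
        · left
          change 3 ≠ (c : ℕ)
          lia
    · push Not at hS
      exact (hcard hS.1 hS.2).symm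
  · rw [if_neg huv]
    by_contra hne
    rw [← hp] at hne
    obtain ⟨j, c', hj, hd', rfl, rfl, -⟩ := hpos hne h2
    obtain rfl : i = j := admissible_unique ha hb hab hi hj (by linarith [hd.2, hd'.2])
    exact huv ⟨rfl, rfl⟩

/-- The part of type 2 of a leading part. -/
theorem exists_type2 (ha : a ≠ 0) (hb : b ≠ 0) (hab : IsExponents a b al be) {x : Polyvec}
    (hx : x ∈ diag (p + q)) :
    ∃ t ∈ type2Part a b al be n p q, ∀ S u v, IsType2Pos a b (al * n) S u v (p - 1) →
      ycoef x S u v (p - 1) = ycoef t S u v (p - 1) := by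
  classical
  refine ⟨ofYcoef fun S u v w =>
    if w = p - 1 ∧ IsType2Pos a b (al * n) S u v w then ycoef x S u v w else 0, ?_, ?_⟩
  · rw [mem_type2Part_iff ha hb hab]
    intro S u v w hne
    rw [ycoef_ofYcoef] at hne
    split_ifs at hne with h1 h2
    · obtain ⟨rfl, h2⟩ := h2
      have := (mem_diag_iff _ _).1 hx _ _ _ _ hne
      exact ⟨h2, by lia, by ring⟩
    · exact absurd rfl hne
    · exact absurd rfl hne
  · intro S u v h
    rw [ycoef_ofYcoef, if_pos h.1, if_pos ⟨rfl, h⟩]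

theorem isLeadSystem_repSystem (ha : a ≠ 0) (hb : b ≠ 0) (hab : IsExponents a b al be)
    (hσ : σ.Valid a b al n) (p q : ℤ) :
    IsLeadSystem a b (al * n) p q (repSystem a b al be n σ p q) where
  mem_Z := by
    rintro _ ⟨s, hs, t, ht, rfl⟩
    refine add_mem ?_ ?_
    · obtain ⟨i, c, κ, hi, hd, hκ, -, h⟩ | ⟨-, rfl⟩ := mem_type1Part_cases ha hb hab hσ hs
      · exact h.mem_Z hd
      · exact zero_mem _
    · rw [mem_type2Part_iff ha hb hab] at ht
      have h0 := coboundary_eq_zero_of_type2 fun S u v w hne => (ht S u v w hne).1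
      refine ⟨⟨(mem_hfil_iff _ _).2 fun S u v w hne => (ht S u v w hne).2.2.ge, ?_⟩,
        (mem_diag_iff _ _).2 fun S u v w hne => ?_⟩
      · change coboundary (lambda4 a b) t ∈ hfil _
        rw [h0]
        exact zero_mem _
      · obtain ⟨-, h1, h2⟩ := ht S u v w hne
        lia
  mem_lead := by
    rintro _ ⟨s, hs, t, ht, rfl⟩
    refine add_mem ?_ ?_
    · obtain ⟨i, c, κ, hi, hd, hκ, -, h⟩ | ⟨-, rfl⟩ := mem_type1Part_cases ha hb hab hσ hs
      · rw [show p - 1 = be * i by rw [hd.2]; ring]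
        exact h.mem_leadSpace ha hb hab hi hκ
      · exact zero_mem _
    · rw [mem_type2Part_iff ha hb hab] at ht
      exact mem_leadSpace_of_type2 fun S u v hne => (ht S u v _ hne).1
  exists_eq x _ hx hl := by
    obtain ⟨s, hs, h1⟩ := exists_type1 (σ := σ) ha hb hab hσ hx hl
    obtain ⟨t, ht, h2⟩ := exists_type2 (n := n) ha hb hab hx
    refine ⟨s + t, ⟨s, hs, t, ht, rfl⟩, fun S u v => ?_⟩
    rw [ycoef_add]
    by_cases hpos : IsType2Pos a b (al * n) S u v (p - 1)
    · rw [h2 S u v hpos, show ycoef s S u v (p - 1) = 0 from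
        not_not.1 fun hne => not_type2Pos_of_type1 ha hb hab hσ hs hne hpos, zero_add]
    · rw [h1 S u v hpos, show ycoef t S u v (p - 1) = 0 from
        not_not.1 fun hne => hpos ((mem_type2Part_iff ha hb hab n p q t).1 ht _ _ _ _ hne).1,
        add_zero]
  eq_of_eq := by
    rintro _ ⟨s, hs, t, ht, rfl⟩ _ ⟨s', hs', t', ht', rfl⟩ h
    have ht2 := (mem_type2Part_iff ha hb hab n p q t).1 ht
    have ht2' := (mem_type2Part_iff ha hb hab n p q t').1 ht'
    have hlevel (S u v) : ycoef s S u v (p - 1) = ycoef s' S u v (p - 1) ∧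
        ycoef t S u v (p - 1) = ycoef t' S u v (p - 1) := by
      have h1 := h S u v
      rw [ycoef_add, ycoef_add] at h1
      by_cases hpos : IsType2Pos a b (al * n) S u v (p - 1)
      · have e : ycoef s S u v (p - 1) = 0 :=
          not_not.1 fun hne => not_type2Pos_of_type1 ha hb hab hσ hs hne hpos
        have e' : ycoef s' S u v (p - 1) = 0 :=
          not_not.1 fun hne => not_type2Pos_of_type1 ha hb hab hσ hs' hne hpos
        exact ⟨by rw [e, e'], by linarith⟩
      · have e : ycoef t S u v (p - 1) = 0 := not_not.1 fun hne => hpos (ht2 _ _ _ _ hne).1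
        have e' : ycoef t' S u v (p - 1) = 0 := not_not.1 fun hne => hpos (ht2' _ _ _ _ hne).1
        exact ⟨by linarith, by rw [e, e']⟩
    have htt : t = t' := by
      refine ycoef_ext fun S u v w => ?_
      by_cases hw : w = p - 1
      · rw [hw]
        exact (hlevel S u v).2
      · have e : ycoef t S u v w = 0 :=
          not_not.1 fun hne => hw (by linarith [(ht2 S u v w hne).2.2])
        have e' : ycoef t' S u v w = 0 :=
          not_not.1 fun hne => hw (by linarith [(ht2' S u v w hne).2.2])
        rw [e, e']
    rw [eq_of_lead_eq ha hb hab hσ hs hs' fun S u v => (hlevel S u v).1, htt]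

end System

/-- The sequences of coefficients that are chosen by solving the recursions with `C_k = 0` and
`F_k = 0` for `k ≥ 1`. -/
def solvedCoefChoice (al : ℕ) : CoefChoice where
  A _ v _ := v
  BCD i v k := Nat.rec v (fun k x =>
    (((al * i - k + 1) * (x.1 + x.2.1) - 2 * x.2.2) / (al * i - k), 0, x.2.2)) k
  EF i v k := Nat.rec v (fun k x => ((al * i - k + 1) / (al * i - k) * (x.1 - x.2), 0)) k

theorem solvedCoefChoice_valid (a b : ℝ) (al n : ℕ) : (solvedCoefChoice al).Valid a b al n where
  A_zero _ _ _ _ := rfl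
  BCD_zero _ _ _ _ := rfl
  EF_zero _ _ _ _ := rfl
  cond₀ _ _ _ _ _ _ := rfl
  cond₁ _ _ _ _ _ _ := ⟨add_zero _, rfl⟩
  cond₂ _ _ _ _ _ _ := sub_zero _

theorem InPackage.bounds {al n : ℕ} {r : ℤ} (h : InPackage al n r) :
    2 * (if n = 0 then -1 else (al * (n - 1 : ℤ))) + 4 ≤ r ∧ r ≤ 2 * (al * n) + 2 := by
  unfold InPackage at h
  split_ifs at h ⊢ with hn
  · subst hn
    subst h
    simp
  · exact ⟨by linarith [h.2.1], by linarith [h.2.2]⟩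

end Polyvec

end

theorem theorem1 (a b : ℝ) (ha : a ≠ 0) (hb : b ≠ 0) (al : ℕ) (be : ℤ)
    (hab : Polyvec.IsExponents a b al be) (n : ℕ) :
    (∀ r r' : ℤ, Polyvec.InPackage al n r → Polyvec.InPackage al n r' → ∀ hr : r ≤ r', ∀ p q : ℤ,
      ∃ e : (Polyvec.complex4 a b).E r' p q ≃ₗ[ℝ] (Polyvec.complex4 a b).E r p q,
        ∀ z : (Polyvec.complex4 a b).Z r' p q,
          e ((Polyvec.complex4 a b).cls r' p q z) =
            (Polyvec.complex4 a b).cls r p q ⟨z.1, (Polyvec.complex4 a b).Z_le hr p q z.2⟩) ∧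
    (∀ r : ℤ, Polyvec.InPackage al n r → r ≤ 2 * n * al → ∀ p q : ℤ, (Polyvec.complex4 a b).dE r p q = 0) ∧
    (∀ σ : Polyvec.CoefChoice, σ.Valid a b al n → ∀ r : ℤ, Polyvec.InPackage al n r → ∀ p q : ℤ,
      (Polyvec.complex4 a b).IsRepSystem r p q (Polyvec.repSystem a b al be n σ p q)) := by
  have hpack := Polyvec.isPackage ha hb hab n
  have hsys := Polyvec.isLeadSystem_repSystem ha hb hab (Polyvec.solvedCoefChoice_valid a b al n)
  refine ⟨fun r r' h h' hr p q => ?_, fun r h hr p q => ?_, fun σ hσ r h p q => ?_⟩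
  · exact (hsys p q).exists_equiv hpack h.bounds.1 hr h'.bounds.2
  · exact (hsys p q).dE_eq_zero hpack h.bounds.1 (by linarith)
  · exact (Polyvec.isLeadSystem_repSystem ha hb hab hσ p q).isRepSystem hpack h.bounds.1 h.bounds.2
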